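/- **Setting.** Let $F(w)=\frac1m\sum_{i=1}^m f_i(g_i(w))$ on $\mathbb R^d$, with $f_i:\mathbb R^p\to\mathbb R$ and $g_i:\mathbb R^d\to\mathbb R^p$ differentiable, each $f_i$ being $C_f$-Lipschitz and $L_f$-smooth and each $g_i$ being $C_g$-Lipschitz and $L_g$-smooth. Let $1\le B_1\le m$ and $B_2\ge 1$ be integers. At each time $t\ge2$ one draws a set $\mathcal B_1^t$, uniformly among the subsets of $\{1,\dots,m\}$ of size $B_1$, and independently of it batches $\xi_t^1,\dots,\xi_t^m$ of size $B_2$; the draws of different times are independent of each other and of the initial estimators. The stochastic values and Jacobians satisfy, for all $x,y,i$, $$\mathbb E\, g_i(x;\xi_t^i)=g_i(x),\qquad \mathbb E\,\nabla g_i(x;\xi_t^i)=\nabla g_i(x),$$ $$\mathbb E\|g_i(x;\xi_t^i)-g_i(x)\|^2\le \sigma^2/B_2,\qquad \mathbb E\|\nabla g_i(x;\xi_t^i)-\nabla g_i(x)\|^2\le\sigma^2/B_2,$$ $$\mathbb E\|g_i(x;\xi_t^i)-g_i(y;\xi_t^i)\|^2\le C_g^2\|x-y\|^2,\qquad \mathbb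 E\|\nabla g_i(x;\xi_t^i)-\nabla g_i(y;\xi_t^i)\|^2\le L_g^2\|x-y\|^2.$$ Finally $F_*=\inf F>-\infty$ and $F(w_1)-F_*\le\Delta$. **Algorithm (MSVR-v1).** Start from $(w_1,u_1,z_1)$ and, for $t\ge1$, set $w_{t+1}=w_t-\eta_tz_t$ and $$u_{t+1}^i=(1-\beta_{t+1})u_t^i+\beta_{t+1}\,g_i(w_{t+1};\xi_{t+1}^i)+\gamma_{t+1}\,\delta_{t+1}^i\quad(i\in\mathcal B_1^{t+1}),\qquad u_{t+1}^i=u_t^i\quad(i\notin\mathcal B_1^{t+1}),$$ $$z_{t+1}=\Pi\Big[(1-\alpha_{t+1})z_t+\frac{\alpha_{t+1}}{B_1}\sum_{i\in\mathcal B_1^{t+1}}\nabla g_i(w_{t+1};\xi_{t+1}^i)^{\top}\nabla f_i(u_t^i)\Big],\qquad \gamma_t=\frac{m-B_1}{B_1(1-\beta_t)}+(1-\beta_t).$$ Either $\delta_{t+1}^i=g_i(w_{t+1};\xi_{t+1}^i)-g_i(w_t;\xi_{t+1}^i)$ (MSVR estimator), and $\Pi$ is the identity or the projection onto the ball of radius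 $C_F=C_fC_g$ centred at $0$; or $\delta_{t+1}^i$ is the stochastic Jacobian $\nabla g_i(w_{t+1};\xi_{t+1}^i)$ applied to $w_{t+1}-w_t$ (single-point estimator MSVR-SP), and $\Pi$ is that projection. If $\Pi$ is the projection, also $\|z_1\|\le C_F$. For positive constants $c_\alpha,c_\beta,c_a$, put $a=c_a\,mB_2/B_1$, $$\eta_t=\min\Big\{\big(\tfrac{B_1\sqrt{B_2}}m\big)^{2/3}(a+t)^{-1/3},\ \sqrt{\min\{B_1,B_2\}}\,(a+t)^{-1/2}\Big\},\qquad \alpha_{t+1}=c_\alpha\eta_t,\qquad \beta_{t+1}=c_\beta\frac{m^2\eta_t^2}{B_1^2}.$$ After $T$ iterations the output is $w_\tau$, with $\tau$ uniform on $\{1,\dots,T\}$ and independent of everything else. The initial estimators may be random and satisfy $\frac1m\sum_i\mathbb E\|u_1^i-g_i(w_1)\|^2\le V\min\{1,\sqrt{m/B_2}\}$ and $\mathbb E\|z_1-\nabla F(w_1)\|^2\le V$. **Theorem.** There are positive constants $c_\alpha,c_\beta,c_a$, depending only on $C_f,L_f,C_g,L_g,\sigma$, and for all $\Delta,V$ a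 constant $K>0$, depending only on these five numbers and on $\Delta,V$ (in particular not on $m,B_1,B_2,d,p$ or $\varepsilon$), such that for every $\varepsilon>0$ with $B_2\le\varepsilon^{-2}$ the output is $\varepsilon$-stationary, that is $\mathbb E\|\nabla F(w_\tau)\|\le\varepsilon$, as soon as $$T\ \ge\ K\max\Big\{\frac{m\,\varepsilon^{-3}}{B_1\sqrt{B_2}}\big(1+\ln\tfrac1\varepsilon\big)^{3/2},\ \frac{\varepsilon^{-4}}{\min\{B_1,B_2\}}\big(1+\ln\tfrac1\varepsilon\big)^{2}\Big\}.$$ That is, up to powers of $\ln(1/\varepsilon)$, MSVR-v1 finds an $\varepsilon$-stationary point in $O\big(\max\{\frac{m\varepsilon^{-3}}{B_1\sqrt{B_2}},\frac{\varepsilon^{-4}}{\min\{B_1,B_2\}}\}\big)$ iterations, with no dependence on $m$ in the term of order $\varepsilon^{-4}$. -/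

import Mathlib

open MeasureTheory ProbabilityTheory
open scoped NNReal Gradient

namespace MSVR

noncomputable section

/-- `n`-dimensional Euclidean space. -/
abbrev Vec (n : ℕ) : Type := EuclideanSpace ℝ (Fin n)

/-- The objective `F(w) = (1/m) ∑ᵢ fᵢ(gᵢ(w))`. -/
def objective {d p m : ℕ} (f : Fin m → Vec p → ℝ) (g : Fin m → Vec d → Vec p)
    (w : Vec d) : ℝ :=
  (1 / (m : ℝ)) * ∑ i, f i (g i w)

/-- Projection onto the closed ball of radius `R` centred at the origin. -/
def projBall {d : ℕ} (R : ℝ) (x : Vec d) : Vec d :=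
  if ‖x‖ ≤ R then x else (R / ‖x‖) • x

/-- The step size
`η_t = min {(B₁ √B₂ / m)^(2/3) (a + t)^(-1/3), √(min {B₁, B₂}) (a + t)^(-1/2)}`. -/
def stepSize (m B₁ B₂ : ℕ) (a : ℝ) (t : ℕ) : ℝ :=
  min (((B₁ : ℝ) * √(B₂ : ℝ) / m) ^ (2 / 3 : ℝ) * (a + t) ^ (-(1 / 3) : ℝ))
    (√(min (B₁ : ℝ) (B₂ : ℝ)) * (a + t) ^ (-(1 / 2) : ℝ))

/-- The coefficient `γ = (m - B₁) / (B₁ (1 - β)) + (1 - β)` of the error correction. -/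
def gammaCoeff (m B₁ : ℕ) (β : ℝ) : ℝ :=
  ((m : ℝ) - B₁) / (B₁ * (1 - β)) + (1 - β)

/-- The variants of the method: the two-point estimator without or with projection of the
gradient estimator, and the single-point estimator (always with projection). -/
inductive Variant
  | twoPoint
  | twoPointProj
  | singlePointProj

/-- The quantity multiplied by `γ`: `gᵢ(w'; ξ) - gᵢ(w; ξ)` for the two-point estimator and
`∇gᵢ(w'; ξ)ᵀ (w' - w)` for the single-point estimator, where `w` is the previous and `w'` the
current iterate. `G` and `J` are the oracle's value and Jacobian for the block. -/
def Variant.correction {d p : ℕ} {S : Type*} (v : Variant)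
    (G : Vec d → S → Vec p) (J : Vec d → S → (Vec d →L[ℝ] Vec p))
    (w w' : Vec d) (s : S) : Vec p :=
  match v with
  | .twoPoint => G w' s - G w s
  | .twoPointProj => G w' s - G w s
  | .singlePointProj => J w' s (w' - w)

/-- The projection that is applied to the gradient estimator, if any. -/
def Variant.project {d : ℕ} (v : Variant) (R : ℝ) (x : Vec d) : Vec d :=
  match v with
  | .twoPoint => x
  | .twoPointProj => projBall R x
  | .singlePointProj => projBall R x

/-- Admissible initial gradient estimators: in the ball, when the method projects onto it. -/
def Variant.AdmitsInit {d : ℕ} (v : Variant) (R : ℝ) (z : Vec d) : Prop :=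
  match v with
  | .twoPoint => True
  | .twoPointProj => ‖z‖ ≤ R
  | .singlePointProj => ‖z‖ ≤ R

/-- The state `(w_t, u_t, z_t)` of the method. -/
structure State (d p m : ℕ) where
  /-- the iterate -/
  w : Vec d
  /-- the estimators of the inner functions, one for each block -/
  u : Fin m → Vec p
  /-- the gradient estimator -/
  z : Vec d

/-- One pass from `(w_t, u_t, z_t)` to `(w_{t+1}, u_{t+1}, z_{t+1})`, with `η = η_t`,
`α = α_{t+1}`, `β = β_{t+1}`, sampled blocks `B` and sampled batches `s i`. -/
def step {d p m : ℕ} {S : Type*} (v : Variant) (B₁ : ℕ) (R : ℝ)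
    (f : Fin m → Vec p → ℝ)
    (G : Fin m → Vec d → S → Vec p) (J : Fin m → Vec d → S → (Vec d →L[ℝ] Vec p))
    (η α β : ℝ) (B : Finset (Fin m)) (s : Fin m → S) (x : State d p m) : State d p m :=
  let w' : Vec d := x.w - η • x.z
  { w := w'
    u := fun i =>
      if i ∈ B then
        (1 - β) • x.u i + β • G i w' (s i)
          + gammaCoeff m B₁ β • v.correction (G i) (J i) x.w w' (s i)
      else x.u i
    z := v.project R
      ((1 - α) • x.z
        + (α / B₁) • ∑ i ∈ B, (J i w' (s i)).adjoint (∇ (f i) (x.u i))) }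

/-- The trajectory of MSVR-v1. The state at time `t ≥ 1` is `(w_t, u_t, z_t)`; the value at
`t = 0` is a dummy. The parameters are `η_t = stepSize m B₁ B₂ a t`, `a = ca m B₂ / B₁`,
`α_{t+1} = cα η_t` and `β_{t+1} = cβ m² η_t² / B₁²`; `blocks t` and `s t i` are the blocks and
the batches that are sampled at time `t`. -/
def run {d p m : ℕ} {S : Type*} (v : Variant) (B₁ B₂ : ℕ) (R cα cβ ca : ℝ)
    (f : Fin m → Vec p → ℝ)
    (G : Fin m → Vec d → S → Vec p) (J : Fin m → Vec d → S → (Vec d →L[ℝ] Vec p))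
    (x₁ : State d p m) (blocks : ℕ → Finset (Fin m)) (s : ℕ → Fin m → S) :
    ℕ → State d p m
  | 0 => x₁
  | 1 => x₁
  | t + 2 =>
    let η : ℝ := stepSize m B₁ B₂ (ca * (m * B₂ / B₁)) (t + 1)
    step v B₁ R f G J η (cα * η) (cβ * (m ^ 2 * η ^ 2 / B₁ ^ 2))
      (blocks (t + 2)) (s (t + 2)) (run v B₁ B₂ R cα cβ ca f G J x₁ blocks s (t + 1))

/-- Smoothness and Lipschitz continuity of the outer functions `fᵢ` and inner functions `gᵢ`. -/
structure Regular {d p m : ℕ} (Cf Lf Cg Lg : ℝ≥0)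
    (f : Fin m → Vec p → ℝ) (g : Fin m → Vec d → Vec p) : Prop where
  f_differentiable : ∀ i, Differentiable ℝ (f i)
  f_lipschitz : ∀ i, LipschitzWith Cf (f i)
  f_smooth : ∀ i, LipschitzWith Lf (∇ (f i))
  g_differentiable : ∀ i, Differentiable ℝ (g i)
  g_lipschitz : ∀ i, LipschitzWith Cg (g i)
  g_smooth : ∀ i, LipschitzWith Lg (fderiv ℝ (g i))

/-- The random variables `ξ_t^i` (batches of size `B₂`), `t ≥ 2`, with the stochastic values
`G i x ξ` of `gᵢ(x)` and stochastic Jacobians `J i x ξ` of `∇gᵢ(x)`: unbiasedness, variance at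
most `σ² / B₂`, and average Lipschitz continuity. Jacobians carry the operator norm. -/
structure Oracle {d p m : ℕ} {Ω S : Type*} [MeasurableSpace Ω] [MeasurableSpace S]
    (μ : Measure Ω) (Cg Lg : ℝ≥0) (σ : ℝ) (B₂ : ℕ) (g : Fin m → Vec d → Vec p)
    (G : Fin m → Vec d → S → Vec p) (J : Fin m → Vec d → S → (Vec d →L[ℝ] Vec p))
    (ξ : ℕ → Ω → Fin m → S) : Prop where
  measurable_value : ∀ i, Measurable fun q : Vec d × S => G i q.1 q.2
  measurable_jacobian : ∀ i, Measurable fun q : Vec d × S => J i q.1 q.2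
  measurable_sample : ∀ t, 2 ≤ t → Measurable (ξ t)
  value_integrable : ∀ t, 2 ≤ t → ∀ i x,
    Integrable (fun ω => ‖G i x (ξ t ω i) - g i x‖ ^ 2) μ
  jacobian_integrable : ∀ t, 2 ≤ t → ∀ i x,
    Integrable (fun ω => ‖J i x (ξ t ω i) - fderiv ℝ (g i) x‖ ^ 2) μ
  value_mean : ∀ t, 2 ≤ t → ∀ i x, ∫ ω, G i x (ξ t ω i) ∂μ = g i x
  jacobian_mean : ∀ t, 2 ≤ t → ∀ i x, ∫ ω, J i x (ξ t ω i) ∂μ = fderiv ℝ (g i) x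
  value_variance : ∀ t, 2 ≤ t → ∀ i x,
    ∫ ω, ‖G i x (ξ t ω i) - g i x‖ ^ 2 ∂μ ≤ σ ^ 2 / B₂
  jacobian_variance : ∀ t, 2 ≤ t → ∀ i x,
    ∫ ω, ‖J i x (ξ t ω i) - fderiv ℝ (g i) x‖ ^ 2 ∂μ ≤ σ ^ 2 / B₂
  value_avgLipschitz : ∀ t, 2 ≤ t → ∀ i x y,
    ∫ ω, ‖G i x (ξ t ω i) - G i y (ξ t ω i)‖ ^ 2 ∂μ ≤ (Cg : ℝ) ^ 2 * ‖x - y‖ ^ 2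
  jacobian_avgLipschitz : ∀ t, 2 ≤ t → ∀ i x y,
    ∫ ω, ‖J i x (ξ t ω i) - J i y (ξ t ω i)‖ ^ 2 ∂μ ≤ (Lg : ℝ) ^ 2 * ‖x - y‖ ^ 2

/-- The sampling scheme: at every time `t ≥ 2` the set of blocks is uniformly distributed over
the subsets of size `B₁` and independent of the batches of time `t`; the samples of different
times are independent of each other and of the initial estimators `(u₁, z₁)`. -/
structure Sampling {d p m : ℕ} {Ω S : Type*} [MeasurableSpace Ω] [MeasurableSpace S]
    (μ : Measure Ω) (B₁ : ℕ) (blocks : ℕ → Ω → Finset (Fin m)) (ξ : ℕ → Ω → Fin m → S)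
    (u₁ : Ω → Fin m → Vec p) (z₁ : Ω → Vec d) : Prop where
  measurable_blocks : ∀ t, 2 ≤ t → Measurable (blocks t)
  blocks_uniform : ∀ t, 2 ≤ t → ∀ B : Finset (Fin m), B.card = B₁ →
    μ.real {ω | blocks t ω = B} = 1 / (m.choose B₁ : ℝ)
  blocks_indep_batches : ∀ t, 2 ≤ t → IndepFun (blocks t) (ξ t) μ
  times_indep : iIndepFun (fun (t : ℕ) ω => (blocks (t + 2) ω, ξ (t + 2) ω)) μ
  init_indep : IndepFun (fun ω => (u₁ ω, z₁ ω))
    (fun ω (t : ℕ) => (blocks (t + 2) ω, ξ (t + 2) ω)) μ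

/-- The initialization: `F` is bounded below with `F(w₁) - inf F ≤ Δ`, and the mean squared
errors of `u₁` (averaged over the blocks) and of `z₁` are at most `V min {1, √(m / B₂)}` and
`V`. -/
structure Init {d p m : ℕ} {Ω : Type*} [MeasurableSpace Ω] (μ : Measure Ω)
    (v : Variant) (R Δ V : ℝ) (B₂ : ℕ)
    (f : Fin m → Vec p → ℝ) (g : Fin m → Vec d → Vec p)
    (w₁ : Vec d) (u₁ : Ω → Fin m → Vec p) (z₁ : Ω → Vec d) : Prop where
  bddBelow : BddBelow (Set.range (objective f g))
  gap : objective f g w₁ - ⨅ w, objective f g w ≤ Δ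
  measurable_u : Measurable u₁
  measurable_z : Measurable z₁
  u_integrable : ∀ i, Integrable (fun ω => ‖u₁ ω i - g i w₁‖ ^ 2) μ
  z_integrable : Integrable (fun ω => ‖z₁ ω - ∇ (objective f g) w₁‖ ^ 2) μ
  u_error : (1 / (m : ℝ)) * ∑ i, ∫ ω, ‖u₁ ω i - g i w₁‖ ^ 2 ∂μ
    ≤ V * min 1 √((m : ℝ) / B₂)
  z_error : ∫ ω, ‖z₁ ω - ∇ (objective f g) w₁‖ ^ 2 ∂μ ≤ V
  z_admissible : ∀ ω, v.AdmitsInit R (z₁ ω)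

end

end MSVR

namespace MSVR

open scoped ENNReal

/-! ### The step size -/

/-! Write q = B₁/m, Z_t = ‖z_t − ∇F(w_t)‖², and U_t for the average over the blocks of ‖u_t^i −
g_i(w_t)‖². The proof follows the potential Φ_t = F(w_t) − inf F + Z_t/cα + (c q/η_t) U_t and shows
that, given the state at time t, the mean of Φ_{t+1} plus (η_t/2)‖∇F(w_t)‖² is at most Φ_t + C/(a +
t) (`lyapunov_arithmetic`, `lintegral_lyapunov_step_le`).

The terms balance as follows. Descent of F costs (η/2)Z and leaves −(η/2)‖z‖² to spend. The moving
average contracts Z by 1 − cα η, which after weighting gives −ηZ. The error U enters the recursion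
of Z with a factor of order η, and its own contraction by 1 − qβ/2, after weighting, gives −(c
cβ/2)ηU. Every effect of the motion of w is a small multiple of η‖z‖². The delicate one is the drift
of the inner estimators: a block is refreshed only with probability q, and the drift D =
g_i(w_{t+1}) − g_i(w_t) correlates with the old error e. The coefficient γ is tuned so that,
averaged over refreshing or not, the terms ⟪e, D⟫ cancel; D then costs ‖D‖²/q and not ‖D‖²/(qβ)
(`error_correction_le`). The single-point correction adds only a second-order bias, controlled
because z stays in a ball.

The noise in Z contributes η²(1/B₁ + 1/B₂) and that in U contributes η³/(q²B₂), up to constants. The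
two branches of `stepSize` make each of these at most a constant over a + t. The first contribution
is free of m because a mean over B₁ blocks drawn without replacement has variance of order 1/B₁
(`blockAvg_norm_add_sq_le`).

Summing, the noise adds up to a logarithm (`sum_inv_le_log`), and since η decreases, η_T times the
sum of the E‖∇F(w_t)‖² is at most M(1 + log(1 + T/a)), up to a factor 2. `le_stepSize_of_iterations`
converts this into the iteration count. Conditional expectations are replaced by independence of the
state and the next sample (`indepFun_of_recursion`) together with Fubini at a frozen state. -/

theorem rpow_pow_eq_rpow {x : ℝ} (hx : 0 ≤ x) (y : ℝ) (n : ℕ) : (x ^ y) ^ n = x ^ (y * n) := by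
  rw [← Real.rpow_natCast, ← Real.rpow_mul hx]

theorem rpow_cube_eq {r s : ℝ} (hr : 0 ≤ r) (hs : 0 < s) :
    (r ^ (2 / 3 : ℝ) * s ^ (-(1 / 3) : ℝ)) ^ 3 = r ^ 2 / s := by
  have e1 : (2 / 3 : ℝ) * (3 : ℕ) = (2 : ℕ) := by norm_num
  have e2 : (-(1 / 3) : ℝ) * (3 : ℕ) = -1 := by norm_num
  rw [mul_pow, rpow_pow_eq_rpow hr, rpow_pow_eq_rpow hs.le, e1, e2, Real.rpow_natCast,
    Real.rpow_neg_one, div_eq_mul_inv]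

theorem sqrt_mul_rpow_sq_eq {b s : ℝ} (hb : 0 ≤ b) (hs : 0 < s) :
    (√b * s ^ (-(1 / 2) : ℝ)) ^ 2 = b / s := by
  have e : (-(1 / 2) : ℝ) * (2 : ℕ) = -1 := by norm_num
  rw [mul_pow, Real.sq_sqrt hb, rpow_pow_eq_rpow hs.le, e, Real.rpow_neg_one, div_eq_mul_inv]

section StepSize

variable {m B₁ B₂ : ℕ} {a : ℝ} {t : ℕ}

theorem ratio_sq (m B₁ B₂ : ℕ) :
    ((B₁ : ℝ) * √(B₂ : ℝ) / m) ^ 2 = ((B₁ : ℝ) / m) ^ 2 * B₂ := by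
  rw [div_pow, mul_pow, Real.sq_sqrt (Nat.cast_nonneg _)]; ring

theorem stepSize_nonneg (hs : 0 < a + t) : 0 ≤ stepSize m B₁ B₂ a t := by
  unfold stepSize
  refine le_min ?_ ?_ <;> positivity

theorem stepSize_pos (h₁ : 1 ≤ B₁) (hm : B₁ ≤ m) (h₂ : 1 ≤ B₂) (hs : 0 < a + t) :
    0 < stepSize m B₁ B₂ a t := by
  have h1 : (0 : ℝ) < B₁ := by exact_mod_cast h₁
  have h2 : (0 : ℝ) < B₂ := by exact_mod_cast h₂
  have h3 : (0 : ℝ) < m := by exact_mod_cast h₁.trans hm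
  unfold stepSize
  refine lt_min ?_ ?_ <;> positivity

/-- The first branch of the minimum, cubed. It makes the inner noise η³/(q²B₂) at most 1/(a + t). -/
theorem stepSize_cube_le (hs : 0 < a + t) :
    stepSize m B₁ B₂ a t ^ 3 ≤ ((B₁ : ℝ) / m) ^ 2 * B₂ / (a + t) := by
  rw [← ratio_sq, ← rpow_cube_eq (by positivity) hs]
  exact pow_le_pow_left₀ (stepSize_nonneg hs) (min_le_left _ _) 3

/-- The second branch, squared. It makes the noise of the gradient estimator, η²/B₁ and η²/B₂, at
most 1/(a + t). -/
theorem stepSize_sq_le (hs : 0 < a + t) :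
    stepSize m B₁ B₂ a t ^ 2 ≤ min (B₁ : ℝ) B₂ / (a + t) := by
  rw [← sqrt_mul_rpow_sq_eq (by positivity) hs]
  exact pow_le_pow_left₀ (stepSize_nonneg hs) (min_le_right _ _) 2

/-- Converse of the two preceding bounds. Together they characterize the step size by polynomial
inequalities, so the later estimates never touch fractional powers. -/
theorem le_stepSize (hs : 0 < a + t) {y : ℝ}
    (h3 : y ^ 3 ≤ ((B₁ : ℝ) / m) ^ 2 * B₂ / (a + t)) (h2 : y ^ 2 ≤ min (B₁ : ℝ) B₂ / (a + t)) :
    y ≤ stepSize m B₁ B₂ a t := by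
  rw [← ratio_sq, ← rpow_cube_eq (by positivity) hs] at h3
  rw [← sqrt_mul_rpow_sq_eq (by positivity) hs] at h2
  exact le_min (le_of_pow_le_pow_left₀ (by norm_num) (by positivity) h3)
    (le_of_pow_le_pow_left₀ (by norm_num) (by positivity) h2)

theorem stepSize_antitone {t' : ℕ} (hs : 0 < a + t) (htt : t ≤ t') :
    stepSize m B₁ B₂ a t' ≤ stepSize m B₁ B₂ a t := by
  have h : a + t ≤ a + t' := by gcongr
  have hs' := hs.trans_le h
  refine le_stepSize hs ((stepSize_cube_le hs').trans ?_) ((stepSize_sq_le hs').trans ?_) <;>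
    gcongr

/-- Consecutive step sizes differ by a factor of at most `1 + 1 / (a + t)`. -/
theorem stepSize_le_succ (hs : 0 < a + t) :
    stepSize m B₁ B₂ a t ≤ (1 + 1 / (a + t)) * stepSize m B₁ B₂ a (t + 1) := by
  set s := a + t with hsdef
  have hc : (1 : ℝ) ≤ 1 + 1 / s := by
    have : 0 < 1 / s := by positivity
    linarith
  have hs1 : a + ((t + 1 : ℕ) : ℝ) = s * (1 + 1 / s) := by
    push_cast; field_simp; rw [hsdef]; ring
  have hs' : 0 < a + ((t + 1 : ℕ) : ℝ) := by rw [hs1]; positivity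
  -- It remains to test η_t/(1 + 1/s) against the bounds at s + 1 = s(1 + 1/s). Its square and cube
  -- lose at least one factor 1 + 1/s, which is all that is needed.
  rw [← div_le_iff₀' (by positivity)]
  refine le_stepSize hs' ?_ ?_
  · rw [hs1, div_pow, ← div_div]
    refine div_le_div₀ (by positivity) (stepSize_cube_le hs) (by positivity) ?_
    calc 1 + 1 / s = (1 + 1 / s) ^ 1 := (pow_one _).symm
      _ ≤ _ := pow_le_pow_right₀ hc (by norm_num)
  · rw [hs1, div_pow, ← div_div]
    refine div_le_div₀ (by positivity) (stepSize_sq_le hs) (by positivity) ?_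
    calc 1 + 1 / s = (1 + 1 / s) ^ 1 := (pow_one _).symm
      _ ≤ _ := pow_le_pow_right₀ hc (by norm_num)

variable {N : ℝ}

/-- Since a + t ≥ N³B₂/q, the cube bound gives η³ ≤ (q/N)³. This is the purpose of the offset: with
N large, η/q, and with it α and β, is as small as desired. -/
theorem stepSize_le_ratio (h₁ : 1 ≤ B₁) (hm : B₁ ≤ m) (h₂ : 1 ≤ B₂) (hN : 0 < N) :
    stepSize m B₁ B₂ (N ^ 3 * (m * B₂ / B₁)) t ≤ (B₁ : ℝ) / m / N := by
  have h1 : (0 : ℝ) < B₁ := by exact_mod_cast h₁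
  have h2 : (0 : ℝ) < B₂ := by exact_mod_cast h₂
  have h3 : (0 : ℝ) < m := by exact_mod_cast h₁.trans hm
  have hs : 0 < N ^ 3 * (m * B₂ / B₁) + (t : ℝ) := by positivity
  refine le_of_pow_le_pow_left₀ (n := 3) (by norm_num) (by positivity)
    ((stepSize_cube_le hs).trans ?_)
  have h4 : N ^ 3 * (m * B₂ / B₁) ≤ N ^ 3 * (m * B₂ / B₁) + (t : ℝ) := by
    have : (0 : ℝ) ≤ t := Nat.cast_nonneg t
    linarith
  refine (div_le_div_of_nonneg_left (by positivity) (by positivity) h4).trans (le_of_eq ?_)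
  field_simp

/-- Controls the growth of the weight c q/η_t in the potential: its relative increase 1/s then costs
at most c η. The number √(q/s) passes both tests of `le_stepSize`, the cubic one because the offset
ensures q s ≥ 1. -/
theorem ratio_le_stepSize_sq_mul (h₁ : 1 ≤ B₁) (hm : B₁ ≤ m) (h₂ : 1 ≤ B₂) (hN : 1 ≤ N) :
    (B₁ : ℝ) / m ≤ stepSize m B₁ B₂ (N ^ 3 * (m * B₂ / B₁)) t ^ 2
      * (N ^ 3 * (m * B₂ / B₁) + t) := by
  have h1 : (1 : ℝ) ≤ B₁ := by exact_mod_cast h₁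
  have h2 : (1 : ℝ) ≤ B₂ := by exact_mod_cast h₂
  have h3 : (B₁ : ℝ) ≤ m := by exact_mod_cast hm
  have h0 : (0 : ℝ) < B₁ := by linarith
  have h0m : (0 : ℝ) < m := by linarith
  have hN3 : 1 ≤ N ^ 3 := one_le_pow₀ hN
  have hs : 0 < N ^ 3 * (m * B₂ / B₁) + (t : ℝ) := by positivity
  have hsB : (m : ℝ) / B₁ ≤ N ^ 3 * (m * B₂ / B₁) + (t : ℝ) := by
    have e : (m : ℝ) / B₁ * 1 ≤ m / B₁ * B₂ := by gcongr
    have e2 : 1 * (m * B₂ / B₁ : ℝ) ≤ N ^ 3 * (m * B₂ / B₁) := by gcongr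
    have : (0 : ℝ) ≤ t := Nat.cast_nonneg t
    have e3 : (m : ℝ) / B₁ * B₂ = m * B₂ / B₁ := by ring
    linarith
  set s := N ^ 3 * (m * B₂ / B₁) + (t : ℝ)
  have hq1 : (B₁ : ℝ) / m ≤ 1 := by rw [div_le_one h0m]; exact h3
  set q := (B₁ : ℝ) / m with hq
  have hq0 : 0 < q := by positivity
  have hqs : 1 ≤ q * s := by
    have : q * (m / B₁) = 1 := by rw [hq]; field_simp
    calc 1 = q * (m / B₁) := this.symm
      _ ≤ q * s := by gcongr
  rw [← div_le_iff₀ hs]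
  have key : √(q / s) ≤ stepSize m B₁ B₂ (N ^ 3 * (m * B₂ / B₁)) t := by
    refine le_stepSize hs ?_ ?_
    · refine le_of_pow_le_pow_left₀ (n := 2) (by norm_num) (by positivity) ?_
      have e : (√(q / s) ^ 3) ^ 2 = (√(q / s) ^ 2) ^ 3 := by ring
      have e2 : q ^ 3 * s ^ 2 * 1 ≤ q ^ 3 * s ^ 2 * (q * s * B₂ ^ 2) := by
        have : 1 ≤ q * s * B₂ ^ 2 := one_le_mul_of_one_le_of_one_le hqs (one_le_pow₀ h2)
        gcongr
      rw [e, Real.sq_sqrt (by positivity)]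
      calc (q / s) ^ 3 = q ^ 3 * s ^ 2 * 1 / s ^ 5 := by field_simp
        _ ≤ q ^ 3 * s ^ 2 * (q * s * B₂ ^ 2) / s ^ 5 := by gcongr
        _ = (q ^ 2 * B₂ / s) ^ 2 := by field_simp
    · rw [Real.sq_sqrt (by positivity)]
      gcongr
      exact hq1.trans (le_min h1 h2)
  calc q / s = √(q / s) ^ 2 := (Real.sq_sqrt (by positivity)).symm
    _ ≤ _ := by gcongr

/-- The weight of the initial error of the inner estimators stays bounded. -/
theorem ratio_mul_min_le_stepSize_one (h₁ : 1 ≤ B₁) (hm : B₁ ≤ m) (h₂ : 1 ≤ B₂) (hN : 1 ≤ N) :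
    (B₁ : ℝ) / m * min 1 √((m : ℝ) / B₂) ≤
      2 * N ^ 3 * stepSize m B₁ B₂ (N ^ 3 * (m * B₂ / B₁)) 1 := by
  have h1 : (1 : ℝ) ≤ B₁ := by exact_mod_cast h₁
  have h2 : (1 : ℝ) ≤ B₂ := by exact_mod_cast h₂
  have h3 : (B₁ : ℝ) ≤ m := by exact_mod_cast hm
  have h0 : (0 : ℝ) < B₁ := by linarith
  have h0m : (0 : ℝ) < m := by linarith
  have hN3 : 1 ≤ N ^ 3 := one_le_pow₀ hN
  have hs : 0 < N ^ 3 * (m * B₂ / B₁) + ((1 : ℕ) : ℝ) := by positivity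
  have hq1 : (B₁ : ℝ) / m ≤ 1 := by rw [div_le_one h0m]; exact h3
  have hsB : N ^ 3 * (m * B₂ / B₁) + ((1 : ℕ) : ℝ) ≤ 2 * N ^ 3 * B₂ / (B₁ / m) := by
    have e : (1 : ℝ) ≤ N ^ 3 * (m * B₂ / B₁) := by
      refine one_le_mul_of_one_le_of_one_le hN3 ?_
      rw [le_div_iff₀ h0]
      nlinarith
    have e2 : 2 * N ^ 3 * B₂ / (B₁ / m) = 2 * (N ^ 3 * (m * B₂ / B₁) : ℝ) := by
      field_simp
    rw [e2]; push_cast; linarith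
  set s := N ^ 3 * (m * B₂ / B₁) + ((1 : ℕ) : ℝ)
  have hqB : (B₁ : ℝ) / m * m = B₁ := by field_simp
  set q := (B₁ : ℝ) / m with hq
  have hq0 : 0 < q := by positivity
  have hsm : ∀ x : ℝ, 0 ≤ x → x * q / (2 * N ^ 3 * B₂) ≤ x / s := by
    intro x hx
    rw [div_le_div_iff₀ (by positivity) hs]
    rw [le_div_iff₀ hq0] at hsB
    nlinarith
  have hμ0 : 0 ≤ min 1 √((m : ℝ) / B₂) := by positivity
  have hμ1 : min 1 √((m : ℝ) / B₂) ≤ 1 := min_le_left _ _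
  have hμ2 : min 1 √((m : ℝ) / B₂) ^ 2 ≤ m / B₂ := by
    calc _ ≤ √((m : ℝ) / B₂) ^ 2 := by gcongr; exact min_le_right _ _
      _ = _ := Real.sq_sqrt (by positivity)
  set ν := min 1 √((m : ℝ) / B₂)
  rw [← div_le_iff₀' (by positivity)]
  have hν2 : ν ^ 2 ≤ 1 := pow_le_one₀ hμ0 hμ1
  have hν3 : ν ^ 3 ≤ 1 := pow_le_one₀ hμ0 hμ1
  -- The cubic test uses only ν ≤ 1. The quadratic one needs q ν² B₂ ≤ min {B₁, B₂}, hence ν² ≤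
  -- m/B₂; this explains the accuracy required of the initial inner estimators.
  refine le_stepSize hs ?_ ?_
  · refine le_trans ?_ (hsm _ (by positivity))
    have e : q ^ 2 * B₂ * q / (2 * N ^ 3 * B₂) = q ^ 3 / (2 * N ^ 3) := by field_simp
    rw [e, div_pow, mul_pow]
    refine div_le_div₀ (by positivity) (mul_le_of_le_one_right (by positivity) hν3)
      (by positivity) ?_
    exact le_self_pow₀ (by linarith) (by norm_num)
  · refine le_trans ?_ (hsm _ (by positivity))
    have hb : q * ν ^ 2 * B₂ ≤ min (B₁ : ℝ) B₂ := by
      refine le_min ?_ ?_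
      · rw [le_div_iff₀ (by linarith)] at hμ2
        calc q * ν ^ 2 * B₂ = q * (ν ^ 2 * B₂) := by ring
          _ ≤ q * m := by gcongr
          _ = B₁ := hqB
      · calc q * ν ^ 2 * B₂ ≤ 1 * 1 * B₂ := by gcongr
          _ = B₂ := by ring
    have e : (2 * N ^ 3) ≤ (2 * N ^ 3) ^ 2 := le_self_pow₀ (by linarith) (by norm_num)
    rw [div_pow, div_le_div_iff₀ (by positivity) (by positivity)]
    calc (q * ν) ^ 2 * (2 * N ^ 3 * B₂) = (q * ν ^ 2 * B₂) * q * (2 * N ^ 3) := by ring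
      _ ≤ _ := by gcongr

end StepSize

/-! ### Sums and logarithms -/

/-- Each term is at most log((a + n + 1)/(a + n)), by 1 − 1/x ≤ log x, and these telescope. -/
theorem sum_inv_le_log {a : ℝ} (ha : 0 < a) (n : ℕ) :
    ∑ k ∈ Finset.range n, 1 / (a + (k + 1 : ℕ)) ≤ Real.log (1 + n / a) := by
  induction n with
  | zero => simp
  | succ n ih =>
    rw [Finset.sum_range_succ]
    have h1 : (0 : ℝ) < a + n := by positivity
    have h2 : (0 : ℝ) < a + (n + 1 : ℕ) := by positivity
    have e1 : 1 + (n : ℝ) / a = (a + n) / a := by field_simp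
    have e2 : 1 + ((n + 1 : ℕ) : ℝ) / a = (a + (n + 1 : ℕ)) / a := by field_simp
    rw [e1, Real.log_div h1.ne' ha.ne'] at ih
    rw [e2, Real.log_div h2.ne' ha.ne']
    have := Real.one_sub_inv_le_log_of_pos (div_pos h2 h1)
    rw [Real.log_div h2.ne' h1.ne'] at this
    have e3 : 1 - ((a + (n + 1 : ℕ)) / (a + n : ℝ))⁻¹ = 1 / (a + (n + 1 : ℕ)) := by
      push_cast at h2 ⊢; field_simp; ring
    linarith

/-- If `x ≤ X ℓ² / ε⁴` with `X ≥ 1` and `ℓ = 1 + log (1 / ε)`, then `log (1 + x)` is at most `ℓ X^(1/4)`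
up to a constant. -/
theorem log_one_add_le {x X ε ℓ : ℝ} (hx : 0 ≤ x) (hX : 1 ≤ X) (hε : 0 < ε) (hε1 : ε ≤ 1)
    (hℓ : ℓ = 1 + Real.log (1 / ε)) (h : x ≤ X * (ℓ ^ 2 / ε ^ 4)) :
    Real.log (1 + x) ≤ 12 * ℓ * X ^ (1 / 4 : ℝ) := by
  have hL : 0 ≤ Real.log (1 / ε) := Real.log_nonneg (by rw [le_div_iff₀ hε]; linarith)
  have hℓ1 : 1 ≤ ℓ := by linarith
  have hy : 1 ≤ ℓ ^ 2 / ε ^ 4 := by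
    rw [le_div_iff₀ (by positivity), one_mul]
    exact (pow_le_one₀ hε.le hε1).trans (one_le_pow₀ hℓ1)
  have h1 : 1 + x ≤ 2 * (X * (ℓ ^ 2 / ε ^ 4)) := by
    have := one_le_mul_of_one_le_of_one_le hX hy
    linarith
  have h2 : Real.log (1 + x) ≤ Real.log (2 * (X * (ℓ ^ 2 / ε ^ 4))) :=
    Real.log_le_log (by linarith) h1
  -- The logarithm is traded for a small power of X, to be absorbed later by X itself. Any exponent
  -- below 1/2 would serve.
  have hX4 : Real.log X ≤ 4 * X ^ (1 / 4 : ℝ) := by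
    have := Real.log_le_rpow_div (x := X) (by linarith) (ε := 1 / 4) (by norm_num)
    linarith
  have hX1 : 1 ≤ X ^ (1 / 4 : ℝ) := Real.one_le_rpow hX (by norm_num)
  rw [Real.log_mul (by norm_num) (by positivity), Real.log_mul (by positivity) (by positivity),
    Real.log_div (by positivity) (by positivity), Real.log_pow, Real.log_pow] at h2
  have h3 : Real.log 2 ≤ 1 := by have := Real.log_two_lt_d9; linarith
  have h4 : Real.log ℓ ≤ ℓ - 1 := Real.log_le_sub_one_of_pos (by linarith)
  have h5 : Real.log (1 / ε) = - Real.log ε := by rw [one_div, Real.log_inv]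
  push_cast at h2
  have h6 : Real.log (1 + x) ≤ 6 * ℓ + 4 * X ^ (1 / 4 : ℝ) := by linarith
  have h7 : ℓ * 1 ≤ ℓ * X ^ (1 / 4 : ℝ) := by gcongr
  have h8 : 1 * X ^ (1 / 4 : ℝ) ≤ ℓ * X ^ (1 / 4 : ℝ) := by gcongr
  linarith

/-- After sufficiently many iterations the averaged bound is below `ε²`. -/
theorem le_stepSize_of_iterations {M N K : ℝ} (hM : 0 ≤ M) (hN : 1 ≤ N)
    (hKN : N ^ 3 ≤ K) (hK : 64 * (26 * M + 1) ^ 4 ≤ K)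
    {m B₁ B₂ : ℕ} (h₁ : 1 ≤ B₁) (hm : B₁ ≤ m) (h₂ : 1 ≤ B₂) {ε : ℝ} (hε : 0 < ε)
    (hB : (B₂ : ℝ) ≤ 1 / ε ^ 2) {T : ℕ}
    (hT : K * max ((m : ℝ) / (B₁ * √(B₂ : ℝ) * ε ^ 3) * (1 + Real.log (1 / ε)) ^ (3 / 2 : ℝ))
      (1 / (min (B₁ : ℝ) (B₂ : ℝ) * ε ^ 4) * (1 + Real.log (1 / ε)) ^ 2) ≤ T) :
    1 ≤ T ∧ 2 * (M * (1 + Real.log (1 + T / (N ^ 3 * (m * B₂ / B₁))))) / (ε ^ 2 * T) ≤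
      stepSize m B₁ B₂ (N ^ 3 * (m * B₂ / B₁)) T := by
  have h1 : (1 : ℝ) ≤ B₁ := by exact_mod_cast h₁
  have h2 : (1 : ℝ) ≤ B₂ := by exact_mod_cast h₂
  have h3 : (B₁ : ℝ) ≤ m := by exact_mod_cast hm
  have h0 : (0 : ℝ) < B₁ := by linarith
  have h0m : (0 : ℝ) < m := by linarith
  have hN3 : 1 ≤ N ^ 3 := one_le_pow₀ hN
  have hK1 : 1 ≤ K := hN3.trans hKN
  have hBε : B₂ * ε ^ 2 ≤ 1 := by rwa [le_div_iff₀ (by positivity)] at hB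
  have hε2 : ε ^ 2 ≤ 1 := by nlinarith [sq_nonneg ε]
  have hε1 : ε ≤ 1 := by nlinarith
  have hL : 0 ≤ Real.log (1 / ε) := Real.log_nonneg (by rw [le_div_iff₀ hε]; linarith)
  set ℓ := 1 + Real.log (1 / ε) with hℓ
  have hℓ1 : 1 ≤ ℓ := by linarith
  have hρ : (ℓ ^ (3 / 2 : ℝ)) ^ 2 = ℓ ^ 3 := by
    rw [← Real.rpow_natCast, ← Real.rpow_mul (by linarith), ← Real.rpow_natCast]; norm_num
  have hρ1 : 1 ≤ ℓ ^ (3 / 2 : ℝ) := Real.one_le_rpow hℓ1 (by norm_num)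
  have hρ2 : ℓ ^ (3 / 2 : ℝ) ≤ ℓ ^ 2 := by
    rw [← Real.rpow_natCast]; exact Real.rpow_le_rpow_of_exponent_le hℓ1 (by norm_num)
  set ρ := ℓ ^ (3 / 2 : ℝ)
  have hb1 : 1 ≤ min (B₁ : ℝ) B₂ := le_min h1 h2
  have hb2 : min (B₁ : ℝ) B₂ ≤ B₁ := min_le_left _ _
  set b := min (B₁ : ℝ) B₂
  have hsq : √(B₂ : ℝ) ^ 2 = B₂ := Real.sq_sqrt (by linarith)
  have hsq1 : 1 ≤ √(B₂ : ℝ) := by rw [Real.one_le_sqrt]; exact h2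
  have hsqe : √(B₂ : ℝ) * ε ≤ 1 := by
    refine le_of_pow_le_pow_left₀ (n := 2) (by norm_num) zero_le_one ?_
    rw [mul_pow, hsq]; linarith
  set S := √(B₂ : ℝ)
  set T₁ := (m : ℝ) / (B₁ * S * ε ^ 3) * ρ with hT₁
  set T₂ := 1 / (b * ε ^ 4) * ℓ ^ 2 with hT₂
  have hT₁0 : 0 < T₁ := by positivity
  have hT₂0 : 0 < T₂ := by positivity
  have hX₁ : K ≤ T / T₁ := by
    rw [le_div_iff₀ hT₁0]
    exact (mul_le_mul_of_nonneg_left (le_max_left _ _) (by linarith)).trans hT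
  have hX₂ : K ≤ T / T₂ := by
    rw [le_div_iff₀ hT₂0]
    exact (mul_le_mul_of_nonneg_left (le_max_right _ _) (by linarith)).trans hT
  -- `X₁` and `X₂` measure by which factor `T` exceeds the two terms of the maximum. The logarithm
  -- grows with `T`, so the claim must be proved for all such factors above `K` and not only at the
  -- threshold.
  set X₁ := (T : ℝ) / T₁ with hX₁d
  set X₂ := (T : ℝ) / T₂ with hX₂d
  have hTX₁ : (T : ℝ) = X₁ * T₁ := by rw [hX₁d]; field_simp
  have hTX₂ : (T : ℝ) = X₂ * T₂ := by rw [hX₂d]; field_simp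
  have hT0 : (0 : ℝ) < T := by rw [hTX₁]; exact mul_pos (by linarith) hT₁0
  refine ⟨Nat.one_le_iff_ne_zero.2 (by rintro rfl; simp at hT0), ?_⟩
  have ha0 : 1 ≤ m * B₂ / (B₁ : ℝ) := by
    rw [le_div_iff₀ h0]; nlinarith
  -- `T` dominates the offset
  have hTa : m * B₂ / (B₁ : ℝ) ≤ T₁ := by
    have e : m * B₂ / (B₁ : ℝ) = (m : ℝ) / (B₁ * S * ε ^ 3) * (B₂ * S * ε ^ 3) := by
      field_simp
    rw [e, hT₁]
    refine mul_le_mul_of_nonneg_left ?_ (by positivity)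
    calc B₂ * S * ε ^ 3 = (B₂ * ε ^ 2) * (S * ε) := by ring
      _ ≤ 1 * 1 := by gcongr
      _ ≤ ρ := by linarith
  have hs2 : N ^ 3 * (m * B₂ / B₁) + (T : ℝ) ≤ 2 * T := by
    have : N ^ 3 * (m * B₂ / B₁) ≤ X₁ * T₁ :=
      mul_le_mul (hKN.trans hX₁) hTa (by positivity) (by linarith)
    rw [← hTX₁] at this; linarith
  have ha1 : 1 ≤ N ^ 3 * (m * B₂ / (B₁ : ℝ)) := one_le_mul_of_one_le_of_one_le hN3 ha0
  have hma : (m : ℝ) / B₁ ≤ N ^ 3 * (m * B₂ / (B₁ : ℝ)) := by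
    calc (m : ℝ) / B₁ = 1 * (m * 1 / B₁) := by ring
      _ ≤ _ := by gcongr
  set a := N ^ 3 * (m * B₂ / (B₁ : ℝ))
  have ha00 : 0 < a := by linarith
  -- The offset `a` is at least m/B₁, so the division removes the factor m/B₁ from T₁ and the
  -- logarithm depends on ε and `X₁` alone.
  have hlog₁ : Real.log (1 + T / a) ≤ 12 * ℓ * X₁ ^ (1 / 4 : ℝ) := by
    refine log_one_add_le (by positivity) (hK1.trans hX₁) hε hε1 hℓ ?_
    rw [div_le_iff₀ ha00, hTX₁, mul_assoc]
    refine mul_le_mul_of_nonneg_left ?_ (by linarith)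
    calc T₁ = (m / B₁) * (ρ / (S * ε ^ 3)) := by rw [hT₁]; field_simp
      _ ≤ a * (ℓ ^ 2 / ε ^ 4) := by
          refine mul_le_mul hma ?_ (by positivity) ha00.le
          refine div_le_div₀ (by positivity) hρ2 (by positivity) ?_
          calc ε ^ 4 = 1 * ε ^ 3 * ε := by ring
            _ ≤ S * ε ^ 3 * 1 := by gcongr
            _ = S * ε ^ 3 := by ring
      _ = _ := by ring
  have hlog₂ : Real.log (1 + T / a) ≤ 12 * ℓ * X₂ ^ (1 / 4 : ℝ) := by
    refine log_one_add_le (by positivity) (hK1.trans hX₂) hε hε1 hℓ ?_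
    rw [div_le_iff₀ ha00, hTX₂, mul_assoc]
    refine mul_le_mul_of_nonneg_left ?_ (by linarith)
    calc T₂ = (ℓ ^ 2 / ε ^ 4) * (1 / b) := by rw [hT₂]; field_simp
      _ ≤ (ℓ ^ 2 / ε ^ 4) * a := by
          refine mul_le_mul_of_nonneg_left ?_ (by positivity)
          refine le_trans ?_ ha1
          rw [div_le_one (by linarith)]; exact hb1
  set Lg := Real.log (1 + T / a) with hLg
  have hLg0 : 0 ≤ Lg := Real.log_nonneg (by
    have : 0 ≤ T / a := by positivity
    linarith)
  -- Here 26 = 2 · (1 + 12), with 12 from `log_one_add_le`.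
  have hΛ : ∀ X : ℝ, K ≤ X → Lg ≤ 12 * ℓ * X ^ (1 / 4 : ℝ) →
      2 * (M * (1 + Lg)) ≤ (26 * M + 1) * (ℓ * X ^ (1 / 4 : ℝ)) := by
    intro X hX hl
    have hX1 : 1 ≤ X ^ (1 / 4 : ℝ) := Real.one_le_rpow (hK1.trans hX) (by norm_num)
    have e : 1 ≤ ℓ * X ^ (1 / 4 : ℝ) := one_le_mul_of_one_le_of_one_le hℓ1 hX1
    have e2 : M * (1 + Lg) ≤ M * (13 * (ℓ * X ^ (1 / 4 : ℝ))) := by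
      gcongr; linarith
    linarith
  have hXp : ∀ X : ℝ, K ≤ X → (X ^ (1 / 4 : ℝ)) ^ 4 = X := by
    intro X hX
    rw [← Real.rpow_natCast, ← Real.rpow_mul (by linarith)]; norm_num
  have hD1 : 1 ≤ 26 * M + 1 := by linarith
  set D := 26 * M + 1
  have hs : 0 < a + T := by positivity
  set Λ := 2 * (M * (1 + Lg)) with hΛd
  have hΛ0 : 0 ≤ Λ := by positivity
  -- The cubic test is met through `X₁`, the quadratic one through `X₂`. In both, X ≥ 64 D⁴ absorbs
  -- the constants and the leftover power of X^(1/4).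
  refine le_stepSize hs ?_ ?_
  · have hy := hΛ X₁ hX₁ hlog₁
    have hX4 := hXp X₁ hX₁
    have hy1 : 1 ≤ X₁ ^ (1 / 4 : ℝ) := Real.one_le_rpow (hK1.trans hX₁) (by norm_num)
    set y := X₁ ^ (1 / 4 : ℝ)
    have e1 : Λ ^ 3 ≤ D ^ 3 * ℓ ^ 3 * y ^ 3 := by
      calc Λ ^ 3 ≤ (D * (ℓ * y)) ^ 3 := by gcongr
        _ = _ := by ring
    have e2 : 2 * D ^ 3 ≤ y ^ 4 := by
      rw [hX4]
      refine le_trans ?_ (hK.trans hX₁)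
      have : D ^ 3 ≤ D ^ 4 := pow_le_pow_right₀ hD1 (by norm_num)
      have : 0 ≤ D ^ 4 := by positivity
      linarith
    have e3 : 2 * Λ ^ 3 ≤ ℓ ^ 3 * X₁ ^ 2 := by
      calc 2 * Λ ^ 3 ≤ 2 * (D ^ 3 * ℓ ^ 3 * y ^ 3) := by gcongr
        _ = (2 * D ^ 3) * ℓ ^ 3 * y ^ 3 := by ring
        _ ≤ y ^ 4 * ℓ ^ 3 * y ^ 4 := by gcongr; norm_num
        _ = ℓ ^ 3 * X₁ ^ 2 := by rw [hX4]; ring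
    have e4 : ℓ ^ 3 * X₁ ^ 2 = ε ^ 6 * T ^ 2 * (B₁ / m) ^ 2 * B₂ := by
      rw [hTX₁, hT₁, ← hρ, ← hsq]; field_simp
    calc (Λ / (ε ^ 2 * T)) ^ 3 = 2 * Λ ^ 3 / (ε ^ 6 * T ^ 2) / (2 * T) := by field_simp
      _ ≤ (ε ^ 6 * T ^ 2 * (B₁ / m) ^ 2 * B₂) / (ε ^ 6 * T ^ 2) / (2 * T) := by
          rw [← e4]; gcongr
      _ = (B₁ / m) ^ 2 * B₂ / (2 * T) := by field_simp
      _ ≤ _ := by gcongr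
  · have hy := hΛ X₂ hX₂ hlog₂
    have hX4 := hXp X₂ hX₂
    have hy1 : 1 ≤ X₂ ^ (1 / 4 : ℝ) := Real.one_le_rpow (hK1.trans hX₂) (by norm_num)
    set y := X₂ ^ (1 / 4 : ℝ)
    have e1 : Λ ^ 2 ≤ D ^ 2 * ℓ ^ 2 * y ^ 2 := by
      calc Λ ^ 2 ≤ (D * (ℓ * y)) ^ 2 := by gcongr
        _ = _ := by ring
    have e2 : 2 * D ^ 2 ≤ y ^ 2 := by
      refine le_of_pow_le_pow_left₀ (n := 2) (by norm_num) (by positivity) ?_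
      have : (y ^ 2) ^ 2 = X₂ := by rw [← hX4]; ring
      rw [this]
      refine le_trans ?_ (hK.trans hX₂)
      have : 0 ≤ D ^ 4 := by positivity
      calc (2 * D ^ 2) ^ 2 = 4 * D ^ 4 := by ring
        _ ≤ _ := by linarith
    have e3 : 2 * Λ ^ 2 ≤ ℓ ^ 2 * X₂ := by
      calc 2 * Λ ^ 2 ≤ 2 * (D ^ 2 * ℓ ^ 2 * y ^ 2) := by gcongr
        _ = (2 * D ^ 2) * ℓ ^ 2 * y ^ 2 := by ring
        _ ≤ y ^ 2 * ℓ ^ 2 * y ^ 2 := by gcongr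
        _ = ℓ ^ 2 * X₂ := by rw [← hX4]; ring
    have e4 : ℓ ^ 2 * X₂ = ε ^ 4 * T * b := by
      rw [hTX₂, hT₂]; field_simp
    calc (Λ / (ε ^ 2 * T)) ^ 2 = 2 * Λ ^ 2 / (ε ^ 4 * T) / (2 * T) := by field_simp
      _ ≤ (ε ^ 4 * T * b) / (ε ^ 4 * T) / (2 * T) := by
          rw [← e4]; gcongr
      _ = b / (2 * T) := by field_simp
      _ ≤ _ := by gcongr

/-! ### Smoothness of the objective -/

/-- Mean value inequality on the ball around x through y. The sharp constant K/2 is not needed. -/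
theorem norm_sub_sub_fderiv_le {E F : Type*} [NormedAddCommGroup E] [NormedSpace ℝ E]
    [NormedAddCommGroup F] [NormedSpace ℝ F] {φ : E → F} {K : ℝ} (hK : 0 ≤ K)
    (hd : Differentiable ℝ φ)
    (hl : ∀ x y, ‖fderiv ℝ φ x - fderiv ℝ φ y‖ ≤ K * ‖x - y‖) (x y : E) :
    ‖φ y - φ x - fderiv ℝ φ x (y - x)‖ ≤ K * ‖y - x‖ ^ 2 := by
  have h := (convex_closedBall x ‖y - x‖).norm_image_sub_le_of_norm_fderiv_le' (𝕜 := ℝ) (f := φ)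
    (φ := fderiv ℝ φ x) (C := K * ‖y - x‖) (x := x) (y := y) (fun z _ => hd z)
    (fun z hz => (hl z x).trans
      (mul_le_mul_of_nonneg_left (by simpa [dist_eq_norm] using hz) hK))
    (by simp) (by simp [dist_eq_norm])
  calc _ ≤ _ := h
    _ = _ := by ring

theorem inner_gradient_eq {E : Type*} [NormedAddCommGroup E] [InnerProductSpace ℝ E]
    [CompleteSpace E] (φ : E → ℝ) (x v : E) : inner ℝ (∇ φ x) v = fderiv ℝ φ x v := by
  rw [gradient, InnerProductSpace.toDual_symm_apply]

theorem norm_gradient_eq {E : Type*} [NormedAddCommGroup E] [InnerProductSpace ℝ E]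
    [CompleteSpace E] (φ : E → ℝ) (x : E) : ‖∇ φ x‖ = ‖fderiv ℝ φ x‖ := by
  rw [gradient, LinearIsometryEquiv.norm_map]

theorem norm_adjoint_apply_le {d p : ℕ} (A : Vec d →L[ℝ] Vec p) (v : Vec p) :
    ‖A.adjoint v‖ ≤ ‖A‖ * ‖v‖ := by
  calc ‖A.adjoint v‖ ≤ ‖A.adjoint‖ * ‖v‖ := A.adjoint.le_opNorm v
    _ = _ := by rw [LinearIsometryEquiv.norm_map]

theorem norm_inv_smul_sum_le {m : ℕ} (hm : 1 ≤ m) {E : Type*} [NormedAddCommGroup E]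
    [NormedSpace ℝ E] (h : Fin m → E) {C : ℝ} (hC : ∀ i, ‖h i‖ ≤ C) :
    ‖(1 / (m : ℝ)) • ∑ i, h i‖ ≤ C := by
  have h0 : (0 : ℝ) < m := by exact_mod_cast hm
  rw [norm_smul, Real.norm_of_nonneg (by positivity)]
  calc 1 / (m : ℝ) * ‖∑ i, h i‖ ≤ 1 / m * ∑ i : Fin m, ‖h i‖ := by gcongr; exact norm_sum_le _ _
    _ ≤ 1 / m * ∑ _i : Fin m, C := by gcongr; exact hC _
    _ = C := by simp; field_simp

/-- The gradient of the `i`-th summand with the value of the inner function replaced by `u`. -/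
noncomputable def blockGradient {d p m : ℕ} (f : Fin m → Vec p → ℝ) (g : Fin m → Vec d → Vec p)
    (w : Vec d) (u : Fin m → Vec p) (i : Fin m) : Vec d :=
  (fderiv ℝ (g i) w).adjoint (∇ (f i) (u i))

namespace Regular

variable {d p m : ℕ} {Cf Lf Cg Lg : ℝ≥0} {f : Fin m → Vec p → ℝ} {g : Fin m → Vec d → Vec p}

theorem norm_gradient_le (h : Regular Cf Lf Cg Lg f g) (i : Fin m) (x : Vec p) :
    ‖∇ (f i) x‖ ≤ Cf := by
  rw [norm_gradient_eq]; exact norm_fderiv_le_of_lipschitz ℝ (h.f_lipschitz i)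

theorem norm_fderiv_le (h : Regular Cf Lf Cg Lg f g) (i : Fin m) (x : Vec d) :
    ‖fderiv ℝ (g i) x‖ ≤ Cg :=
  norm_fderiv_le_of_lipschitz ℝ (h.g_lipschitz i)

theorem norm_g_sub_le (h : Regular Cf Lf Cg Lg f g) (i : Fin m) (x y : Vec d) :
    ‖g i x - g i y‖ ≤ Cg * ‖x - y‖ := by
  simpa [dist_eq_norm] using (h.g_lipschitz i).dist_le_mul x y

theorem norm_g_taylor_le (h : Regular Cf Lf Cg Lg f g) (i : Fin m) (x y : Vec d) :
    ‖g i y - g i x - fderiv ℝ (g i) x (y - x)‖ ≤ Lg * ‖y - x‖ ^ 2 :=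
  norm_sub_sub_fderiv_le Lg.2 (h.g_differentiable i)
    (fun x y => by simpa [dist_eq_norm] using (h.g_smooth i).dist_le_mul x y) x y

theorem hasGradientAt_objective (h : Regular Cf Lf Cg Lg f g) (w : Vec d) :
    HasGradientAt (objective f g)
      ((1 / (m : ℝ)) • ∑ i, blockGradient f g w (fun i => g i w) i) w := by
  rw [hasGradientAt_iff_hasFDerivAt]
  have h1 : HasFDerivAt (objective f g) ((1 / (m : ℝ)) • ∑ i,
      (fderiv ℝ (f i) (g i w)).comp (fderiv ℝ (g i) w)) w := by
    unfold objective
    refine HasFDerivAt.const_mul (HasFDerivAt.fun_sum fun i _ => ?_) _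
    exact (h.f_differentiable i _).hasFDerivAt.comp w (h.g_differentiable i w).hasFDerivAt
  have e : InnerProductSpace.toDual ℝ (Vec d)
      ((1 / (m : ℝ)) • ∑ i, blockGradient f g w (fun i => g i w) i)
      = (1 / (m : ℝ)) • ∑ i, (fderiv ℝ (f i) (g i w)).comp (fderiv ℝ (g i) w) := by
    refine ContinuousLinearMap.ext fun v => ?_
    simp [blockGradient, ContinuousLinearMap.adjoint_inner_left]
  rwa [e]

theorem gradient_objective (h : Regular Cf Lf Cg Lg f g) (w : Vec d) :
    ∇ (objective f g) w = (1 / (m : ℝ)) • ∑ i, blockGradient f g w (fun i => g i w) i :=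
  (h.hasGradientAt_objective w).gradient

theorem differentiable_objective (h : Regular Cf Lf Cg Lg f g) :
    Differentiable ℝ (objective f g) :=
  fun w => (h.hasGradientAt_objective w).hasFDerivAt.differentiableAt

theorem norm_blockGradient_le (h : Regular Cf Lf Cg Lg f g) (w : Vec d) (u : Fin m → Vec p)
    (i : Fin m) : ‖blockGradient f g w u i‖ ≤ Cf * Cg := by
  refine (norm_adjoint_apply_le _ _).trans ?_
  rw [mul_comm]
  exact mul_le_mul (h.norm_gradient_le i _) (h.norm_fderiv_le i _) (norm_nonneg _) Cf.2

theorem norm_gradient_objective_le (h : Regular Cf Lf Cg Lg f g) (hm : 1 ≤ m) (w : Vec d) :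
    ‖∇ (objective f g) w‖ ≤ Cf * Cg := by
  rw [h.gradient_objective]
  exact norm_inv_smul_sum_le hm _ fun i => h.norm_blockGradient_le _ _ i

theorem norm_blockGradient_sub_le (h : Regular Cf Lf Cg Lg f g) (w w' : Vec d)
    (u u' : Fin m → Vec p) (i : Fin m) :
    ‖blockGradient f g w u i - blockGradient f g w' u' i‖ ≤
      Cf * Lg * ‖w - w'‖ + Cg * Lf * ‖u i - u' i‖ := by
  have e : blockGradient f g w u i - blockGradient f g w' u' i
      = (fderiv ℝ (g i) w - fderiv ℝ (g i) w').adjoint (∇ (f i) (u i))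
        + (fderiv ℝ (g i) w').adjoint (∇ (f i) (u i) - ∇ (f i) (u' i)) := by
    simp [blockGradient, map_sub]
  rw [e]
  refine (norm_add_le _ _).trans (add_le_add ?_ ?_)
  · refine (norm_adjoint_apply_le _ _).trans ?_
    have h1 : ‖fderiv ℝ (g i) w - fderiv ℝ (g i) w'‖ ≤ Lg * ‖w - w'‖ := by
      simpa [dist_eq_norm] using (h.g_smooth i).dist_le_mul w w'
    calc _ ≤ (Lg * ‖w - w'‖) * Cf :=
          mul_le_mul h1 (h.norm_gradient_le i _) (norm_nonneg _) (by positivity)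
      _ = _ := by ring
  · refine (norm_adjoint_apply_le _ _).trans ?_
    have h1 : ‖∇ (f i) (u i) - ∇ (f i) (u' i)‖ ≤ Lf * ‖u i - u' i‖ := by
      simpa [dist_eq_norm] using (h.f_smooth i).dist_le_mul (u i) (u' i)
    calc _ ≤ Cg * (Lf * ‖u i - u' i‖) :=
          mul_le_mul (h.norm_fderiv_le i _) h1 (norm_nonneg _) Cg.2
      _ = _ := by ring

theorem norm_gradient_objective_sub_le (h : Regular Cf Lf Cg Lg f g) (hm : 1 ≤ m)
    (w w' : Vec d) :
    ‖∇ (objective f g) w - ∇ (objective f g) w'‖ ≤ (Cf * Lg + Cg ^ 2 * Lf) * ‖w - w'‖ := by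
  rw [h.gradient_objective, h.gradient_objective, ← smul_sub, ← Finset.sum_sub_distrib]
  refine norm_inv_smul_sum_le hm _ fun i => (h.norm_blockGradient_sub_le _ _ _ _ i).trans ?_
  have := mul_le_mul_of_nonneg_left (h.norm_g_sub_le i w w')
    (mul_nonneg Cg.2 Lf.2)
  calc _ ≤ Cf * Lg * ‖w - w'‖ + Cg * Lf * (Cg * ‖w - w'‖) := add_le_add le_rfl this
    _ = _ := by ring

/-- One step of inexact gradient descent. -/
theorem objective_descent (h : Regular Cf Lf Cg Lg f g) (hm : 1 ≤ m) (w z : Vec d) (η : ℝ) :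
    objective f g (w - η • z) ≤ objective f g w - η / 2 * ‖∇ (objective f g) w‖ ^ 2
      - η / 2 * ‖z‖ ^ 2 + η / 2 * ‖z - ∇ (objective f g) w‖ ^ 2
      + (Cf * Lg + Cg ^ 2 * Lf) * (η ^ 2 * ‖z‖ ^ 2) := by
  have hl : ∀ x y, ‖fderiv ℝ (objective f g) x - fderiv ℝ (objective f g) y‖ ≤
      (Cf * Lg + Cg ^ 2 * Lf : ℝ) * ‖x - y‖ := by
    intro x y
    refine le_trans (le_of_eq ?_) (h.norm_gradient_objective_sub_le hm x y)
    rw [gradient, gradient, ← map_sub, LinearIsometryEquiv.norm_map]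
  have h1 := norm_sub_sub_fderiv_le (K := Cf * Lg + Cg ^ 2 * Lf) (by positivity)
    h.differentiable_objective hl w (w - η • z)
  have e : w - η • z - w = -(η • z) := by abel
  rw [e, norm_neg, norm_smul, mul_pow, Real.norm_eq_abs η, sq_abs, ← inner_gradient_eq,
    inner_neg_right, inner_smul_right] at h1
  have h2 := (le_abs_self _).trans h1
  -- Polarization of −η⟪∇F, z⟫ produces −(η/2)‖z‖², the reserve from which all drift terms are later
  -- paid.
  rw [norm_sub_sq_real, real_inner_comm]
  linarith

end Regular

/-- By Cauchy–Schwarz, projecting a point outside the ball lowers the squared distance to y by at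
least (‖x‖ − R)². It is applied with y = ∇F, which lies in the ball of radius Cf Cg. -/
theorem norm_projBall_sub_le {d : ℕ} {R : ℝ} (x y : Vec d) (hy : ‖y‖ ≤ R) :
    ‖projBall R x - y‖ ≤ ‖x - y‖ := by
  unfold projBall
  split_ifs with hx
  · exact le_rfl
  · push Not at hx
    have hR : 0 ≤ R := (norm_nonneg y).trans hy
    have hx0 : 0 < ‖x‖ := hR.trans_lt hx
    refine le_of_pow_le_pow_left₀ (n := 2) (by norm_num) (norm_nonneg _) ?_
    rw [norm_sub_sq_real, norm_sub_sq_real, inner_smul_left, norm_smul,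
      Real.norm_of_nonneg (by positivity)]
    have e : R / ‖x‖ * ‖x‖ = R := by field_simp
    have hin : inner ℝ x y ≤ ‖x‖ * R :=
      (real_inner_le_norm x y).trans (mul_le_mul_of_nonneg_left hy hx0.le)
    have hc : 0 ≤ 1 - R / ‖x‖ := by
      have : R / ‖x‖ ≤ 1 := by rw [div_le_one hx0]; exact hx.le
      linarith
    have h1 := mul_le_mul_of_nonneg_left hin hc
    rw [e]
    simp only [conj_trivial]
    have e2 : (1 - R / ‖x‖) * (‖x‖ * R) = ‖x‖ * R - R ^ 2 := by field_simp
    nlinarith [sq_nonneg (‖x‖ - R)]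

theorem norm_projBall_le {d : ℕ} {R : ℝ} (hR : 0 ≤ R) (x : Vec d) : ‖projBall R x‖ ≤ R := by
  unfold projBall
  split_ifs with hx
  · exact hx
  · push Not at hx
    have hx0 : 0 < ‖x‖ := hR.trans_lt hx
    rw [norm_smul, Real.norm_of_nonneg (by positivity)]
    exact le_of_eq (by field_simp)

/-! ### Averages over the subsets of given size -/

/-- The mean of `h B` over the subsets `B` of `Fin m` of size `k`. -/
noncomputable def blockAvg {m : ℕ} (k : ℕ) (h : Finset (Fin m) → ℝ) : ℝ :=
  (∑ B ∈ Finset.powersetCard k Finset.univ, h B) / (m.choose k : ℝ)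

section BlockAvg

variable {m k : ℕ}

theorem choose_cast_pos (hkm : k ≤ m) : (0 : ℝ) < m.choose k := by
  exact_mod_cast Nat.choose_pos hkm

theorem blockAvg_mono {h h' : Finset (Fin m) → ℝ} (H : ∀ B, B.card = k → h B ≤ h' B) :
    blockAvg k h ≤ blockAvg k h' := by
  unfold blockAvg
  gcongr with B hB
  exact H B (Finset.mem_powersetCard_univ.1 hB)

theorem blockAvg_add (h h' : Finset (Fin m) → ℝ) :
    blockAvg k (fun B => h B + h' B) = blockAvg k h + blockAvg k h' := by
  unfold blockAvg; rw [Finset.sum_add_distrib, add_div]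

theorem blockAvg_const_mul (c : ℝ) (h : Finset (Fin m) → ℝ) :
    blockAvg k (fun B => c * h B) = c * blockAvg k h := by
  unfold blockAvg; rw [← Finset.mul_sum, mul_div_assoc]

theorem blockAvg_const (hkm : k ≤ m) (c : ℝ) : blockAvg (m := m) k (fun _ => c) = c := by
  have := choose_cast_pos hkm
  unfold blockAvg
  simp
  field_simp

theorem blockAvg_sum {ι : Type*} (s : Finset ι) (h : ι → Finset (Fin m) → ℝ) :
    blockAvg k (fun B => ∑ i ∈ s, h i B) = ∑ i ∈ s, blockAvg k (h i) := by
  unfold blockAvg; rw [Finset.sum_comm, Finset.sum_div]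

theorem card_filter_superset (A : Finset (Fin m)) (hA : A.card ≤ k) :
    ((Finset.powersetCard k (Finset.univ : Finset (Fin m))).filter (A ⊆ ·)).card
      = (m - A.card).choose (k - A.card) := by
  rw [Finset.card_filter_powersetCard_subset _ _ _ (Finset.subset_univ _) hA]
  simp

/-- The probability that a random subset of size `k` contains a given element is `k / m`. -/
theorem blockAvg_mem (hk : 1 ≤ k) (hkm : k ≤ m) (i : Fin m) :
    blockAvg k (fun B => if i ∈ B then (1 : ℝ) else 0) = (k : ℝ) / m := by
  have hc := choose_cast_pos hkm
  have h0 : (0 : ℝ) < m := by exact_mod_cast hk.trans hkm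
  unfold blockAvg
  rw [Finset.sum_boole]
  have h1 := card_filter_superset (k := k) ({i} : Finset (Fin m)) (by simpa using hk)
  simp only [Finset.singleton_subset_iff, Finset.card_singleton] at h1
  rw [h1, div_eq_div_iff hc.ne' h0.ne']
  obtain ⟨k, rfl⟩ := Nat.exists_eq_add_of_le' hk
  obtain ⟨m, rfl⟩ := Nat.exists_eq_add_of_le' (hk.trans hkm)
  have := Nat.add_one_mul_choose_eq m k
  simp only [Nat.add_sub_cancel]
  exact_mod_cast (by linarith : m.choose k * (m + 1) = (k + 1) * (m + 1).choose (k + 1))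

theorem blockAvg_ite (hk : 1 ≤ k) (hkm : k ≤ m) (i : Fin m) (x y : ℝ) :
    blockAvg k (fun B => if i ∈ B then x else y) = (k : ℝ) / m * x + (1 - (k : ℝ) / m) * y := by
  have e : (fun B : Finset (Fin m) => if i ∈ B then x else y)
      = fun B => (x - y) * (if i ∈ B then 1 else 0) + y := by
    ext B; split_ifs <;> ring
  rw [e, blockAvg_add, blockAvg_const_mul, blockAvg_mem hk hkm, blockAvg_const hkm]
  ring

/-- By symmetry all pairs are equally likely; the value of the probability is irrelevant below.
Sizes k < 2 are separate because truncated subtraction would spoil the binomial formula. -/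
theorem exists_blockAvg_mem_mem (hkm : k ≤ m) :
    ∃ P : ℝ, 0 ≤ P ∧ ∀ i j : Fin m, i ≠ j →
      blockAvg k (fun B => if i ∈ B then (if j ∈ B then (1 : ℝ) else 0) else 0) = P := by
  have hc := choose_cast_pos hkm
  by_cases hk : 2 ≤ k
  · refine ⟨((m - 2).choose (k - 2) : ℕ) / (m.choose k : ℝ), by positivity, fun i j hij => ?_⟩
    have h1 := card_filter_superset (k := k) ({i, j} : Finset (Fin m))
      (by rw [Finset.card_pair hij]; exact hk)
    rw [Finset.card_pair hij] at h1
    unfold blockAvg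
    rw [← h1]
    congr 1
    rw [← Finset.sum_boole]
    refine Finset.sum_congr rfl fun B _ => ?_
    simp only [Finset.insert_subset_iff, Finset.singleton_subset_iff]
    split_ifs <;> simp_all
  · refine ⟨0, le_rfl, fun i j hij => ?_⟩
    unfold blockAvg
    rw [Finset.sum_eq_zero, zero_div]
    intro B hB
    rw [Finset.mem_powersetCard_univ] at hB
    split_ifs with hi hj
    · have : ({i, j} : Finset (Fin m)) ⊆ B := by simp [Finset.insert_subset_iff, hi, hj]
      have := Finset.card_le_card this
      rw [Finset.card_pair hij] at this
      omega
    · rfl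
    · rfl

variable {E : Type*} [NormedAddCommGroup E] [InnerProductSpace ℝ E]

/-- Expanding the square, the off-diagonal pairs contribute P‖∑ a_i‖² = 0 up to a diagonal term −P ∑
‖a_i‖², which has the favourable sign. Thus sampling without replacement is no worse than
independent selection. -/
theorem blockAvg_norm_sum_sq_le (hk : 1 ≤ k) (hkm : k ≤ m) (a : Fin m → E) (ha : ∑ i, a i = 0) :
    blockAvg k (fun B => ‖∑ i ∈ B, a i‖ ^ 2) ≤ (k : ℝ) / m * ∑ i, ‖a i‖ ^ 2 := by
  obtain ⟨P, hP, hPij⟩ := exists_blockAvg_mem_mem (m := m) hkm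
  have e : (fun B : Finset (Fin m) => ‖∑ i ∈ B, a i‖ ^ 2) = fun B => ∑ i, ∑ j,
      inner ℝ (a i) (a j) * (if i ∈ B then (if j ∈ B then (1 : ℝ) else 0) else 0) := by
    ext B
    rw [← real_inner_self_eq_norm_sq, sum_inner]
    simp_rw [inner_sum]
    rw [← Finset.univ_inter B, ← Finset.sum_ite_mem]
    refine Finset.sum_congr rfl fun i _ => ?_
    by_cases hi : i ∈ B <;> simp [hi]
  have e2 : ∀ i j : Fin m, blockAvg k (fun B => inner ℝ (a i) (a j) *
      (if i ∈ B then (if j ∈ B then (1 : ℝ) else 0) else 0))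
      = P * inner ℝ (a i) (a j) + if i = j then ((k : ℝ) / m - P) * ‖a i‖ ^ 2 else 0 := by
    intro i j
    rw [blockAvg_const_mul]
    split_ifs with hij
    · subst hij
      have : (fun B : Finset (Fin m) => if i ∈ B then (if i ∈ B then (1 : ℝ) else 0) else 0)
          = fun B => if i ∈ B then 1 else 0 := by
        ext B; split_ifs <;> rfl
      rw [this, blockAvg_mem hk hkm, real_inner_self_eq_norm_sq]; ring
    · rw [hPij i j hij]; ring
  rw [e, blockAvg_sum]
  simp_rw [blockAvg_sum, e2, Finset.sum_add_distrib, ← Finset.mul_sum, ← inner_sum, ← sum_inner]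
  rw [ha]
  simp only [inner_zero_left, mul_zero, zero_add, Finset.sum_ite_eq, Finset.mem_univ, if_true]
  rw [← Finset.mul_sum]
  refine mul_le_mul_of_nonneg_right (by linarith) (Finset.sum_nonneg fun i _ => by positivity)

/-- Sampling without replacement: the mean squared distance to `c` of a shifted block mean. -/
theorem blockAvg_norm_add_sq_le (hk : 1 ≤ k) (hkm : k ≤ m) (c : E) (α : ℝ) (h : Fin m → E) :
    blockAvg k (fun B => ‖c + α • ((1 / (k : ℝ)) • ∑ i ∈ B, h i
        - (1 / (m : ℝ)) • ∑ i, h i)‖ ^ 2) ≤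
      ‖c‖ ^ 2 + α ^ 2 / k * ((1 / (m : ℝ)) * ∑ i, ‖h i‖ ^ 2) := by
  have h0 : (0 : ℝ) < m := by exact_mod_cast hk.trans hkm
  have hk0 : (0 : ℝ) < k := by exact_mod_cast hk
  set hb := (1 / (m : ℝ)) • ∑ i, h i with hbdef
  have hmb : (m : ℝ) • hb = ∑ i, h i := by
    rw [hbdef, smul_smul, mul_one_div_cancel h0.ne', one_smul]
  have ha : ∑ i, (h i - hb) = 0 := by
    rw [Finset.sum_sub_distrib, ← hmb]
    simp [Nat.cast_smul_eq_nsmul]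
  have hvar : ∑ i, ‖h i - hb‖ ^ 2 ≤ ∑ i, ‖h i‖ ^ 2 := by
    have e : ∀ i, ‖h i - hb‖ ^ 2 = ‖h i‖ ^ 2 - 2 * inner ℝ (h i) hb + ‖hb‖ ^ 2 :=
      fun i => norm_sub_sq_real _ _
    simp_rw [e, Finset.sum_add_distrib, Finset.sum_sub_distrib, ← Finset.mul_sum, ← sum_inner]
    rw [← hmb, inner_smul_left, real_inner_self_eq_norm_sq]
    simp
    nlinarith [sq_nonneg ‖hb‖]
  -- After centring, the cross term with `c` is linear in vectors of sum zero and vanishes on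
  -- average.
  have e1 : ∀ B : Finset (Fin m), B.card = k →
      ‖c + α • ((1 / (k : ℝ)) • ∑ i ∈ B, h i - hb)‖ ^ 2
        = ‖c‖ ^ 2 + (∑ i, 2 * (α / k) * (inner ℝ c (h i - hb) * if i ∈ B then 1 else 0)
          + (α / k) ^ 2 * ‖∑ i ∈ B, (h i - hb)‖ ^ 2) := by
    intro B hB
    have e : α • ((1 / (k : ℝ)) • ∑ i ∈ B, h i - hb) = (α / k) • ∑ i ∈ B, (h i - hb) := by
      rw [Finset.sum_sub_distrib, Finset.sum_const, hB, smul_sub, smul_sub,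
        ← Nat.cast_smul_eq_nsmul ℝ, smul_smul (α / k) (k : ℝ), div_mul_cancel₀ _ hk0.ne',
        smul_smul, mul_one_div]
    rw [e, norm_add_sq_real, inner_smul_right, inner_sum, norm_smul, mul_pow, Real.norm_eq_abs,
      sq_abs]
    simp only [mul_ite, mul_one, mul_zero, Finset.sum_ite_mem, Finset.univ_inter]
    rw [← Finset.mul_sum]
    ring
  calc _ ≤ blockAvg k (fun B => ‖c‖ ^ 2 + (∑ i, 2 * (α / k) *
            (inner ℝ c (h i - hb) * if i ∈ B then 1 else 0)
          + (α / k) ^ 2 * ‖∑ i ∈ B, (h i - hb)‖ ^ 2)) :=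
        blockAvg_mono fun B hB => (e1 B hB).le
    _ = ‖c‖ ^ 2 + (α / k) ^ 2 * blockAvg k (fun B => ‖∑ i ∈ B, (h i - hb)‖ ^ 2) := by
        rw [blockAvg_add, blockAvg_const hkm, blockAvg_add, blockAvg_const_mul, blockAvg_sum]
        simp_rw [blockAvg_const_mul, blockAvg_mem hk hkm]
        rw [← Finset.mul_sum, ← Finset.sum_mul, ← inner_sum, ha]
        simp
    _ ≤ ‖c‖ ^ 2 + (α / k) ^ 2 * ((k : ℝ) / m * ∑ i, ‖h i - hb‖ ^ 2) := by
        gcongr; exact blockAvg_norm_sum_sq_le hk hkm _ ha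
    _ ≤ ‖c‖ ^ 2 + (α / k) ^ 2 * ((k : ℝ) / m * ∑ i, ‖h i‖ ^ 2) := by gcongr
    _ = _ := by field_simp

end BlockAvg

/-! ### Mean square of random vectors -/

section MeanSquare

variable {Ω : Type*} [MeasurableSpace Ω] {μ : Measure Ω}
  {E : Type*} [NormedAddCommGroup E]

theorem MemLp_two.integrable_norm_sq {X : Ω → E} (hX : MemLp X 2 μ) :
    Integrable (fun ω => ‖X ω‖ ^ 2) μ :=
  (memLp_two_iff_integrable_sq_norm hX.1).1 hX

theorem memLp_of_sub_const [IsFiniteMeasure μ] {X : Ω → E} {c : E}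
    (h : MemLp (fun ω => X ω - c) 2 μ) : MemLp X 2 μ :=
  (h.add (memLp_const c)).ae_eq (ae_of_all _ fun ω => sub_add_cancel (X ω) c)

theorem integral_norm_add_sq_le [NormedSpace ℝ E] {X Y : Ω → E} (hX : MemLp X 2 μ)
    (hY : MemLp Y 2 μ) :
    ∫ ω, ‖X ω + Y ω‖ ^ 2 ∂μ ≤ 2 * ∫ ω, ‖X ω‖ ^ 2 ∂μ + 2 * ∫ ω, ‖Y ω‖ ^ 2 ∂μ := by
  have iX := MemLp_two.integrable_norm_sq hX
  have iY := MemLp_two.integrable_norm_sq hY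
  rw [← integral_const_mul, ← integral_const_mul, ← integral_add (iX.const_mul 2) (iY.const_mul 2)]
  refine integral_mono (MemLp_two.integrable_norm_sq (hX.add hY))
    ((iX.const_mul 2).add (iY.const_mul 2)) fun ω => ?_
  have h1 := norm_add_le (X ω) (Y ω)
  have h2 := norm_nonneg (X ω + Y ω)
  calc ‖X ω + Y ω‖ ^ 2 ≤ (‖X ω‖ + ‖Y ω‖) ^ 2 := by gcongr
    _ ≤ 2 * ‖X ω‖ ^ 2 + 2 * ‖Y ω‖ ^ 2 := by nlinarith [sq_nonneg (‖X ω‖ - ‖Y ω‖)]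

variable [InnerProductSpace ℝ E] [CompleteSpace E] [IsProbabilityMeasure μ]

theorem integral_norm_const_add_sq {X : Ω → E} (hX : MemLp X 2 μ) (h0 : ∫ ω, X ω ∂μ = 0) (c : E) :
    ∫ ω, ‖c + X ω‖ ^ 2 ∂μ = ‖c‖ ^ 2 + ∫ ω, ‖X ω‖ ^ 2 ∂μ := by
  have i1 : Integrable X μ := hX.integrable (by norm_num)
  have i2 := MemLp_two.integrable_norm_sq hX
  have i3 : Integrable (fun ω => 2 * inner ℝ c (X ω)) μ := (i1.const_inner c).const_mul 2
  have i4 : Integrable (fun ω => ‖c‖ ^ 2 + 2 * inner ℝ c (X ω)) μ := (integrable_const _).add i3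
  simp_rw [norm_add_sq_real]
  rw [integral_add i4 i2, integral_add (integrable_const _) i3,
    integral_const_mul, integral_inner i1, h0]
  simp

theorem integral_norm_sub_mean_sq_le {X : Ω → E} (hX : MemLp X 2 μ) :
    ∫ ω, ‖X ω - ∫ ω', X ω' ∂μ‖ ^ 2 ∂μ ≤ ∫ ω, ‖X ω‖ ^ 2 ∂μ := by
  have i1 : Integrable X μ := hX.integrable (by norm_num)
  have h := integral_norm_const_add_sq (X := fun ω => X ω - ∫ ω', X ω' ∂μ)
    (hX.sub (memLp_const _)) (by rw [integral_sub i1 (integrable_const _)]; simp)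
    (∫ ω', X ω' ∂μ)
  simp only [add_sub_cancel] at h
  rw [h]
  nlinarith [sq_nonneg ‖∫ ω', X ω' ∂μ‖]

end MeanSquare

/-- The linear map `A ↦ Aᵀ v`. -/
noncomputable def adjointApply {d p : ℕ} (v : Vec p) : (Vec d →L[ℝ] Vec p) →L[ℝ] Vec d :=
  LinearMap.toContinuousLinearMap
    { toFun := fun A => A.adjoint v
      map_add' := fun A B => by simp
      map_smul' := fun c A => by simp }

/-! ### The oracle at a fixed state -/

/-- The expected correction. -/
noncomputable def Variant.meanCorrection {d p : ℕ} (v : Variant) (g : Vec d → Vec p)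
    (w w' : Vec d) : Vec p :=
  v.correction (fun x (_ : Unit) => g x) (fun x _ => fderiv ℝ g x) w w' ()

/-- The two-point correction is unbiased. For the single-point one the bias is a Taylor remainder of
order η²‖z‖²; projection bounds one factor ‖z‖ by R, so the squared bias is η² times the squared
displacement, up to constants. -/
theorem Regular.norm_meanCorrection_sub_le {d p m : ℕ} {Cf Lf Cg Lg : ℝ≥0}
    {f : Fin m → Vec p → ℝ} {g : Fin m → Vec d → Vec p} (h : Regular Cf Lf Cg Lg f g)
    (v : Variant) {R : ℝ} {z : Vec d} (hz : v.AdmitsInit R z) (i : Fin m) (w : Vec d) (η : ℝ) :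
    ‖v.meanCorrection (g i) w (w - η • z) - (g i (w - η • z) - g i w)‖ ^ 2 ≤
      Lg ^ 2 * R ^ 2 * (η ^ 2 * (η ^ 2 * ‖z‖ ^ 2)) := by
  have hnn : 0 ≤ Lg ^ 2 * R ^ 2 * (η ^ 2 * (η ^ 2 * ‖z‖ ^ 2)) := by positivity
  match v with
  | .twoPoint => simpa [Variant.meanCorrection, Variant.correction] using hnn
  | .twoPointProj => simpa [Variant.meanCorrection, Variant.correction] using hnn
  | .singlePointProj =>
    simp only [Variant.AdmitsInit] at hz
    simp only [Variant.meanCorrection, Variant.correction]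
    have h1 := h.norm_g_taylor_le i (w - η • z) w
    have e : g i w - g i (w - η • z) - fderiv ℝ (g i) (w - η • z) (w - (w - η • z))
        = fderiv ℝ (g i) (w - η • z) (w - η • z - w) - (g i (w - η • z) - g i w) := by
      rw [← neg_sub (w - η • z) w, map_neg]; abel
    have e2 : w - (w - η • z) = η • z := by abel
    rw [e, e2, norm_smul, mul_pow, Real.norm_eq_abs η, sq_abs] at h1
    have h2 : ‖z‖ ^ 2 ≤ R * ‖z‖ := by rw [sq]; gcongr
    calc _ ≤ (Lg * (η ^ 2 * (R * ‖z‖))) ^ 2 := by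
          refine pow_le_pow_left₀ (norm_nonneg _) (h1.trans ?_) 2
          gcongr
      _ = _ := by ring

namespace Oracle

variable {d p m : ℕ} {Ω S : Type*} [MeasurableSpace Ω] [MeasurableSpace S]
  {μ : Measure Ω} {Cf Lf Cg Lg : ℝ≥0} {σ : ℝ} {B₂ : ℕ}
  {f : Fin m → Vec p → ℝ} {g : Fin m → Vec d → Vec p}
  {G : Fin m → Vec d → S → Vec p} {J : Fin m → Vec d → S → (Vec d →L[ℝ] Vec p)}
  {ξ : ℕ → Ω → Fin m → S}

theorem measurable_batch (H : Oracle μ Cg Lg σ B₂ g G J ξ) {t : ℕ} (ht : 2 ≤ t) (i : Fin m) :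
    Measurable fun ω => ξ t ω i :=
  (measurable_pi_apply i).comp (H.measurable_sample t ht)

theorem measurable_value_at (H : Oracle μ Cg Lg σ B₂ g G J ξ) {t : ℕ} (ht : 2 ≤ t) (i : Fin m)
    (x : Vec d) : Measurable fun ω => G i x (ξ t ω i) :=
  (H.measurable_value i).comp (measurable_const.prodMk (H.measurable_batch ht i))

theorem measurable_jacobian_at (H : Oracle μ Cg Lg σ B₂ g G J ξ) {t : ℕ} (ht : 2 ≤ t) (i : Fin m)
    (x : Vec d) : Measurable fun ω => J i x (ξ t ω i) :=
  (H.measurable_jacobian i).comp (measurable_const.prodMk (H.measurable_batch ht i))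

theorem memLp_value_sub (H : Oracle μ Cg Lg σ B₂ g G J ξ) {t : ℕ} (ht : 2 ≤ t) (i : Fin m)
    (x : Vec d) : MemLp (fun ω => G i x (ξ t ω i) - g i x) 2 μ :=
  (memLp_two_iff_integrable_sq_norm
    ((H.measurable_value_at ht i x).sub_const _).aestronglyMeasurable).2
    (H.value_integrable t ht i x)

theorem memLp_jacobian_sub (H : Oracle μ Cg Lg σ B₂ g G J ξ) {t : ℕ} (ht : 2 ≤ t) (i : Fin m)
    (x : Vec d) : MemLp (fun ω => J i x (ξ t ω i) - fderiv ℝ (g i) x) 2 μ :=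
  (memLp_two_iff_integrable_sq_norm
    ((H.measurable_jacobian_at ht i x).sub_const _).aestronglyMeasurable).2
    (H.jacobian_integrable t ht i x)

variable [IsProbabilityMeasure μ]

theorem memLp_value (H : Oracle μ Cg Lg σ B₂ g G J ξ) {t : ℕ} (ht : 2 ≤ t) (i : Fin m)
    (x : Vec d) : MemLp (fun ω => G i x (ξ t ω i)) 2 μ :=
  memLp_of_sub_const (H.memLp_value_sub ht i x)

theorem memLp_jacobian (H : Oracle μ Cg Lg σ B₂ g G J ξ) {t : ℕ} (ht : 2 ≤ t) (i : Fin m)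
    (x : Vec d) : MemLp (fun ω => J i x (ξ t ω i)) 2 μ :=
  memLp_of_sub_const (H.memLp_jacobian_sub ht i x)

theorem integral_value_sub (H : Oracle μ Cg Lg σ B₂ g G J ξ) {t : ℕ} (ht : 2 ≤ t) (i : Fin m)
    (x : Vec d) : ∫ ω, (G i x (ξ t ω i) - g i x) ∂μ = 0 := by
  rw [integral_sub ((H.memLp_value ht i x).integrable (by norm_num)) (integrable_const _),
    H.value_mean t ht i x]
  simp

theorem integral_jacobian_sub (H : Oracle μ Cg Lg σ B₂ g G J ξ) {t : ℕ} (ht : 2 ≤ t) (i : Fin m)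
    (x : Vec d) : ∫ ω, (J i x (ξ t ω i) - fderiv ℝ (g i) x) ∂μ = 0 := by
  rw [integral_sub ((H.memLp_jacobian ht i x).integrable (by norm_num)) (integrable_const _),
    H.jacobian_mean t ht i x]
  simp

theorem variance_le (h₂ : 1 ≤ B₂) : σ ^ 2 / B₂ ≤ σ ^ 2 :=
  div_le_self (sq_nonneg _) (by exact_mod_cast h₂)

theorem memLp_correction (H : Oracle μ Cg Lg σ B₂ g G J ξ) {t : ℕ} (ht : 2 ≤ t) (v : Variant)
    (i : Fin m) (w w' : Vec d) :
    MemLp (fun ω => v.correction (G i) (J i) w w' (ξ t ω i)) 2 μ := by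
  match v with
  | .twoPoint => exact (H.memLp_value ht i w').sub (H.memLp_value ht i w)
  | .twoPointProj => exact (H.memLp_value ht i w').sub (H.memLp_value ht i w)
  | .singlePointProj =>
    exact (ContinuousLinearMap.apply ℝ (Vec p) (w' - w)).comp_memLp' (H.memLp_jacobian ht i w')

theorem integral_correction (H : Oracle μ Cg Lg σ B₂ g G J ξ) {t : ℕ} (ht : 2 ≤ t) (v : Variant)
    (i : Fin m) (w w' : Vec d) :
    ∫ ω, v.correction (G i) (J i) w w' (ξ t ω i) ∂μ = v.meanCorrection (g i) w w' := by
  have hG : ∫ ω, (G i w' (ξ t ω i) - G i w (ξ t ω i)) ∂μ = g i w' - g i w := by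
    rw [integral_sub ((H.memLp_value ht i w').integrable (by norm_num))
      ((H.memLp_value ht i w).integrable (by norm_num)), H.value_mean t ht, H.value_mean t ht]
  match v with
  | .twoPoint => exact hG
  | .twoPointProj => exact hG
  | .singlePointProj =>
    have := (ContinuousLinearMap.apply ℝ (Vec p) (w' - w)).integral_comp_comm
      ((H.memLp_jacobian ht i w').integrable (by norm_num))
    rw [H.jacobian_mean t ht] at this
    exact this

/-- For two points the variance is at most the second moment, bounded by average Lipschitz
continuity; for a single point the Jacobian variance applies. The sum Cg² + σ² covers both. -/
theorem integral_norm_correction_sub_sq_le (H : Oracle μ Cg Lg σ B₂ g G J ξ) (h₂ : 1 ≤ B₂)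
    {t : ℕ} (ht : 2 ≤ t) (v : Variant) (i : Fin m) (w w' : Vec d) :
    ∫ ω, ‖v.correction (G i) (J i) w w' (ξ t ω i) - v.meanCorrection (g i) w w'‖ ^ 2 ∂μ ≤
      (Cg ^ 2 + σ ^ 2) * ‖w' - w‖ ^ 2 := by
  have h0 : ∫ ω, ‖G i w' (ξ t ω i) - G i w (ξ t ω i)‖ ^ 2 ∂μ
      ≤ (Cg ^ 2 + σ ^ 2) * ‖w' - w‖ ^ 2 := by
    refine (H.value_avgLipschitz t ht i w' w).trans ?_
    gcongr
    nlinarith [sq_nonneg σ]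
  have h1 := integral_norm_sub_mean_sq_le (H.memLp_correction ht v i w w')
  rw [H.integral_correction ht] at h1
  match v with
  | .twoPoint => exact h1.trans h0
  | .twoPointProj => exact h1.trans h0
  | .singlePointProj =>
    simp only [Variant.meanCorrection, Variant.correction, ← sub_apply]
    calc _ ≤ ∫ ω, ‖J i w' (ξ t ω i) - fderiv ℝ (g i) w'‖ ^ 2 * ‖w' - w‖ ^ 2 ∂μ := by
          refine integral_mono_of_nonneg (ae_of_all _ fun ω => by positivity)
            ((H.jacobian_integrable t ht i w').mul_const _) (ae_of_all _ fun ω => ?_)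
          dsimp only
          rw [← mul_pow]
          gcongr
          exact ContinuousLinearMap.le_opNorm _ _
      _ ≤ σ ^ 2 * ‖w' - w‖ ^ 2 := by
          rw [integral_mul_const]
          gcongr
          exact (H.jacobian_variance t ht i w').trans (variance_le h₂)
      _ ≤ _ := by gcongr; nlinarith [sq_nonneg (Cg : ℝ)]

/-- The expected squared error of an updated inner estimator. -/
theorem updated_value_error (H : Oracle μ Cg Lg σ B₂ g G J ξ) (h₂ : 1 ≤ B₂)
    {t : ℕ} (ht : 2 ≤ t) (v : Variant) (i : Fin m) (w w' : Vec d) (u : Vec p) (β γ : ℝ) :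
    Integrable (fun ω => ‖(1 - β) • u + β • G i w' (ξ t ω i)
      + γ • v.correction (G i) (J i) w w' (ξ t ω i) - g i w'‖ ^ 2) μ ∧
    ∫ ω, ‖(1 - β) • u + β • G i w' (ξ t ω i)
      + γ • v.correction (G i) (J i) w w' (ξ t ω i) - g i w'‖ ^ 2 ∂μ ≤
    ‖(1 - β) • (u - g i w') + γ • v.meanCorrection (g i) w w'‖ ^ 2
      + (2 * (β ^ 2 * (σ ^ 2 / B₂)) + 2 * (γ ^ 2 * ((Cg ^ 2 + σ ^ 2) * ‖w' - w‖ ^ 2))) := by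
  set c := (1 - β) • (u - g i w') + γ • v.meanCorrection (g i) w w' with hc
  have m1 : MemLp (fun ω => β • (G i w' (ξ t ω i) - g i w')) 2 μ :=
    (H.memLp_value_sub ht i w').const_smul β
  have m2' : MemLp (fun ω => v.correction (G i) (J i) w w' (ξ t ω i)
      - v.meanCorrection (g i) w w') 2 μ :=
    (H.memLp_correction ht v i w w').sub (memLp_const _)
  have m2 : MemLp (fun ω => γ • (v.correction (G i) (J i) w w' (ξ t ω i)
      - v.meanCorrection (g i) w w')) 2 μ := m2'.const_smul γ
  have z2 : ∫ ω, (v.correction (G i) (J i) w w' (ξ t ω i)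
      - v.meanCorrection (g i) w w') ∂μ = 0 := by
    rw [integral_sub ((H.memLp_correction ht v i w w').integrable (by norm_num))
      (integrable_const _), H.integral_correction ht]
    simp
  -- Mean plus centred noise, so that the squares add without a cross term.
  have e : ∀ ω, (1 - β) • u + β • G i w' (ξ t ω i)
      + γ • v.correction (G i) (J i) w w' (ξ t ω i) - g i w'
      = c + (β • (G i w' (ξ t ω i) - g i w') + γ • (v.correction (G i) (J i) w w' (ξ t ω i)
      - v.meanCorrection (g i) w w')) := by
    intro ω
    rw [hc]; module
  simp_rw [e]
  have m3 : MemLp (fun ω => β • (G i w' (ξ t ω i) - g i w')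
      + γ • (v.correction (G i) (J i) w w' (ξ t ω i) - v.meanCorrection (g i) w w')) 2 μ :=
    m1.add m2
  refine ⟨MemLp_two.integrable_norm_sq ((memLp_const c).add m3), ?_⟩
  have z3 : ∫ ω, (β • (G i w' (ξ t ω i) - g i w') + γ • (v.correction (G i) (J i) w w' (ξ t ω i)
      - v.meanCorrection (g i) w w')) ∂μ = 0 := by
    rw [integral_add (m1.integrable (by norm_num)) (m2.integrable (by norm_num)),
      integral_smul, integral_smul, z2, H.integral_value_sub ht]
    simp
  rw [integral_norm_const_add_sq m3 z3 c]
  gcongr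
  refine (integral_norm_add_sq_le m1 m2).trans ?_
  simp_rw [norm_smul, mul_pow, Real.norm_eq_abs, sq_abs]
  rw [integral_const_mul, integral_const_mul]
  gcongr
  · exact H.value_variance t ht i w'
  · exact H.integral_norm_correction_sub_sq_le h₂ ht v i w w'

end Oracle

theorem norm_sum_sq_le {ι E : Type*} [NormedAddCommGroup E] (s : Finset ι) (x : ι → E) :
    ‖∑ i ∈ s, x i‖ ^ 2 ≤ s.card * ∑ i ∈ s, ‖x i‖ ^ 2 := by
  calc _ ≤ (∑ i ∈ s, ‖x i‖) ^ 2 := by gcongr; exact norm_sum_le _ _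
    _ ≤ _ := sq_sum_le_card_mul_sum_sq

theorem Variant.norm_project_sub_le {d : ℕ} (v : Variant) {R : ℝ} (x y : Vec d) (hy : ‖y‖ ≤ R) :
    ‖v.project R x - y‖ ≤ ‖x - y‖ := by
  match v with
  | .twoPoint => exact le_rfl
  | .twoPointProj => exact norm_projBall_sub_le x y hy
  | .singlePointProj => exact norm_projBall_sub_le x y hy

theorem measurable_projBall {d : ℕ} (R : ℝ) : Measurable (projBall (d := d) R) := by
  unfold projBall
  refine Measurable.ite (measurableSet_le measurable_norm measurable_const) measurable_id ?_
  exact (measurable_const.div measurable_norm).smul measurable_id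

theorem Variant.measurable_project {d : ℕ} (v : Variant) (R : ℝ) :
    Measurable (v.project (d := d) R) := by
  match v with
  | .twoPoint => exact measurable_id
  | .twoPointProj => exact measurable_projBall R
  | .singlePointProj => exact measurable_projBall R

namespace Oracle

variable {d p m : ℕ} {Ω S : Type*} [MeasurableSpace Ω] [MeasurableSpace S]
  {μ : Measure Ω} {Cf Lf Cg Lg : ℝ≥0} {σ : ℝ} {B₂ : ℕ}
  {f : Fin m → Vec p → ℝ} {g : Fin m → Vec d → Vec p}
  {G : Fin m → Vec d → S → Vec p} {J : Fin m → Vec d → S → (Vec d →L[ℝ] Vec p)}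
  {ξ : ℕ → Ω → Fin m → S}

theorem memLp_blockNoise (H : Oracle μ Cg Lg σ B₂ g G J ξ) {t : ℕ} (ht : 2 ≤ t)
    (i : Fin m) (w' : Vec d) (y : Vec p) :
    MemLp (fun ω => (J i w' (ξ t ω i) - fderiv ℝ (g i) w').adjoint y) 2 μ :=
  (adjointApply y).comp_memLp' (H.memLp_jacobian_sub ht i w')

theorem integral_blockNoise [IsProbabilityMeasure μ] (H : Oracle μ Cg Lg σ B₂ g G J ξ)
    {t : ℕ} (ht : 2 ≤ t)
    (i : Fin m) (w' : Vec d) (y : Vec p) :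
    ∫ ω, (J i w' (ξ t ω i) - fderiv ℝ (g i) w').adjoint y ∂μ = 0 := by
  have h := (adjointApply y).integral_comp_comm
    ((H.memLp_jacobian_sub ht i w').integrable (by norm_num))
  rw [H.integral_jacobian_sub ht, map_zero] at h
  exact h

theorem integral_norm_blockNoise_sq_le (H : Oracle μ Cg Lg σ B₂ g G J ξ) {t : ℕ} (ht : 2 ≤ t)
    (i : Fin m) (w' : Vec d) {y : Vec p} {C : ℝ} (hy : ‖y‖ ≤ C) :
    ∫ ω, ‖(J i w' (ξ t ω i) - fderiv ℝ (g i) w').adjoint y‖ ^ 2 ∂μ ≤ C ^ 2 * (σ ^ 2 / B₂) := by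
  calc _ ≤ ∫ ω, C ^ 2 * ‖J i w' (ξ t ω i) - fderiv ℝ (g i) w'‖ ^ 2 ∂μ := by
        refine integral_mono (MemLp_two.integrable_norm_sq (H.memLp_blockNoise ht i w' y))
          ((H.jacobian_integrable t ht i w').const_mul _) fun ω => ?_
        dsimp only
        rw [← mul_pow, mul_comm]
        gcongr
        exact (norm_adjoint_apply_le _ _).trans (by gcongr)
    _ ≤ _ := by
        rw [integral_const_mul]
        gcongr
        exact H.jacobian_variance t ht i w'

/-- The expected squared error of the updated gradient estimator for given blocks. -/
theorem updated_gradient_error [IsProbabilityMeasure μ] (H : Oracle μ Cg Lg σ B₂ g G J ξ)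
    (hr : Regular Cf Lf Cg Lg f g) (hm : 1 ≤ m) {t : ℕ} (ht : 2 ≤ t)
    (v : Variant) (w' z : Vec d) (u : Fin m → Vec p) (α : ℝ) {B₁ : ℕ} (h₁ : 1 ≤ B₁)
    (B : Finset (Fin m)) (hB : B.card = B₁) :
    Integrable (fun ω => ‖v.project (Cf * Cg) ((1 - α) • z + (α / B₁) •
      ∑ i ∈ B, (J i w' (ξ t ω i)).adjoint (∇ (f i) (u i))) - ∇ (objective f g) w'‖ ^ 2) μ ∧
    ∫ ω, ‖v.project (Cf * Cg) ((1 - α) • z + (α / B₁) •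
      ∑ i ∈ B, (J i w' (ξ t ω i)).adjoint (∇ (f i) (u i))) - ∇ (objective f g) w'‖ ^ 2 ∂μ ≤
    ‖(1 - α) • z + (α / B₁) • ∑ i ∈ B, blockGradient f g w' u i - ∇ (objective f g) w'‖ ^ 2
      + α ^ 2 * (Cf ^ 2 * (σ ^ 2 / B₂)) := by
  have hB0 : (0 : ℝ) < B₁ := by exact_mod_cast h₁
  set c := (1 - α) • z + (α / B₁) • ∑ i ∈ B, blockGradient f g w' u i - ∇ (objective f g) w'
    with hc
  set n : Fin m → Ω → Vec d := fun i ω =>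
    (J i w' (ξ t ω i) - fderiv ℝ (g i) w').adjoint (∇ (f i) (u i)) with hn
  have mn : ∀ i, MemLp (n i) 2 μ := fun i => H.memLp_blockNoise ht i w' _
  have ms : MemLp (fun ω => ∑ i ∈ B, n i ω) 2 μ := memLp_finsetSum B fun i _ => mn i
  have mN : MemLp (fun ω => (α / B₁) • ∑ i ∈ B, n i ω) 2 μ :=
    ms.const_smul (α / B₁ : ℝ)
  have zN : ∫ ω, (α / B₁) • ∑ i ∈ B, n i ω ∂μ = 0 := by
    rw [integral_smul, integral_finsetSum B fun i _ => (mn i).integrable (by norm_num)]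
    rw [Finset.sum_eq_zero fun i _ => H.integral_blockNoise ht i w' _, smul_zero]
  have e : ∀ ω, (1 - α) • z + (α / B₁) •
      ∑ i ∈ B, (J i w' (ξ t ω i)).adjoint (∇ (f i) (u i)) - ∇ (objective f g) w'
      = c + (α / B₁) • ∑ i ∈ B, n i ω := by
    intro ω
    simp only [hc, hn, blockGradient, map_sub, sub_apply,
      Finset.sum_sub_distrib, smul_sub]
    abel
  -- The target ∇F(w') lies in the ball, so the projection can be dropped.
  have hle : ∀ ω, ‖v.project (Cf * Cg) ((1 - α) • z + (α / B₁) •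
      ∑ i ∈ B, (J i w' (ξ t ω i)).adjoint (∇ (f i) (u i))) - ∇ (objective f g) w'‖ ^ 2
      ≤ ‖c + (α / B₁) • ∑ i ∈ B, n i ω‖ ^ 2 := by
    intro ω
    rw [← e]
    gcongr
    exact v.norm_project_sub_le _ _ (hr.norm_gradient_objective_le hm w')
  have i1 := MemLp_two.integrable_norm_sq ((memLp_const c).add mN)
  have mY : Measurable fun ω => (1 - α) • z + (α / (B₁ : ℝ)) •
      ∑ i ∈ B, (J i w' (ξ t ω i)).adjoint (∇ (f i) (u i)) := by
    have mS : Measurable fun ω => ∑ i ∈ B, (J i w' (ξ t ω i)).adjoint (∇ (f i) (u i)) := by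
      refine Finset.measurable_sum B fun i _ => ?_
      exact (adjointApply (∇ (f i) (u i))).measurable.comp (H.measurable_jacobian_at ht i w')
    exact measurable_const.add (mS.const_smul (α / B₁ : ℝ))
  have i2 : Integrable (fun ω => ‖v.project (Cf * Cg) ((1 - α) • z + (α / B₁) •
      ∑ i ∈ B, (J i w' (ξ t ω i)).adjoint (∇ (f i) (u i))) - ∇ (objective f g) w'‖ ^ 2) μ := by
    refine i1.mono' ?_ (ae_of_all _ fun ω => ?_)
    · exact ((((v.measurable_project _).comp mY).sub_const _).norm.pow_const 2).aestronglyMeasurable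
    · rw [Real.norm_of_nonneg (by positivity)]; exact hle ω
  refine ⟨i2, ?_⟩
  refine (integral_mono i2 i1 hle).trans ?_
  refine (integral_norm_const_add_sq mN zN c).le.trans ?_
  gcongr
  simp_rw [norm_smul, mul_pow, Real.norm_eq_abs, sq_abs]
  rw [integral_const_mul]
  have i3 : ∀ i ∈ B, Integrable (fun ω => ‖n i ω‖ ^ 2) μ :=
    fun i _ => MemLp_two.integrable_norm_sq (mn i)
  -- Batches of different blocks at the same time may be dependent. Cauchy–Schwarz is used, and the
  -- Jacobian noise gains no factor 1/B₁.
  calc (α / B₁) ^ 2 * ∫ ω, ‖∑ i ∈ B, n i ω‖ ^ 2 ∂μ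
      ≤ (α / B₁) ^ 2 * ∫ ω, B₁ * ∑ i ∈ B, ‖n i ω‖ ^ 2 ∂μ := by
        refine mul_le_mul_of_nonneg_left (integral_mono (MemLp_two.integrable_norm_sq ms)
          ((integrable_finsetSum B i3).const_mul _) fun ω => ?_) (sq_nonneg _)
        dsimp only
        rw [← hB]; exact norm_sum_sq_le B _
    _ = (α / B₁) ^ 2 * (B₁ * ∑ i ∈ B, ∫ ω, ‖n i ω‖ ^ 2 ∂μ) := by
        rw [integral_const_mul, integral_finsetSum B i3]
    _ ≤ (α / B₁) ^ 2 * (B₁ * ∑ i ∈ B, Cf ^ 2 * (σ ^ 2 / B₂)) := by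
        gcongr with i hi
        exact H.integral_norm_blockNoise_sq_le ht i w' (hr.norm_gradient_le i _)
    _ = α ^ 2 * (Cf ^ 2 * (σ ^ 2 / B₂)) := by
        rw [Finset.sum_const, hB, nsmul_eq_mul]; field_simp

end Oracle

/-! ### Algebra of one step -/

section Algebra

variable {E : Type*} [NormedAddCommGroup E] [InnerProductSpace ℝ E]

theorem two_inner_le {x y : E} {a : ℝ} (ha : 0 < a) :
    2 * inner ℝ x y ≤ a * ‖x‖ ^ 2 + 1 / a * ‖y‖ ^ 2 := by
  have h1 := real_inner_le_norm x y
  have h2 : 0 ≤ (a * ‖x‖ - ‖y‖) ^ 2 / a := by positivity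
  have h3 : (a * ‖x‖ - ‖y‖) ^ 2 / a = a * ‖x‖ ^ 2 - 2 * (‖x‖ * ‖y‖) + 1 / a * ‖y‖ ^ 2 := by
    field_simp; ring
  linarith

theorem norm_add_sq_le_two (x y : E) : ‖x + y‖ ^ 2 ≤ 2 * ‖x‖ ^ 2 + 2 * ‖y‖ ^ 2 := by
  have := parallelogram_law_with_norm ℝ x y
  nlinarith [sq_nonneg ‖x - y‖]

/-- Convexity of the squared norm, with y read as α • (y/α). -/
theorem norm_convex_sq_le {α : ℝ} (h0 : 0 < α) (h1 : α ≤ 1) (x y : E) :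
    ‖(1 - α) • x + y‖ ^ 2 ≤ (1 - α) * ‖x‖ ^ 2 + 1 / α * ‖y‖ ^ 2 := by
  have h := two_inner_le (x := x) (y := y) h0
  rw [norm_add_sq_real, norm_smul, mul_pow, Real.norm_eq_abs, sq_abs, inner_smul_left]
  simp only [conj_trivial]
  have h2 := mul_le_mul_of_nonneg_left h (by linarith : 0 ≤ 1 - α)
  have e : (1 - α) * (α * ‖x‖ ^ 2 + 1 / α * ‖y‖ ^ 2) + (1 - α) ^ 2 * ‖x‖ ^ 2 + ‖y‖ ^ 2
      = (1 - α) * ‖x‖ ^ 2 + 1 / α * ‖y‖ ^ 2 := by field_simp; ring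
  linarith

/-- The choice of `γ` makes the terms `⟪e, D⟫` cancel. -/
theorem error_correction_le {q β γ : ℝ} (hq : 0 < q) (hq1 : q ≤ 1) (hβ : 0 < β) (hβ1 : β ≤ 1 / 2)
    (hγ : γ = (1 - q) / (q * (1 - β)) + (1 - β)) (e D b : E) :
    (1 - q) * ‖e - D‖ ^ 2 + q * ‖(1 - β) • (e - D) + γ • (D + b)‖ ^ 2 ≤
      (1 - q * β / 2) * ‖e‖ ^ 2 + 9 / q * ‖D‖ ^ 2 + 12 / (q * β) * ‖b‖ ^ 2 := by
  have hβ2 : 0 < 1 - β := by linarith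
  set κ := (1 - q) / (q * (1 - β)) with hκ
  have hκ0 : 0 ≤ κ := div_nonneg (by linarith) (by positivity)
  have hqκ : q * (1 - β) * κ = 1 - q := by rw [hκ]; field_simp
  have hqκ2 : q * κ ≤ 2 * (1 - q) := by nlinarith [mul_nonneg hq.le hκ0]
  have hqγ : q * γ ≤ 2 := by rw [hγ]; nlinarith
  have hγ0 : 0 ≤ γ := by rw [hγ]; linarith
  have e0 : (1 - β) • (e - D) + γ • (D + b) = (1 - β) • e + (κ • D + γ • b) := by
    rw [hγ]; module
  rw [e0, norm_sub_sq_real, norm_add_sq_real, inner_add_right, inner_smul_left, inner_smul_left,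
    inner_smul_right, norm_smul, mul_pow, Real.norm_eq_abs, sq_abs]
  simp only [conj_trivial]
  have h1 := norm_add_sq_le_two (κ • D) (γ • b)
  have h2 : (2 : ℝ) * inner ℝ e (γ • b) ≤ β / 2 * ‖e‖ ^ 2 + 1 / (β / 2) * ‖γ • b‖ ^ 2 :=
    two_inner_le (by linarith)
  rw [norm_smul κ, norm_smul γ, mul_pow, mul_pow, Real.norm_eq_abs, Real.norm_eq_abs, sq_abs,
    sq_abs] at h1
  rw [norm_smul, mul_pow, Real.norm_eq_abs, sq_abs] at h2
  -- Only the bias `b` goes through Young's inequality and pays a factor 1/β.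
  have h3 : (1 - β) * (2 * inner ℝ e (γ • b)) ≤ β / 2 * ‖e‖ ^ 2 + 2 / β * (γ ^ 2 * ‖b‖ ^ 2) := by
    have hr : 0 ≤ β / 2 * ‖e‖ ^ 2 + 1 / (β / 2) * (γ ^ 2 * ‖b‖ ^ 2) := by positivity
    have e3 : 1 / (β / 2) = 2 / β := by field_simp
    rw [e3] at h2 hr
    nlinarith [mul_le_mul_of_nonneg_left h2 hβ2.le, mul_nonneg hβ.le hr]
  -- The untouched block contributes −2(1 − q)⟪e, D⟫ and the refreshed one +2q(1 − β)κ⟪e, D⟫. The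
  -- choice of κ makes them cancel.
  have h4 : q * ((1 - β) * (κ * inner ℝ e D)) = (1 - q) * inner ℝ e D := by
    rw [← hqκ]; ring
  have h5 : q * (2 * (κ ^ 2 * ‖D‖ ^ 2)) ≤ 8 / q * ‖D‖ ^ 2 := by
    have : (q * κ) ^ 2 ≤ 4 := by
      have : 0 ≤ q * κ := by positivity
      nlinarith
    calc q * (2 * (κ ^ 2 * ‖D‖ ^ 2)) = 2 * (q * κ) ^ 2 / q * ‖D‖ ^ 2 := by field_simp
      _ ≤ 2 * 4 / q * ‖D‖ ^ 2 := by gcongr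
      _ = _ := by ring
  have h6 : q * ((2 / β + 2) * (γ ^ 2 * ‖b‖ ^ 2)) ≤ 12 / (q * β) * ‖b‖ ^ 2 := by
    have h7 : (q * γ) ^ 2 ≤ 4 := by
      have : 0 ≤ q * γ := by positivity
      nlinarith
    have h8 : 2 / β + 2 ≤ 3 / β := by
      rw [← sub_nonneg]
      have : 3 / β - (2 / β + 2) = (1 - 2 * β) / β := by field_simp; ring
      rw [this]; exact div_nonneg (by linarith) hβ.le
    calc q * ((2 / β + 2) * (γ ^ 2 * ‖b‖ ^ 2)) ≤ q * ((3 / β) * (γ ^ 2 * ‖b‖ ^ 2)) := by gcongr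
      _ = 3 * (q * γ) ^ 2 / (q * β) * ‖b‖ ^ 2 := by field_simp
      _ ≤ 3 * 4 / (q * β) * ‖b‖ ^ 2 := by gcongr
      _ = _ := by ring
  have h9 : (1 - q) * ‖D‖ ^ 2 ≤ 1 / q * ‖D‖ ^ 2 := by
    gcongr
    have : 1 ≤ 1 / q := by rw [le_div_iff₀ hq]; linarith
    linarith
  have h10 : ((1 - q) + q * (1 - β) ^ 2 + q * (β / 2)) * ‖e‖ ^ 2 ≤ (1 - q * β / 2) * ‖e‖ ^ 2 := by
    gcongr
    nlinarith [mul_pos hq hβ, mul_pos (mul_pos hq hβ) hβ]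
  have h11 := mul_le_mul_of_nonneg_left h1 hq.le
  have h12 := mul_le_mul_of_nonneg_left h3 hq.le
  have h13 : 9 / q * ‖D‖ ^ 2 = 8 / q * ‖D‖ ^ 2 + 1 / q * ‖D‖ ^ 2 := by ring
  rw [h13]
  have h14 : q * (2 * ((1 - β) * (κ * inner ℝ e D) + (1 - β) * inner ℝ e (γ • b)))
      = 2 * ((1 - q) * inner ℝ e D) + q * ((1 - β) * (2 * inner ℝ e (γ • b))) := by
    rw [← h4]; ring
  linarith

/-- The decrease of the Lyapunov function, for given bounds on its three parts. -/
theorem lyapunov_arithmetic {q η η' s c cα cβ C₁ L M F F' U Z ζ Γ n₁ n₂ : ℝ}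
    (hq : 0 < q) (hη : 0 < η) (hη' : 0 < η') (hs : 0 < s) (hc : 0 < c) (hcα : 0 < cα)
    (hM : 0 ≤ M) (hU : 0 ≤ U) (hZ : 0 ≤ Z) (hζ : 0 ≤ ζ) (hn₂ : 0 ≤ n₂)
    (hC₁ : 0 < C₁)
    (hηη : η ≤ (1 + 1 / s) * η') (hηs : q ≤ η ^ 2 * s) (hηq : η ^ 2 ≤ q)
    (hβ : cβ * (η ^ 2 / q ^ 2) ≤ 1 / 2) (hq1 : q ≤ 1)
    (hcC : c * C₁ ≤ 1 / 32) (hcβ : 4 * M + c ≤ c * cβ / 2) (hLα : 2 * (L / cα) ^ 2 ≤ 1 / 8)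
    (hLη : L * η ≤ 1 / 8) {M' : ℝ} (hMη : 4 * M' * η ^ 2 ≤ 1 / 8)
    (hF : F' ≤ F - η / 2 * Γ - η / 2 * ζ + η / 2 * Z + L * (η ^ 2 * ζ)) :
    F' + 1 / cα * ((1 - cα * η) * Z + 2 / (cα * η) * (L ^ 2 * (η ^ 2 * ζ))
        + 4 * (cα * η) * (M * U + M' * (η ^ 2 * ζ)) + n₁)
      + c * q / η' * ((1 - q * (cβ * (η ^ 2 / q ^ 2)) / 2) * U + C₁ / q * (η ^ 2 * ζ) + n₂)
      + η / 2 * Γ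
      ≤ F + 1 / cα * Z + c * q / η * U + 1 / cα * n₁ + 2 * (c * q / η) * n₂ := by
  have hP' : c * q / η' ≤ (1 + 1 / s) * (c * q / η) := by
    rw [div_le_iff₀ hη']
    have : (1 + 1 / s) * (c * q / η) * η' = c * q * (((1 + 1 / s) * η') / η) := by ring
    rw [this]
    refine le_mul_of_one_le_right (by positivity) ?_
    rw [le_div_iff₀ hη]; linarith
  -- Cost of passing from the weight at η to the weight at η'.
  have hPs : 1 / s * (c * q / η) ≤ c * η := by
    calc 1 / s * (c * q / η) = c * q / (s * η) := by ring
      _ ≤ c * (η ^ 2 * s) / (s * η) := by gcongr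
      _ = c * η := by field_simp
  have hs1 : 1 / s ≤ 1 := by
    rw [div_le_one hs]
    by_contra! h
    have : η ^ 2 * s < η ^ 2 * 1 := by gcongr
    linarith
  have hP0 : 0 < c * q / η := by positivity
  set P := c * q / η with hP
  set P' := c * q / η' with hP'd
  have hP'0 : 0 < P' := by positivity
  have hP2 : P' ≤ 2 * P := by nlinarith
  -- The contraction qβ/2, multiplied by the weight c q/η, becomes c cβ η/2, free of q.
  have t1 : P' * ((1 - q * (cβ * (η ^ 2 / q ^ 2)) / 2) * U) ≤ (P + c * η - c * cβ * η / 2) * U := by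
    have hk : 0 ≤ 1 - q * (cβ * (η ^ 2 / q ^ 2)) / 2 := by nlinarith
    have e : (1 + 1 / s) * P * (1 - q * (cβ * (η ^ 2 / q ^ 2)) / 2)
        = P + 1 / s * P - c * cβ * η / 2 - 1 / s * (c * cβ * η / 2) := by
      rw [hP]; field_simp; ring
    rw [← mul_assoc]
    gcongr
    refine (mul_le_mul_of_nonneg_right hP' hk).trans ?_
    rw [e]
    have : 0 ≤ 1 / s * (c * cβ * η / 2) := by
      have : 0 ≤ c * cβ / 2 := by linarith
      have : 0 ≤ 1 / s * (c * cβ / 2 * η) := by positivity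
      calc (0:ℝ) ≤ _ := this
        _ = _ := by ring
    linarith
  have t2 : P' * (C₁ / q * (η ^ 2 * ζ)) ≤ η * ζ / 16 := by
    calc P' * (C₁ / q * (η ^ 2 * ζ)) ≤ 2 * P * (C₁ / q * (η ^ 2 * ζ)) := by gcongr
      _ = 2 * (c * C₁) * (η * ζ) := by rw [hP]; field_simp
      _ ≤ 2 * (1 / 32) * (η * ζ) := by gcongr
      _ = _ := by ring
  have t3 : P' * n₂ ≤ 2 * P * n₂ := by gcongr
  have t4 : 1 / cα * (2 / (cα * η) * (L ^ 2 * (η ^ 2 * ζ))) ≤ η * ζ / 8 := by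
    calc _ = 2 * (L / cα) ^ 2 * (η * ζ) := by field_simp
      _ ≤ 1 / 8 * (η * ζ) := by gcongr
      _ = _ := by ring
  have t5 : 1 / cα * (4 * (cα * η) * (M * U + M' * (η ^ 2 * ζ)))
      ≤ 4 * M * η * U + η * ζ / 8 := by
    calc _ = 4 * M * η * U + 4 * M' * η ^ 2 * (η * ζ) := by field_simp
      _ ≤ 4 * M * η * U + 1 / 8 * (η * ζ) := by gcongr
      _ = _ := by ring
  have t6 : L * (η ^ 2 * ζ) ≤ η * ζ / 8 := by
    calc _ = L * η * (η * ζ) := by ring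
      _ ≤ 1 / 8 * (η * ζ) := by gcongr
      _ = _ := by ring
  have t7 : 1 / cα * ((1 - cα * η) * Z) = 1 / cα * Z - η * Z := by field_simp
  have t8 : (4 * M + c - c * cβ / 2) * (η * U) ≤ 0 :=
    mul_nonpos_of_nonpos_of_nonneg (by linarith) (by positivity)
  have t9 : 0 ≤ η * Z := by positivity
  have t10 : 0 ≤ η * ζ := by positivity
  -- Budget: η‖z‖² is charged 1/16 + 1/8 + 1/8 + 1/8 ≤ 1/2, and ηZ is charged 1/2 against 1.
  linarith

end Algebra

/-! ### Measurability of one step -/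

section Measurability

variable {d p m : ℕ}

instance : MeasurableSpace (State d p m) :=
  MeasurableSpace.comap (fun x => (x.w, x.u, x.z)) inferInstance

theorem measurable_state_prod :
    Measurable fun x : State d p m => (x.w, x.u, x.z) :=
  comap_measurable _

theorem measurable_state_w : Measurable fun x : State d p m => x.w :=
  measurable_fst.comp measurable_state_prod

theorem measurable_state_u (i : Fin m) : Measurable fun x : State d p m => x.u i :=
  (measurable_pi_apply i).comp (measurable_fst.comp (measurable_snd.comp measurable_state_prod))

theorem measurable_state_z : Measurable fun x : State d p m => x.z :=
  measurable_snd.comp (measurable_snd.comp measurable_state_prod)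

theorem measurable_to_state {X : Type*} [MeasurableSpace X] {φ : X → State d p m}
    (hw : Measurable fun x => (φ x).w) (hu : ∀ i, Measurable fun x => (φ x).u i)
    (hz : Measurable fun x => (φ x).z) : Measurable φ :=
  measurable_comap_iff.2 (hw.prodMk ((measurable_pi_iff.2 hu).prodMk hz))

theorem _root_.Measurable.clm_apply_adjoint {X : Type*} [MeasurableSpace X]
    {A : X → Vec d →L[ℝ] Vec p} {y : X → Vec p} (hA : Measurable A) (hy : Measurable y) :
    Measurable fun x => (A x).adjoint (y x) := by
  have ha : Continuous (ContinuousLinearMap.adjoint (𝕜 := ℝ) (E := Vec d) (F := Vec p)) :=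
    LinearIsometryEquiv.continuous _
  have hc : Continuous fun q : (Vec d →L[ℝ] Vec p) × Vec p => q.1.adjoint q.2 :=
    (ha.comp continuous_fst).clm_apply continuous_snd
  have hAy : Measurable fun x => (A x, y x) := hA.prodMk hy
  have h := hc.measurable.comp hAy
  exact h

theorem _root_.Measurable.clm_apply_vec {X : Type*} [MeasurableSpace X]
    {A : X → Vec d →L[ℝ] Vec p} {y : X → Vec d} (hA : Measurable A) (hy : Measurable y) :
    Measurable fun x => A x (y x) := by
  have hc : Continuous fun q : (Vec d →L[ℝ] Vec p) × Vec d => q.1 q.2 :=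
    continuous_fst.clm_apply continuous_snd
  exact hc.measurable.comp (hA.prodMk hy)

theorem measurable_step {S : Type*} [MeasurableSpace S]
    {f : Fin m → Vec p → ℝ} (hf : ∀ i, Measurable (∇ (f i)))
    {G : Fin m → Vec d → S → Vec p} {J : Fin m → Vec d → S → (Vec d →L[ℝ] Vec p)}
    (hG : ∀ i, Measurable fun q : Vec d × S => G i q.1 q.2)
    (hJ : ∀ i, Measurable fun q : Vec d × S => J i q.1 q.2)
    (v : Variant) (B₁ : ℕ) (R η α β : ℝ) :
    Measurable fun q : State d p m × (Finset (Fin m) × (Fin m → S)) =>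
      step v B₁ R f G J η α β q.2.1 q.2.2 q.1 := by
  set Q := State d p m × (Finset (Fin m) × (Fin m → S))
  have mw : Measurable fun q : Q => q.1.w := measurable_state_w.comp measurable_fst
  have mz : Measurable fun q : Q => q.1.z := measurable_state_z.comp measurable_fst
  have mu : ∀ i, Measurable fun q : Q => q.1.u i :=
    fun i => (measurable_state_u i).comp measurable_fst
  have ms : ∀ i, Measurable fun q : Q => q.2.2 i :=
    fun i => (measurable_pi_apply i).comp (measurable_snd.comp measurable_snd)
  have mw' : Measurable fun q : Q => q.1.w - η • q.1.z := mw.sub (mz.const_smul η)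
  have mB : ∀ i, MeasurableSet {q : Q | i ∈ q.2.1} := fun i =>
    (measurable_fst.comp measurable_snd) (MeasurableSet.of_discrete (s := {B | i ∈ B}))
  have mG : ∀ i, Measurable fun q : Q => G i (q.1.w - η • q.1.z) (q.2.2 i) :=
    fun i => (hG i).comp (mw'.prodMk (ms i))
  have mG' : ∀ i, Measurable fun q : Q => G i q.1.w (q.2.2 i) :=
    fun i => (hG i).comp (mw.prodMk (ms i))
  have mJ : ∀ i, Measurable fun q : Q => J i (q.1.w - η • q.1.z) (q.2.2 i) :=
    fun i => (hJ i).comp (mw'.prodMk (ms i))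
  have mc : ∀ i, Measurable fun q : Q =>
      v.correction (G i) (J i) q.1.w (q.1.w - η • q.1.z) (q.2.2 i) := by
    intro i
    match v with
    | .twoPoint => exact (mG i).sub (mG' i)
    | .twoPointProj => exact (mG i).sub (mG' i)
    | .singlePointProj => exact (mJ i).clm_apply_vec (mw'.sub mw)
  refine measurable_to_state mw' (fun i => ?_) ?_
  · exact Measurable.ite (mB i) ((((mu i).const_smul (1 - β)).add ((mG i).const_smul β)).add
      ((mc i).const_smul (gammaCoeff m B₁ β))) (mu i)
  · refine (v.measurable_project R).comp ((mz.const_smul (1 - α)).add ?_)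
    have mS : Measurable fun q : Q => ∑ i ∈ q.2.1,
        (J i (q.1.w - η • q.1.z) (q.2.2 i)).adjoint (∇ (f i) (q.1.u i)) := by
      -- A sum over a random index set is measurable once written as a fixed sum of indicators.
      have e : (fun q : Q => ∑ i ∈ q.2.1,
          (J i (q.1.w - η • q.1.z) (q.2.2 i)).adjoint (∇ (f i) (q.1.u i))) = fun q : Q =>
          ∑ i, if i ∈ q.2.1 then
            (J i (q.1.w - η • q.1.z) (q.2.2 i)).adjoint (∇ (f i) (q.1.u i)) else 0 := by
        ext1 q
        rw [Finset.sum_ite_mem, Finset.univ_inter]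
      rw [e]
      exact Finset.measurable_sum _ fun i _ => Measurable.ite (mB i)
        ((mJ i).clm_apply_adjoint ((hf i).comp (mu i))) measurable_const
    exact mS.const_smul (α / B₁ : ℝ)

end Measurability

/-! ### The Lyapunov function -/

/-- Function gap plus weighted squared errors of the two estimators. -/
noncomputable def lyapunov {d p m : ℕ} (f : Fin m → Vec p → ℝ) (g : Fin m → Vec d → Vec p)
    (cz cu : ℝ) (x : State d p m) : ℝ :=
  objective f g x.w - (⨅ w, objective f g w) + cz * ‖x.z - ∇ (objective f g) x.w‖ ^ 2
    + cu * ((1 / (m : ℝ)) * ∑ i, ‖x.u i - g i x.w‖ ^ 2)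

section Lyapunov

variable {d p m : ℕ} {Cf Lf Cg Lg : ℝ≥0} {f : Fin m → Vec p → ℝ} {g : Fin m → Vec d → Vec p}

theorem lyapunov_nonneg (hb : BddBelow (Set.range (objective f g))) {cz cu : ℝ} (hz : 0 ≤ cz)
    (hu : 0 ≤ cu) (x : State d p m) : 0 ≤ lyapunov f g cz cu x := by
  have h1 := ciInf_le hb x.w
  have h2 : 0 ≤ objective f g x.w - ⨅ w, objective f g w := by linarith
  unfold lyapunov
  positivity

theorem Regular.continuous_gradient_objective (hr : Regular Cf Lf Cg Lg f g) (hm : 1 ≤ m) :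
    Continuous (∇ (objective f g)) := by
  refine (LipschitzWith.of_dist_le_mul (K := Cf * Lg + Cg ^ 2 * Lf) fun x y => ?_).continuous
  rw [dist_eq_norm, dist_eq_norm]
  exact_mod_cast hr.norm_gradient_objective_sub_le hm x y

theorem Regular.measurable_lyapunov (hr : Regular Cf Lf Cg Lg f g) (hm : 1 ≤ m) (cz cu : ℝ) :
    Measurable (lyapunov f g cz cu) := by
  have m1 := hr.differentiable_objective.continuous.measurable.comp
    (measurable_state_w (d := d) (p := p) (m := m))
  have m2 := (hr.continuous_gradient_objective hm).measurable.comp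
    (measurable_state_w (d := d) (p := p) (m := m))
  have m3 : ∀ i, Measurable fun x : State d p m => g i x.w := fun i =>
    (hr.g_differentiable i).continuous.measurable.comp measurable_state_w
  exact ((m1.sub_const _).add (((measurable_state_z.sub m2).norm.pow_const 2).const_mul cz)).add
    ((Finset.measurable_sum _ fun i _ =>
      ((measurable_state_u i).sub (m3 i)).norm.pow_const 2).const_mul _ |>.const_mul cu)

end Lyapunov

/-! ### Integrals over the random blocks -/

section Blocks

variable {d p m : ℕ} {Ω S : Type*} [MeasurableSpace Ω] [MeasurableSpace S]
  {μ : Measure Ω} [IsProbabilityMeasure μ] {B₁ : ℕ} {blocks : ℕ → Ω → Finset (Fin m)}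
  {ξ : ℕ → Ω → Fin m → S} {u₁ : Ω → Fin m → Vec p} {z₁ : Ω → Vec d}

/-- The hypothesis gives only the masses of the sets of size `B₁`. They already add up to 1, so
nothing is left for other sizes. -/
theorem Sampling.measure_blocks_eq (H : Sampling μ B₁ blocks ξ u₁ z₁) (hm : B₁ ≤ m) {t : ℕ}
    (ht : 2 ≤ t) (B : Finset (Fin m)) :
    μ {ω | blocks t ω = B} = if B.card = B₁ then ((m.choose B₁ : ℕ) : ℝ≥0∞)⁻¹ else 0 := by
  have hms : ∀ B, MeasurableSet {ω | blocks t ω = B} := fun B =>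
    H.measurable_blocks t ht (measurableSet_singleton B)
  have hc : m.choose B₁ ≠ 0 := (Nat.choose_pos hm).ne'
  have hcard : ∀ B : Finset (Fin m), B.card = B₁ →
      μ {ω | blocks t ω = B} = ((m.choose B₁ : ℕ) : ℝ≥0∞)⁻¹ := by
    intro B hB
    rw [← ofReal_measureReal (measure_ne_top _ _), H.blocks_uniform t ht B hB, one_div,
      ENNReal.ofReal_inv_of_pos (by positivity), ENNReal.ofReal_natCast]
  split_ifs with hB
  · exact hcard B hB
  · have hsum : ∑ A ∈ Finset.powersetCard B₁ (Finset.univ : Finset (Fin m)),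
        μ {ω | blocks t ω = A} = 1 := by
      rw [Finset.sum_congr rfl fun A hA => hcard A (Finset.mem_powersetCard_univ.1 hA),
        Finset.sum_const, Finset.card_powersetCard, Finset.card_univ, Fintype.card_fin,
        nsmul_eq_mul, ENNReal.mul_inv_cancel (by exact_mod_cast hc) (ENNReal.natCast_ne_top _)]
    have hle : ∑ A ∈ insert B (Finset.powersetCard B₁ (Finset.univ : Finset (Fin m))),
        μ {ω | blocks t ω = A} ≤ 1 := by
      rw [← measure_biUnion_finset (fun A _ A' _ hAA => ?_) fun A _ => hms A]
      · exact prob_le_one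
      · exact Set.disjoint_left.2 fun ω h1 h2 => hAA (h1.symm.trans h2)
    rw [Finset.sum_insert (by simpa using hB), hsum] at hle
    have h1 : μ {ω | blocks t ω = B} + 1 ≤ 0 + 1 := by simpa using hle
    simpa using (ENNReal.add_le_add_iff_right ENNReal.one_ne_top).1 h1

/-- Integration over blocks and batches of the same time, one after the other. -/
theorem Sampling.lintegral_blocks_le (H : Sampling μ B₁ blocks ξ u₁ z₁) (hm : B₁ ≤ m) {t : ℕ}
    (ht : 2 ≤ t) (hξ : Measurable (ξ t)) {h : Finset (Fin m) × (Fin m → S) → ℝ}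
    (hh : Measurable h) (h0 : ∀ q, 0 ≤ h q) {b : Finset (Fin m) → ℝ}
    (hb : ∀ B, B.card = B₁ → Integrable (fun ω => h (B, ξ t ω)) μ ∧
      ∫ ω, h (B, ξ t ω) ∂μ ≤ b B) :
    ∫⁻ ω, ENNReal.ofReal (h (blocks t ω, ξ t ω)) ∂μ ≤ ENNReal.ofReal (blockAvg B₁ b) := by
  have hmb := H.measurable_blocks t ht
  have hc : 0 < m.choose B₁ := Nat.choose_pos hm
  have hmap := (indepFun_iff_map_prod_eq_prod_map_map hmb.aemeasurable hξ.aemeasurable).1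
    (H.blocks_indep_batches t ht)
  have hm2 : Measurable fun q => ENNReal.ofReal (h q) := hh.ennreal_ofReal
  rw [← lintegral_map (f := fun q => ENNReal.ofReal (h q)) hm2 (hmb.prodMk hξ), hmap,
    lintegral_prod _ hm2.aemeasurable, lintegral_fintype]
  have hsing : ∀ B, (Measure.map (blocks t) μ) {B}
      = if B.card = B₁ then ((m.choose B₁ : ℕ) : ℝ≥0∞)⁻¹ else 0 := by
    intro B
    rw [Measure.map_apply hmb (measurableSet_singleton B)]
    exact H.measure_blocks_eq hm ht B
  simp_rw [hsing, mul_ite, mul_zero]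
  rw [← Finset.sum_filter, Finset.univ_filter_card_eq]
  have hB0 : ∀ B, B.card = B₁ → 0 ≤ b B := fun B hB =>
    (integral_nonneg fun ω => h0 _).trans (hb B hB).2
  have hle : ∀ B ∈ Finset.powersetCard B₁ (Finset.univ : Finset (Fin m)),
      (∫⁻ y, ENNReal.ofReal (h (B, y)) ∂(Measure.map (ξ t) μ)) * ((m.choose B₁ : ℕ) : ℝ≥0∞)⁻¹
        ≤ ENNReal.ofReal (b B / m.choose B₁) := by
    intro B hB
    have hB' := Finset.mem_powersetCard_univ.1 hB
    rw [lintegral_map (f := fun y => ENNReal.ofReal (h (B, y)))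
      (hm2.comp (measurable_const.prodMk measurable_id)) hξ,
      ← ofReal_integral_eq_lintegral_ofReal (hb B hB').1 (ae_of_all _ fun ω => h0 _),
      ENNReal.ofReal_div_of_pos (by exact_mod_cast hc), ENNReal.ofReal_natCast, div_eq_mul_inv]
    gcongr
    exact (hb B hB').2
  refine (Finset.sum_le_sum hle).trans ?_
  rw [← ENNReal.ofReal_sum_of_nonneg fun B hB => div_nonneg
    (hB0 B (Finset.mem_powersetCard_univ.1 hB)) (Nat.cast_nonneg _), ← Finset.sum_div]
  rfl

end Blocks

/-! ### The expected decrease of the Lyapunov function -/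

section OneStep

variable {d p m : ℕ} {Ω S : Type*} [MeasurableSpace Ω] [MeasurableSpace S]
  {μ : Measure Ω} [IsProbabilityMeasure μ] {Cf Lf Cg Lg : ℝ≥0} {σ : ℝ} {B₁ B₂ : ℕ}
  {f : Fin m → Vec p → ℝ} {g : Fin m → Vec d → Vec p}
  {G : Fin m → Vec d → S → Vec p} {J : Fin m → Vec d → S → (Vec d →L[ℝ] Vec p)}
  {ξ : ℕ → Ω → Fin m → S}

/-- The new iterate depends on the old state alone. With state and blocks fixed, only the two
estimator errors are random, and they are bounded separately. -/
theorem Oracle.integral_lyapunov_step_le (H : Oracle μ Cg Lg σ B₂ g G J ξ)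
    (hr : Regular Cf Lf Cg Lg f g) (hm : 1 ≤ m) (h₁ : 1 ≤ B₁) (h₂ : 1 ≤ B₂) {t : ℕ} (ht : 2 ≤ t)
    (v : Variant) (x : State d p m) (η α β : ℝ) {cz cu : ℝ} (hcz : 0 ≤ cz) (hcu : 0 ≤ cu)
    (B : Finset (Fin m)) (hB : B.card = B₁) :
    Integrable (fun ω => lyapunov f g cz cu
      (step v B₁ (Cf * Cg) f G J η α β B (ξ t ω) x)) μ ∧
    ∫ ω, lyapunov f g cz cu (step v B₁ (Cf * Cg) f G J η α β B (ξ t ω) x) ∂μ ≤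
      objective f g (x.w - η • x.z) - (⨅ w, objective f g w)
      + cz * (‖(1 - α) • x.z + (α / B₁) • ∑ i ∈ B, blockGradient f g (x.w - η • x.z) x.u i
          - ∇ (objective f g) (x.w - η • x.z)‖ ^ 2 + α ^ 2 * (Cf ^ 2 * (σ ^ 2 / B₂)))
      + cu * ((1 / (m : ℝ)) * ∑ i, if i ∈ B then
          ‖(1 - β) • (x.u i - g i (x.w - η • x.z))
            + gammaCoeff m B₁ β • v.meanCorrection (g i) x.w (x.w - η • x.z)‖ ^ 2
          + (2 * (β ^ 2 * (σ ^ 2 / B₂)) + 2 * (gammaCoeff m B₁ β ^ 2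
            * ((Cg ^ 2 + σ ^ 2) * ‖x.w - η • x.z - x.w‖ ^ 2)))
        else ‖x.u i - g i (x.w - η • x.z)‖ ^ 2) := by
  set w' := x.w - η • x.z with hw'
  obtain ⟨iz, bz⟩ := H.updated_gradient_error hr hm ht v w' x.z x.u α h₁ B hB
  have hu := fun i => H.updated_value_error h₂ ht v i x.w w' (x.u i) β (gammaCoeff m B₁ β)
  set eu : Fin m → Ω → ℝ := fun i ω => ‖(if i ∈ B then
      (1 - β) • x.u i + β • G i w' (ξ t ω i)
        + gammaCoeff m B₁ β • v.correction (G i) (J i) x.w w' (ξ t ω i)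
      else x.u i) - g i w'‖ ^ 2 with heu
  have iu : ∀ i, Integrable (eu i) μ := by
    intro i
    by_cases hi : i ∈ B
    · simpa only [heu, hi, if_true] using (hu i).1
    · simpa only [heu, hi, if_false] using integrable_const _
  have bu : ∀ i, ∫ ω, eu i ω ∂μ ≤ if i ∈ B then
          ‖(1 - β) • (x.u i - g i w') + gammaCoeff m B₁ β • v.meanCorrection (g i) x.w w'‖ ^ 2
          + (2 * (β ^ 2 * (σ ^ 2 / B₂)) + 2 * (gammaCoeff m B₁ β ^ 2
            * ((Cg ^ 2 + σ ^ 2) * ‖w' - x.w‖ ^ 2)))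
        else ‖x.u i - g i w'‖ ^ 2 := by
    intro i
    by_cases hi : i ∈ B
    · simpa only [heu, hi, if_true] using (hu i).2
    · simp [heu, hi]
  set ez : Ω → ℝ := fun ω => ‖v.project (Cf * Cg) ((1 - α) • x.z + (α / B₁) •
      ∑ i ∈ B, (J i w' (ξ t ω i)).adjoint (∇ (f i) (x.u i))) - ∇ (objective f g) w'‖ ^ 2
  have e : ∀ ω, lyapunov f g cz cu (step v B₁ (Cf * Cg) f G J η α β B (ξ t ω) x)
      = objective f g w' - (⨅ w, objective f g w) + cz * ez ω
        + cu * ((1 / (m : ℝ)) * ∑ i, eu i ω) := fun ω => rfl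
  simp_rw [e]
  have i1 : Integrable (fun ω => objective f g w' - (⨅ w, objective f g w) + cz * ez ω) μ :=
    (integrable_const _).add (iz.const_mul cz)
  have i2 : Integrable (fun ω => cu * ((1 / (m : ℝ)) * ∑ i, eu i ω)) μ :=
    ((integrable_finsetSum _ fun i _ => iu i).const_mul _).const_mul _
  refine ⟨i1.add i2, ?_⟩
  rw [integral_add i1 i2, integral_add (integrable_const _) (iz.const_mul cz),
    integral_const_mul, integral_const_mul, integral_const_mul,
    integral_finsetSum _ fun i _ => iu i]
  simp only [integral_const, probReal_univ, one_smul]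
  gcongr with i
  exact bu i

theorem gammaCoeff_eq (h₁ : 1 ≤ B₁) (hm : B₁ ≤ m) (β : ℝ) :
    gammaCoeff m B₁ β = (1 - (B₁ : ℝ) / m) / ((B₁ : ℝ) / m * (1 - β)) + (1 - β) := by
  have h0 : (0 : ℝ) < m := by exact_mod_cast h₁.trans hm
  have h1 : (0 : ℝ) < B₁ := by exact_mod_cast h₁
  unfold gammaCoeff
  congr 1
  have e1 : 1 - (B₁ : ℝ) / m = (m - B₁) / m := by field_simp
  have e2 : (B₁ : ℝ) / m * (1 - β) = (B₁ * (1 - β)) / m := by ring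
  rw [e1, e2, div_div_div_cancel_right₀ h0.ne']

/-- The inner estimators after a step, on average over the blocks. -/
theorem Regular.blockAvg_inner_error_le (hr : Regular Cf Lf Cg Lg f g) (h₁ : 1 ≤ B₁)
    (hm : B₁ ≤ m) {v : Variant} {x : State d p m} (hx : v.AdmitsInit (Cf * Cg) x.z) {η β W : ℝ}
    (hβ : 0 < β) (hβ1 : β ≤ 1 / 2) (hηβ : η ^ 2 ≤ β * ((B₁ : ℝ) / m) ^ 2)
    (i : Fin m) :
    blockAvg B₁ (fun B => if i ∈ B then
          ‖(1 - β) • (x.u i - g i (x.w - η • x.z))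
            + gammaCoeff m B₁ β • v.meanCorrection (g i) x.w (x.w - η • x.z)‖ ^ 2
          + (2 * (β ^ 2 * W) + 2 * (gammaCoeff m B₁ β ^ 2
            * ((Cg ^ 2 + σ ^ 2) * ‖x.w - η • x.z - x.w‖ ^ 2)))
        else ‖x.u i - g i (x.w - η • x.z)‖ ^ 2) ≤
      (1 - (B₁ : ℝ) / m * β / 2) * ‖x.u i - g i x.w‖ ^ 2
      + (17 * Cg ^ 2 + 12 * (Lg ^ 2 * (Cf * Cg) ^ 2) + 8 * σ ^ 2 + 1) / ((B₁ : ℝ) / m)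
          * (η ^ 2 * ‖x.z‖ ^ 2)
      + 2 * ((B₁ : ℝ) / m) * β ^ 2 * W := by
  rw [blockAvg_ite h₁ hm, gammaCoeff_eq h₁ hm]
  have h0 : (0 : ℝ) < m := by exact_mod_cast h₁.trans hm
  have h1 : (0 : ℝ) < B₁ := by exact_mod_cast h₁
  have hq1 : (B₁ : ℝ) / m ≤ 1 := by rw [div_le_one h0]; exact_mod_cast hm
  have hq : (0 : ℝ) < (B₁ : ℝ) / m := by positivity
  set q := (B₁ : ℝ) / m
  have hβ2 : 0 < 1 - β := by linarith
  set γ := (1 - q) / (q * (1 - β)) + (1 - β) with hγ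
  -- γ is of order 1/q. The noise of the correction, met with probability q, thus costs q γ² ≤ 4/q,
  -- the same order as the drift.
  have hqγ : (q * γ) ^ 2 ≤ 4 := by
    have hγ0 : 0 ≤ γ := add_nonneg (div_nonneg (by linarith) (by positivity)) hβ2.le
    have e : q * γ * (1 - β) = (1 - q) + q * (1 - β) ^ 2 := by rw [hγ]; field_simp
    have h2 : q * γ ≤ 2 := by
      have h4 : q * (1 - β) ^ 2 ≤ q * (1 - β) := by
        gcongr; nlinarith
      by_contra! h3
      nlinarith
    have : 0 ≤ q * γ := by positivity
    nlinarith
  set w' := x.w - η • x.z with hw'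
  have hww : ‖w' - x.w‖ ^ 2 = η ^ 2 * ‖x.z‖ ^ 2 := by
    have : w' - x.w = -(η • x.z) := by rw [hw']; abel
    rw [this, norm_neg, norm_smul, mul_pow, Real.norm_eq_abs, sq_abs]
  have hD : ‖g i w' - g i x.w‖ ^ 2 ≤ Cg ^ 2 * (η ^ 2 * ‖x.z‖ ^ 2) := by
    rw [← hww, ← mul_pow]
    exact pow_le_pow_left₀ (norm_nonneg _) (hr.norm_g_sub_le i _ _) 2
  have hb := hr.norm_meanCorrection_sub_le v hx i x.w η
  rw [← hw'] at hb
  rw [hww]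
  have hδ0 : 0 ≤ η ^ 2 * ‖x.z‖ ^ 2 := by positivity
  set δ := η ^ 2 * ‖x.z‖ ^ 2
  have key := error_correction_le hq hq1 hβ hβ1 hγ (x.u i - g i x.w) (g i w' - g i x.w)
    (v.meanCorrection (g i) x.w w' - (g i w' - g i x.w))
  have e1 : x.u i - g i x.w - (g i w' - g i x.w) = x.u i - g i w' := by abel
  have e2 : g i w' - g i x.w + (v.meanCorrection (g i) x.w w' - (g i w' - g i x.w))
      = v.meanCorrection (g i) x.w w' := by abel
  rw [e1, e2] at key
  have k1 : 9 / q * ‖g i w' - g i x.w‖ ^ 2 ≤ 9 * Cg ^ 2 / q * δ := by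
    calc _ ≤ 9 / q * (Cg ^ 2 * δ) := by gcongr
      _ = _ := by ring
  -- The factor 1/β in front of the bias is absorbed by η² ≤ β q².
  have k2 : 12 / (q * β) * ‖v.meanCorrection (g i) x.w w' - (g i w' - g i x.w)‖ ^ 2
      ≤ 12 * (Lg ^ 2 * (Cf * Cg) ^ 2) / q * δ := by
    calc _ ≤ 12 / (q * β) * (Lg ^ 2 * (Cf * Cg) ^ 2 * (β * q ^ 2 * δ)) := by
          refine mul_le_mul_of_nonneg_left (hb.trans ?_) (by positivity)
          gcongr
      _ = 12 * (Lg ^ 2 * (Cf * Cg) ^ 2) * q * δ := by field_simp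
      _ ≤ _ := by
          gcongr
          rw [le_div_iff₀ hq, mul_assoc]
          refine mul_le_of_le_one_right (by positivity) (by nlinarith)
  have k3 : q * (2 * (γ ^ 2 * ((Cg ^ 2 + σ ^ 2) * δ))) ≤ (8 * Cg ^ 2 + 8 * σ ^ 2) / q * δ := by
    calc _ = 2 * (q * γ) ^ 2 * (Cg ^ 2 + σ ^ 2) / q * δ := by field_simp
      _ ≤ 2 * 4 * (Cg ^ 2 + σ ^ 2) / q * δ := by gcongr
      _ = _ := by ring
  -- Slack: 17 = 9 + 8 collects the Cg² terms, while the summand 1 only keeps the constant positive.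
  have k4 : 0 ≤ 1 / q * δ := by positivity
  have e3 : (17 * Cg ^ 2 + 12 * (Lg ^ 2 * (Cf * Cg) ^ 2) + 8 * σ ^ 2 + 1) / q * δ
      = 9 * Cg ^ 2 / q * δ + 12 * (Lg ^ 2 * (Cf * Cg) ^ 2) / q * δ
        + (8 * Cg ^ 2 + 8 * σ ^ 2) / q * δ + 1 / q * δ := by ring
  rw [e3]
  linarith

/-- The gradient estimator after a step, on average over the blocks. -/
theorem Regular.blockAvg_gradient_error_le (hr : Regular Cf Lf Cg Lg f g) (h₁ : 1 ≤ B₁)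
    (hm : B₁ ≤ m) (x : State d p m) {η α : ℝ} (hα : 0 < α) (hα1 : α ≤ 1) :
    blockAvg B₁ (fun B => ‖(1 - α) • x.z + (α / B₁) • ∑ i ∈ B,
        blockGradient f g (x.w - η • x.z) x.u i - ∇ (objective f g) (x.w - η • x.z)‖ ^ 2) ≤
      (1 - α) * ‖x.z - ∇ (objective f g) x.w‖ ^ 2
      + 2 / α * ((Cf * Lg + Cg ^ 2 * Lf) ^ 2 * (η ^ 2 * ‖x.z‖ ^ 2))
      + 4 * α * (Cg ^ 2 * Lf ^ 2 * ((1 / (m : ℝ)) * ∑ i, ‖x.u i - g i x.w‖ ^ 2)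
        + Cg ^ 4 * Lf ^ 2 * (η ^ 2 * ‖x.z‖ ^ 2))
      + α ^ 2 / B₁ * (Cf * Cg) ^ 2 := by
  have hm1 : 1 ≤ m := h₁.trans hm
  have h0 : (0 : ℝ) < m := by exact_mod_cast hm1
  have h1 : (0 : ℝ) < B₁ := by exact_mod_cast h₁
  set w' := x.w - η • x.z with hw'
  have hww : ‖w' - x.w‖ ^ 2 = η ^ 2 * ‖x.z‖ ^ 2 := by
    have : w' - x.w = -(η • x.z) := by rw [hw']; abel
    rw [this, norm_neg, norm_smul, mul_pow, Real.norm_eq_abs, sq_abs]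
  rw [← hww]
  set δ := ‖w' - x.w‖ ^ 2 with hδ
  set h := blockGradient f g w' x.u with hh
  set hb := (1 / (m : ℝ)) • ∑ i, h i with hhb
  set U := (1 / (m : ℝ)) * ∑ i, ‖x.u i - g i x.w‖ ^ 2 with hU
  -- The update of z uses the old `u`, so at a fixed state the vectors `h i` do not depend on the
  -- blocks and the block mean is unbiased for `hb`.
  have a1 := blockAvg_norm_add_sq_le h₁ hm ((1 - α) • x.z + α • hb - ∇ (objective f g) w') α h
  have e1 : ∀ B : Finset (Fin m), (1 - α) • x.z + α • hb - ∇ (objective f g) w'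
      + α • ((1 / (B₁ : ℝ)) • ∑ i ∈ B, h i - (1 / (m : ℝ)) • ∑ i, h i)
      = (1 - α) • x.z + (α / B₁) • ∑ i ∈ B, h i - ∇ (objective f g) w' := by
    intro B
    rw [← hhb, smul_sub, smul_smul α (1 / (B₁ : ℝ)), mul_one_div]
    abel
  simp_rw [e1] at a1
  refine a1.trans ?_
  have a2 : (1 / (m : ℝ)) * ∑ i, ‖h i‖ ^ 2 ≤ (Cf * Cg) ^ 2 := by
    calc (1 / (m : ℝ)) * ∑ i, ‖h i‖ ^ 2 ≤ (1 / (m : ℝ)) * ∑ _i : Fin m, ((Cf : ℝ) * Cg) ^ 2 := by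
          gcongr; exact hr.norm_blockGradient_le _ _ _
      _ = _ := by simp; field_simp
  have a3 : ‖hb - ∇ (objective f g) w'‖ ^ 2 ≤ 2 * (Cg * Lf) ^ 2 * (U + Cg ^ 2 * δ) := by
    have e2 : hb - ∇ (objective f g) w' = (1 / (m : ℝ)) •
        ∑ i, (h i - blockGradient f g w' (fun i => g i w') i) := by
      rw [hr.gradient_objective, hhb, Finset.sum_sub_distrib, smul_sub]
    have a4 : ∀ i, ‖h i - blockGradient f g w' (fun i => g i w') i‖ ^ 2
        ≤ (Cg * Lf) ^ 2 * (2 * ‖x.u i - g i x.w‖ ^ 2 + 2 * (Cg ^ 2 * δ)) := by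
      intro i
      have b1 := hr.norm_blockGradient_sub_le w' w' x.u (fun i => g i w') i
      simp only [sub_self, norm_zero, mul_zero, zero_add] at b1
      have b2 : ‖x.u i - g i w'‖ ^ 2 ≤ 2 * ‖x.u i - g i x.w‖ ^ 2 + 2 * (Cg ^ 2 * δ) := by
        have b3 := norm_add_sq_le_two (x.u i - g i x.w) (g i x.w - g i w')
        rw [sub_add_sub_cancel] at b3
        refine b3.trans ?_
        gcongr
        rw [hδ, ← mul_pow, norm_sub_rev w']
        exact pow_le_pow_left₀ (norm_nonneg _) (hr.norm_g_sub_le i _ _) 2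
      calc _ ≤ (Cg * Lf * ‖x.u i - g i w'‖) ^ 2 := pow_le_pow_left₀ (norm_nonneg _) b1 2
        _ = (Cg * Lf) ^ 2 * ‖x.u i - g i w'‖ ^ 2 := by ring
        _ ≤ _ := by gcongr
    rw [e2, norm_smul, mul_pow, Real.norm_eq_abs, sq_abs]
    calc (1 / (m : ℝ)) ^ 2 * ‖∑ i, (h i - blockGradient f g w' (fun i => g i w') i)‖ ^ 2
        ≤ (1 / (m : ℝ)) ^ 2 * (m * ∑ i,
          (Cg * Lf) ^ 2 * (2 * ‖x.u i - g i x.w‖ ^ 2 + 2 * (Cg ^ 2 * δ))) := by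
          gcongr
          refine (norm_sum_sq_le Finset.univ _).trans ?_
          rw [Finset.card_univ, Fintype.card_fin]
          gcongr with i
          exact a4 i
      _ = _ := by
          rw [← Finset.mul_sum, Finset.sum_add_distrib, ← Finset.mul_sum, hU]
          simp
          field_simp
  -- Old error, motion of the gradient, and bias caused by the inner errors.
  have e3 : (1 - α) • x.z + α • hb - ∇ (objective f g) w'
      = (1 - α) • (x.z - ∇ (objective f g) x.w)
        + ((1 - α) • (∇ (objective f g) x.w - ∇ (objective f g) w')
          + α • (hb - ∇ (objective f g) w')) := by module
  have a5 : ‖(1 - α) • (∇ (objective f g) x.w - ∇ (objective f g) w')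
          + α • (hb - ∇ (objective f g) w')‖ ^ 2
      ≤ 2 * ((Cf * Lg + Cg ^ 2 * Lf) ^ 2 * δ)
        + 2 * (α ^ 2 * (2 * (Cg * Lf) ^ 2 * (U + Cg ^ 2 * δ))) := by
    refine (norm_add_sq_le_two _ _).trans ?_
    gcongr
    · rw [norm_smul, Real.norm_of_nonneg (by linarith), hδ, ← mul_pow]
      refine pow_le_pow_left₀ (by positivity) ?_ 2
      have b1 := hr.norm_gradient_objective_sub_le hm1 x.w w'
      rw [norm_sub_rev x.w] at b1
      refine le_trans ?_ b1
      exact mul_le_of_le_one_left (norm_nonneg _) (by linarith)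
    · rw [norm_smul, mul_pow, Real.norm_eq_abs, sq_abs]
      gcongr
  have a6 : ‖(1 - α) • x.z + α • hb - ∇ (objective f g) w'‖ ^ 2
      ≤ (1 - α) * ‖x.z - ∇ (objective f g) x.w‖ ^ 2 + 1 / α *
        (2 * ((Cf * Lg + Cg ^ 2 * Lf) ^ 2 * δ)
        + 2 * (α ^ 2 * (2 * (Cg * Lf) ^ 2 * (U + Cg ^ 2 * δ)))) := by
    rw [e3]
    refine (norm_convex_sq_le hα hα1 _ _).trans ?_
    gcongr
  have e4 : 1 / α * (2 * ((Cf * Lg + Cg ^ 2 * Lf : ℝ) ^ 2 * δ)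
        + 2 * (α ^ 2 * (2 * (Cg * Lf) ^ 2 * (U + Cg ^ 2 * δ))))
      = 2 / α * ((Cf * Lg + Cg ^ 2 * Lf) ^ 2 * δ)
      + 4 * α * (Cg ^ 2 * Lf ^ 2 * U + Cg ^ 4 * Lf ^ 2 * δ) := by
    field_simp; ring
  rw [e4] at a6
  have a7 : α ^ 2 / B₁ * ((1 / (m : ℝ)) * ∑ i, ‖h i‖ ^ 2) ≤ α ^ 2 / B₁ * (Cf * Cg) ^ 2 := by
    gcongr
  linarith

end OneStep

/-! ### Choice of the constants -/

/-- Admissible constants of the parameter schedule, with `ca = N³`; `c` scales the weight of the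
inner estimators in the Lyapunov function. -/
structure Schedule (Cf Lf Cg Lg : ℝ≥0) (σ N c cα cβ : ℝ) : Prop where
  one_le_N : 1 ≤ N
  c_pos : 0 < c
  cα_pos : 0 < cα
  one_le_cβ : 1 ≤ cβ
  drift : c * (17 * Cg ^ 2 + 12 * (Lg ^ 2 * (Cf * Cg) ^ 2) + 8 * σ ^ 2 + 1) ≤ 1 / 32
  inner_rate : 4 * (Cg ^ 2 * Lf ^ 2) + c ≤ c * cβ / 2
  outer_rate : 2 * ((Cf * Lg + Cg ^ 2 * Lf) / cα) ^ 2 ≤ 1 / 8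
  smooth_le : 8 * (Cf * Lg + Cg ^ 2 * Lf) ≤ N
  mixed_le : 32 * (Cg ^ 4 * Lf ^ 2) ≤ N
  cβ_le : 2 * cβ ≤ N
  cα_le : cα ≤ N

/-- The constants are not circular: c is fixed by the drift, then cβ by c (with equality in
`inner_rate`), cα by the smoothness of F, and N last, above all of them. -/
theorem exists_schedule (Cf Lf Cg Lg : ℝ≥0) (σ : ℝ) :
    ∃ N c cα cβ : ℝ, Schedule Cf Lf Cg Lg σ N c cα cβ := by
  set C₁ : ℝ := 17 * Cg ^ 2 + 12 * (Lg ^ 2 * (Cf * Cg) ^ 2) + 8 * σ ^ 2 + 1 with hC₁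
  have hC₁0 : 0 < C₁ := by positivity
  set L : ℝ := Cf * Lg + Cg ^ 2 * Lf with hL
  have hL0 : 0 ≤ L := by positivity
  set c : ℝ := 1 / (32 * C₁) with hc
  have hc0 : 0 < c := by positivity
  set cβ : ℝ := 2 + 8 * (Cg ^ 2 * Lf ^ 2) / c with hcβ
  have hcβ0 : 2 ≤ cβ := by
    have : 0 ≤ 8 * ((Cg : ℝ) ^ 2 * Lf ^ 2) / c := by positivity
    linarith
  have hM : 0 ≤ 32 * ((Cg : ℝ) ^ 4 * Lf ^ 2) := by positivity
  refine ⟨8 * L + 32 * (Cg ^ 4 * Lf ^ 2) + 2 * cβ + (4 * L + 1), c, 4 * L + 1, cβ,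
    by linarith, hc0, by linarith, by linarith, ?_, ?_, ?_, by linarith, by linarith,
    by linarith, by linarith⟩
  · rw [← hC₁, hc]; exact le_of_eq (by field_simp)
  · exact le_of_eq (by rw [hcβ]; field_simp; ring)
  · have h1 : L / (4 * L + 1) ≤ 1 / 4 := by
      rw [div_le_iff₀ (by linarith)]; linarith
    have h2 : 0 ≤ L / (4 * L + 1) := by positivity
    nlinarith

/-! ### The one-step inequality -/

section LyapunovStep

variable {d p m : ℕ} {Ω S : Type*} [MeasurableSpace Ω] [MeasurableSpace S]
  {μ : Measure Ω} [IsProbabilityMeasure μ] {Cf Lf Cg Lg : ℝ≥0} {σ : ℝ} {B₁ B₂ : ℕ}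
  {f : Fin m → Vec p → ℝ} {g : Fin m → Vec d → Vec p}
  {G : Fin m → Vec d → S → Vec p} {J : Fin m → Vec d → S → (Vec d →L[ℝ] Vec p)}
  {blocks : ℕ → Ω → Finset (Fin m)} {ξ : ℕ → Ω → Fin m → S}
  {u₁ : Ω → Fin m → Vec p} {z₁ : Ω → Vec d} {N c cα cβ : ℝ}

/-- A bound for the conditional expectation of the Lyapunov function given the blocks. -/
noncomputable def stepBound (f : Fin m → Vec p → ℝ) (g : Fin m → Vec d → Vec p) (v : Variant)
    (x : State d p m) (σ : ℝ) (B₁ B₂ : ℕ) (Cf Cg : ℝ≥0) (η α β cz cu : ℝ)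
    (B : Finset (Fin m)) : ℝ :=
  objective f g (x.w - η • x.z) - (⨅ w, objective f g w)
      + cz * (‖(1 - α) • x.z + (α / B₁) • ∑ i ∈ B, blockGradient f g (x.w - η • x.z) x.u i
          - ∇ (objective f g) (x.w - η • x.z)‖ ^ 2 + α ^ 2 * (Cf ^ 2 * (σ ^ 2 / B₂)))
      + cu * ((1 / (m : ℝ)) * ∑ i, if i ∈ B then
          ‖(1 - β) • (x.u i - g i (x.w - η • x.z))
            + gammaCoeff m B₁ β • v.meanCorrection (g i) x.w (x.w - η • x.z)‖ ^ 2
          + (2 * (β ^ 2 * (σ ^ 2 / B₂)) + 2 * (gammaCoeff m B₁ β ^ 2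
            * ((Cg ^ 2 + σ ^ 2) * ‖x.w - η • x.z - x.w‖ ^ 2)))
        else ‖x.u i - g i (x.w - η • x.z)‖ ^ 2)

theorem Regular.blockAvg_stepBound_le (hr : Regular Cf Lf Cg Lg f g) (h₁ : 1 ≤ B₁)
    (hm : B₁ ≤ m) {v : Variant} {x : State d p m} (hx : v.AdmitsInit (Cf * Cg) x.z)
    {η α β cz cu : ℝ} (hα : 0 < α) (hα1 : α ≤ 1) (hβ : 0 < β) (hβ1 : β ≤ 1 / 2)
    (hηβ : η ^ 2 ≤ β * ((B₁ : ℝ) / m) ^ 2) (hcz : 0 ≤ cz) (hcu : 0 ≤ cu) :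
    blockAvg B₁ (stepBound f g v x σ B₁ B₂ Cf Cg η α β cz cu) ≤
      objective f g (x.w - η • x.z) - (⨅ w, objective f g w)
      + cz * ((1 - α) * ‖x.z - ∇ (objective f g) x.w‖ ^ 2
        + 2 / α * ((Cf * Lg + Cg ^ 2 * Lf) ^ 2 * (η ^ 2 * ‖x.z‖ ^ 2))
        + 4 * α * (Cg ^ 2 * Lf ^ 2 * ((1 / (m : ℝ)) * ∑ i, ‖x.u i - g i x.w‖ ^ 2)
          + Cg ^ 4 * Lf ^ 2 * (η ^ 2 * ‖x.z‖ ^ 2))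
        + (α ^ 2 / B₁ * (Cf * Cg) ^ 2 + α ^ 2 * (Cf ^ 2 * (σ ^ 2 / B₂))))
      + cu * ((1 - (B₁ : ℝ) / m * β / 2) * ((1 / (m : ℝ)) * ∑ i, ‖x.u i - g i x.w‖ ^ 2)
        + (17 * Cg ^ 2 + 12 * (Lg ^ 2 * (Cf * Cg) ^ 2) + 8 * σ ^ 2 + 1) / ((B₁ : ℝ) / m)
          * (η ^ 2 * ‖x.z‖ ^ 2) + 2 * ((B₁ : ℝ) / m) * β ^ 2 * (σ ^ 2 / B₂)) := by
  have h0 : (0 : ℝ) < m := by exact_mod_cast h₁.trans hm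
  unfold stepBound
  rw [blockAvg_add, blockAvg_add, blockAvg_const_mul, blockAvg_const_mul,
    blockAvg_const_mul, blockAvg_add, blockAvg_const hm, blockAvg_const hm, blockAvg_sum]
  have A := hr.blockAvg_gradient_error_le h₁ hm x (η := η) hα hα1
  have B := fun i => hr.blockAvg_inner_error_le h₁ hm hx (η := η) (W := σ ^ 2 / B₂) (σ := σ)
    hβ hβ1 hηβ i
  refine add_le_add (add_le_add le_rfl (mul_le_mul_of_nonneg_left ?_ hcz))
    (mul_le_mul_of_nonneg_left ?_ hcu)
  · linarith
  · refine (mul_le_mul_of_nonneg_left (Finset.sum_le_sum fun i _ => B i)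
      (by positivity)).trans (le_of_eq ?_)
    rw [Finset.sum_add_distrib, Finset.sum_add_distrib, ← Finset.mul_sum]
    simp only [Finset.sum_const, Finset.card_univ, Fintype.card_fin, nsmul_eq_mul]
    have e : ∀ y z s : ℝ, 1 / (m : ℝ) * (y * s + m * z + m * (2 * ((B₁ : ℝ) / m) * β ^ 2
        * (σ ^ 2 / B₂))) = y * (1 / (m : ℝ) * s) + z
          + 2 * ((B₁ : ℝ) / m) * β ^ 2 * (σ ^ 2 / B₂) := by
      intro y z s; field_simp
    exact e _ _ _

/-- Block sampling and Jacobian noise are bounded through η² ≤ min {b₁, b₂}/s, inner noise through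
η³ ≤ q²b₂/s. -/
theorem step_noise_le {η q s R Cf b₁ b₂ : ℝ} (h1 : 0 < b₁) (h2 : 0 < b₂) (hq : 0 < q)
    (hη : 0 < η) (hs : 0 < s) (hc : 0 ≤ c) (hcα : 0 < cα) (hη2 : η ^ 2 ≤ min b₁ b₂ / s)
    (hη3 : η ^ 3 ≤ q ^ 2 * b₂ / s) :
    1 / cα * ((cα * η) ^ 2 / b₁ * R ^ 2 + (cα * η) ^ 2 * (Cf ^ 2 * (σ ^ 2 / b₂)))
      + 2 * (c * q / η) * (2 * q * (cβ * (η ^ 2 / q ^ 2)) ^ 2 * (σ ^ 2 / b₂))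
      ≤ (cα * (R ^ 2 + Cf ^ 2 * σ ^ 2) + 4 * c * cβ ^ 2 * σ ^ 2) / s := by
  have n1 : η ^ 2 / b₁ ≤ 1 / s := by
    rw [div_le_iff₀ h1, one_div_mul_eq_div]
    exact hη2.trans (by gcongr; exact min_le_left _ _)
  have n2 : η ^ 2 / b₂ ≤ 1 / s := by
    rw [div_le_iff₀ h2, one_div_mul_eq_div]
    exact hη2.trans (by gcongr; exact min_le_right _ _)
  have n3 : η ^ 3 / (q ^ 2 * b₂) ≤ 1 / s := by
    rw [div_le_iff₀ (by positivity), one_div_mul_eq_div]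
    exact hη3
  calc _ = cα * (R ^ 2 * (η ^ 2 / b₁) + Cf ^ 2 * σ ^ 2 * (η ^ 2 / b₂))
        + 4 * c * cβ ^ 2 * σ ^ 2 * (η ^ 3 / (q ^ 2 * b₂)) := by field_simp; ring
    _ ≤ cα * (R ^ 2 * (1 / s) + Cf ^ 2 * σ ^ 2 * (1 / s))
        + 4 * c * cβ ^ 2 * σ ^ 2 * (1 / s) := by gcongr
    _ = _ := by ring

-- The one-step inequality at a frozen state. Nonnegative extended integrals are used so that
-- integrability of the potential along the trajectory is never an issue.
set_option maxHeartbeats 1000000 in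
theorem lintegral_lyapunov_step_le (H : Oracle μ Cg Lg σ B₂ g G J ξ)
    (hr : Regular Cf Lf Cg Lg f g) (HS : Sampling μ B₁ blocks ξ u₁ z₁)
    (hbd : BddBelow (Set.range (objective f g))) (hsch : Schedule Cf Lf Cg Lg σ N c cα cβ)
    (h₁ : 1 ≤ B₁) (hm : B₁ ≤ m) (h₂ : 1 ≤ B₂) {v : Variant} {x : State d p m}
    (hx : v.AdmitsInit (Cf * Cg) x.z) {t : ℕ} (ht : 1 ≤ t) {a η η' : ℝ}
    (ha : a = N ^ 3 * (m * B₂ / B₁)) (hη : η = stepSize m B₁ B₂ a t)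
    (hη' : η' = stepSize m B₁ B₂ a (t + 1)) :
    ∫⁻ ω, ENNReal.ofReal (lyapunov f g (1 / cα) (c * ((B₁ : ℝ) / m) / η')
        (step v B₁ (Cf * Cg) f G J η (cα * η) (cβ * (m ^ 2 * η ^ 2 / B₁ ^ 2))
          (blocks (t + 1) ω) (ξ (t + 1) ω) x)) ∂μ
      + ENNReal.ofReal (η / 2 * ‖∇ (objective f g) x.w‖ ^ 2) ≤
    ENNReal.ofReal (lyapunov f g (1 / cα) (c * ((B₁ : ℝ) / m) / η) x)
      + ENNReal.ofReal ((cα * ((Cf * Cg) ^ 2 + Cf ^ 2 * σ ^ 2) + 4 * c * cβ ^ 2 * σ ^ 2)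
          / (a + t)) := by
  have hm1 : 1 ≤ m := h₁.trans hm
  have h0 : (0 : ℝ) < m := by exact_mod_cast hm1
  have h1 : (0 : ℝ) < B₁ := by exact_mod_cast h₁
  have h2 : (0 : ℝ) < B₂ := by exact_mod_cast h₂
  have hN0 : 0 < N := by linarith [hsch.one_le_N]
  have ha0 : 0 < a := by rw [ha]; positivity
  have hs : 0 < a + t := by positivity
  have hs' : 0 < a + (t + 1 : ℕ) := by positivity
  have hη0 : 0 < η := hη ▸ stepSize_pos h₁ hm h₂ hs
  have hη'0 : 0 < η' := hη' ▸ stepSize_pos h₁ hm h₂ hs'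
  have hq1 : (B₁ : ℝ) / m ≤ 1 := by rw [div_le_one h0]; exact_mod_cast hm
  have hηq : η ≤ (B₁ : ℝ) / m / N := by rw [hη, ha]; exact stepSize_le_ratio h₁ hm h₂ hN0
  have hηs : (B₁ : ℝ) / m ≤ η ^ 2 * (a + t) := by
    rw [hη, ha]; exact ratio_le_stepSize_sq_mul h₁ hm h₂ hsch.one_le_N
  have hηη : η ≤ (1 + 1 / (a + t)) * η' := by rw [hη, hη']; exact stepSize_le_succ hs
  have hη3 : η ^ 3 ≤ ((B₁ : ℝ) / m) ^ 2 * B₂ / (a + t) := hη ▸ stepSize_cube_le hs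
  have hη2 : η ^ 2 ≤ min (B₁ : ℝ) B₂ / (a + t) := hη ▸ stepSize_sq_le hs
  have hβe : cβ * (m ^ 2 * η ^ 2 / B₁ ^ 2) = cβ * (η ^ 2 / ((B₁ : ℝ) / m) ^ 2) := by field_simp
  rw [hβe]
  have hq : (0 : ℝ) < (B₁ : ℝ) / m := by positivity
  have hηN : η * N ≤ (B₁ : ℝ) / m := by rwa [le_div_iff₀ hN0] at hηq
  have hηq' : η ≤ (B₁ : ℝ) / m := by nlinarith [hsch.one_le_N]
  have hratio : η / ((B₁ : ℝ) / m) ≤ 1 / N := by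
    rw [div_le_div_iff₀ hq hN0]; linarith
  set q := (B₁ : ℝ) / m with hqdef
  have hηsq : η ^ 2 / q ^ 2 ≤ 1 / N := by
    rw [← div_pow]
    calc (η / q) ^ 2 ≤ (1 / N) ^ 2 := by gcongr
      _ ≤ 1 / N := by
        have : 1 / N ≤ 1 := by rw [div_le_one hN0]; exact hsch.one_le_N
        have : 0 ≤ 1 / N := by positivity
        nlinarith
  have hη1N : η ≤ 1 / N := by
    rw [le_div_iff₀ hN0]; exact hηN.trans hq1
  have hη1 : η ≤ 1 := hηq'.trans hq1
  have hη2q : η ^ 2 ≤ q := by nlinarith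
  have hcβ0 : 0 < cβ := by linarith [hsch.one_le_cβ]
  have hβ0 : 0 < cβ * (η ^ 2 / q ^ 2) := by positivity
  have hβ1 : cβ * (η ^ 2 / q ^ 2) ≤ 1 / 2 := by
    calc cβ * (η ^ 2 / q ^ 2) ≤ cβ * (1 / N) := by gcongr
      _ ≤ 1 / 2 := by
        rw [mul_one_div, div_le_div_iff₀ hN0 (by norm_num)]; linarith [hsch.cβ_le]
  have hηβ : η ^ 2 ≤ cβ * (η ^ 2 / q ^ 2) * q ^ 2 := by
    have : cβ * (η ^ 2 / q ^ 2) * q ^ 2 = cβ * η ^ 2 := by field_simp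
    rw [this]; exact le_mul_of_one_le_left (sq_nonneg _) hsch.one_le_cβ
  set β := cβ * (η ^ 2 / q ^ 2) with hβ
  have hcα0 := hsch.cα_pos
  have hα0 : 0 < cα * η := by positivity
  have hα1 : cα * η ≤ 1 := by
    calc cα * η ≤ N * (1 / N) := mul_le_mul hsch.cα_le hη1N hη0.le hN0.le
      _ = 1 := by field_simp
  set α := cα * η with hα
  have hc0 := hsch.c_pos
  have hcu : 0 ≤ c * q / η' := by positivity
  have hcz : 0 ≤ 1 / cα := by positivity
  set b : Finset (Fin m) → ℝ := stepBound f g v x σ B₁ B₂ Cf Cg η α β (1 / cα) (c * q / η')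
  have hmeas : Measurable fun y : Finset (Fin m) × (Fin m → S) =>
      lyapunov f g (1 / cα) (c * q / η')
        (step v B₁ (Cf * Cg) f G J η α β y.1 y.2 x) :=
    (hr.measurable_lyapunov hm1 _ _).comp
      ((measurable_step (fun i => (hr.f_smooth i).continuous.measurable) H.measurable_value
        H.measurable_jacobian v B₁ (Cf * Cg) η α β).comp (measurable_const.prodMk measurable_id))
  have key := HS.lintegral_blocks_le hm (t := t + 1) (by omega)
    (H.measurable_sample (t + 1) (by omega)) hmeas
    (fun y => lyapunov_nonneg hbd hcz hcu _) (b := b)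
    (fun B hB => H.integral_lyapunov_step_le hr hm1 h₁ h₂ (by omega) v x η α β hcz hcu B hB)
  have avg := hr.blockAvg_stepBound_le h₁ hm hx (η := η) (B₂ := B₂) (σ := σ) hα0 hα1 hβ0 hβ1 hηβ
    hcz hcu
  rw [← hqdef] at avg
  have main := lyapunov_arithmetic (q := q) (η := η) (η' := η') (s := a + t) (c := c) (cα := cα)
    (cβ := cβ) (C₁ := 17 * Cg ^ 2 + 12 * (Lg ^ 2 * (Cf * Cg) ^ 2) + 8 * σ ^ 2 + 1)
    (L := Cf * Lg + Cg ^ 2 * Lf) (M := Cg ^ 2 * Lf ^ 2)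
    (F := objective f g x.w - (⨅ w, objective f g w))
    (F' := objective f g (x.w - η • x.z) - (⨅ w, objective f g w))
    (U := (1 / (m : ℝ)) * ∑ i, ‖x.u i - g i x.w‖ ^ 2)
    (Z := ‖x.z - ∇ (objective f g) x.w‖ ^ 2) (ζ := ‖x.z‖ ^ 2)
    (Γ := ‖∇ (objective f g) x.w‖ ^ 2)
    (n₁ := α ^ 2 / B₁ * (Cf * Cg) ^ 2 + α ^ 2 * (Cf ^ 2 * (σ ^ 2 / B₂)))
    (n₂ := 2 * q * β ^ 2 * (σ ^ 2 / B₂)) (M' := Cg ^ 4 * Lf ^ 2)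
    hq hη0 hη'0 hs hc0 hcα0 (by positivity) (by positivity) (by positivity) (by positivity)
    (by positivity) (by positivity) hηη hηs hη2q hβ1 hq1 hsch.drift hsch.inner_rate
    hsch.outer_rate
    (by
      calc (Cf * Lg + Cg ^ 2 * Lf : ℝ) * η ≤ (N / 8) * (1 / N) :=
            mul_le_mul (by linarith [hsch.smooth_le]) hη1N hη0.le (by positivity)
        _ = 1 / 8 := by field_simp)
    (by
      calc 4 * (Cg ^ 4 * Lf ^ 2 : ℝ) * η ^ 2 ≤ (N / 8) * (1 / N) := by
            refine mul_le_mul (by linarith [hsch.mixed_le]) ?_ (by positivity) (by positivity)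
            exact le_trans (by nlinarith) hη1N
        _ = 1 / 8 := by field_simp)
    (by
      have := hr.objective_descent hm1 x.w x.z η
      linarith)
  have noise := step_noise_le (σ := σ) (R := Cf * Cg) (Cf := Cf) h1 h2 hq hη0 hs hc0.le hcα0 hη2
    hη3 (cβ := cβ)
  have hfin : blockAvg B₁ b + η / 2 * ‖∇ (objective f g) x.w‖ ^ 2 ≤
      lyapunov f g (1 / cα) (c * q / η) x
      + (cα * ((Cf * Cg) ^ 2 + Cf ^ 2 * σ ^ 2) + 4 * c * cβ ^ 2 * σ ^ 2) / (a + t) := by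
    unfold lyapunov
    linarith
  have hb0 : 0 ≤ blockAvg B₁ b := by
    refine div_nonneg (Finset.sum_nonneg fun B hB => ?_) (Nat.cast_nonneg _)
    exact (integral_nonneg fun ω => lyapunov_nonneg hbd hcz hcu _).trans
      (H.integral_lyapunov_step_le hr hm1 h₁ h₂ (t := t + 1) (by omega) v x η α β hcz hcu B
        (Finset.mem_powersetCard_univ.1 hB)).2
  refine (add_le_add_left key _).trans ?_
  rw [← ENNReal.ofReal_add hb0 (by positivity), ← ENNReal.ofReal_add
    (lyapunov_nonneg hbd hcz (by positivity) _) (by positivity)]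
  exact ENNReal.ofReal_le_ofReal hfin

end LyapunovStep

/-! ### Random recursions -/

section Recursion

variable {Ω ι X Y : Type*} [MeasurableSpace Ω] [MeasurableSpace ι] [MeasurableSpace X]
  [MeasurableSpace Y] {μ : Measure Ω} [IsProbabilityMeasure μ]

theorem indepFun_prod_of_indepFun {A : Ω → ι} {B : Ω → X} {C : Ω → Y} (hA : Measurable A)
    (hB : Measurable B) (hC : Measurable C) (h : IndepFun A (fun ω => (B ω, C ω)) μ)
    (h' : IndepFun B C μ) : IndepFun (fun ω => (A ω, B ω)) C μ := by
  have hAB : IndepFun A B μ := h.comp measurable_id measurable_fst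
  rw [indepFun_iff_map_prod_eq_prod_map_map (hA.prodMk hB).aemeasurable hC.aemeasurable]
  rw [indepFun_iff_map_prod_eq_prod_map_map hA.aemeasurable (hB.prodMk hC).aemeasurable] at h
  rw [indepFun_iff_map_prod_eq_prod_map_map hA.aemeasurable hB.aemeasurable] at hAB
  rw [indepFun_iff_map_prod_eq_prod_map_map hB.aemeasurable hC.aemeasurable] at h'
  have : IsProbabilityMeasure (μ.map A) := Measure.isProbabilityMeasure_map hA.aemeasurable
  have : IsProbabilityMeasure (μ.map B) := Measure.isProbabilityMeasure_map hB.aemeasurable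
  have : IsProbabilityMeasure (μ.map C) := Measure.isProbabilityMeasure_map hC.aemeasurable
  rw [hAB, ← (measurePreserving_prodAssoc (μ.map A) (μ.map B) (μ.map C)).symm.map_eq, ← h', ← h,
    Measure.map_map MeasurableEquiv.prodAssoc.symm.measurable (hA.prodMk (hB.prodMk hC))]
  rfl

/-- The state of a random recursion is independent of the next innovation. -/
theorem indepFun_of_recursion {I : Ω → ι} {Z : ℕ → Ω → X} {ζ : ℕ → Ω → Y} {φ : ι → X}
    {Φ : ℕ → X × Y → X} (hI : Measurable I) (hζ : ∀ n, Measurable (ζ n)) (hind : iIndepFun ζ μ)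
    (hI0 : IndepFun I (fun ω n => ζ n ω) μ) (hφ : Measurable φ) (hΦ : ∀ n, Measurable (Φ n))
    (h0 : ∀ ω, Z 0 ω = φ (I ω)) (hs : ∀ n ω, Z (n + 1) ω = Φ n (Z n ω, ζ n ω)) (n : ℕ) :
    Measurable (Z n) ∧ IndepFun (Z n) (ζ n) μ := by
  -- The n-th state is a function of the initial data and of the innovations with index below n, all
  -- of them jointly independent of the n-th.
  have past : ∃ Ψ : ι × (Finset.range n → Y) → X, Measurable Ψ ∧
      ∀ ω, Z n ω = Ψ (I ω, fun k => ζ k ω) := by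
    induction n with
    | zero => exact ⟨fun q => φ q.1, hφ.comp measurable_fst, h0⟩
    | succ n ih =>
      obtain ⟨Ψ, hΨ, hZ⟩ := ih
      refine ⟨fun q => Φ n (Ψ (q.1, fun k => q.2 ⟨k, Finset.mem_range.2
        ((Finset.mem_range.1 k.2).trans n.lt_succ_self)⟩),
        q.2 ⟨n, Finset.self_mem_range_succ n⟩), ?_, fun ω => by rw [hs, hZ]⟩
      refine (hΦ n).comp (Measurable.prodMk (hΨ.comp (measurable_fst.prodMk ?_)) ?_)
      · exact measurable_pi_iff.2 fun k => (measurable_pi_apply _).comp measurable_snd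
      · exact (measurable_pi_apply _).comp measurable_snd
  obtain ⟨Ψ, hΨ, hZ⟩ := past
  have hP : Measurable fun ω => (fun k : Finset.range n => ζ k ω) :=
    measurable_pi_iff.2 fun k => hζ k
  have h1 : IndepFun (fun ω => (fun k : Finset.range n => ζ k ω)) (ζ n) μ := by
    have := hind.indepFun_finset (Finset.range n) {n} (by simp) hζ
    exact this.comp (φ := id) (ψ := fun y => y ⟨n, Finset.mem_singleton_self n⟩) measurable_id
      (measurable_pi_apply (X := fun _ : ({n} : Finset ℕ) => Y) ⟨n, Finset.mem_singleton_self n⟩)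
  have h2 : IndepFun I (fun ω => ((fun k : Finset.range n => ζ k ω), ζ n ω)) μ :=
    hI0.comp (φ := id) (ψ := fun y : ℕ → Y => ((fun k : Finset.range n => y k), y n)) measurable_id
      ((measurable_pi_iff.2 fun k => measurable_pi_apply _).prodMk (measurable_pi_apply n))
  have h3 := indepFun_prod_of_indepFun hI hP (hζ n) h2 h1
  have e : Z n = Ψ ∘ fun ω => (I ω, fun k : Finset.range n => ζ k ω) := funext hZ
  rw [e]
  exact ⟨hΨ.comp (hI.prodMk hP), h3.comp hΨ measurable_id⟩

/-- Freezing: by Fubini an independent argument may be held fixed in the inner integral. This plays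
the role of conditional expectation. -/
theorem lintegral_of_indepFun {A : Ω → X} {B : Ω → Y} (hA : Measurable A) (hB : Measurable B)
    (h : IndepFun A B μ) {F : X × Y → ℝ≥0∞} (hF : Measurable F) :
    ∫⁻ ω, F (A ω, B ω) ∂μ = ∫⁻ ω, ∫⁻ ω', F (A ω, B ω') ∂μ ∂μ := by
  rw [indepFun_iff_map_prod_eq_prod_map_map hA.aemeasurable hB.aemeasurable] at h
  have : IsProbabilityMeasure (μ.map B) := Measure.isProbabilityMeasure_map hB.aemeasurable
  rw [← lintegral_map (f := F) hF (hA.prodMk hB), h, lintegral_prod _ hF.aemeasurable,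
    lintegral_map (f := fun x => ∫⁻ y, F (x, y) ∂(μ.map B)) hF.lintegral_prod_right' hA]
  refine lintegral_congr fun ω => ?_
  rw [lintegral_map (f := fun y => F (A ω, y)) (hF.comp (measurable_const.prodMk measurable_id)) hB]

end Recursion

/-! ### The trajectory -/

theorem Variant.admitsInit_project {d : ℕ} (v : Variant) {R : ℝ} (hR : 0 ≤ R) (x : Vec d) :
    v.AdmitsInit R (v.project R x) := by
  match v with
  | .twoPoint => trivial
  | .twoPointProj => exact norm_projBall_le hR x
  | .singlePointProj => exact norm_projBall_le hR x

section Trajectory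

variable {d p m : ℕ} {Ω S : Type*} [MeasurableSpace Ω]
  {μ : Measure Ω} {Cf Lf Cg Lg : ℝ≥0} {σ : ℝ} {B₁ B₂ : ℕ}
  {f : Fin m → Vec p → ℝ} {g : Fin m → Vec d → Vec p}
  {G : Fin m → Vec d → S → Vec p} {J : Fin m → Vec d → S → (Vec d →L[ℝ] Vec p)}
  {blocks : ℕ → Ω → Finset (Fin m)} {ξ : ℕ → Ω → Fin m → S}
  {w₁ : Vec d} {u₁ : Ω → Fin m → Vec p} {z₁ : Ω → Vec d} {N c cα cβ Δ V : ℝ} {v : Variant}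

/-- The random trajectory. -/
noncomputable def trajectory (v : Variant) (B₁ B₂ : ℕ) (R cα cβ ca : ℝ)
    (f : Fin m → Vec p → ℝ) (G : Fin m → Vec d → S → Vec p)
    (J : Fin m → Vec d → S → (Vec d →L[ℝ] Vec p)) (w₁ : Vec d) (u₁ : Ω → Fin m → Vec p)
    (z₁ : Ω → Vec d) (blocks : ℕ → Ω → Finset (Fin m)) (ξ : ℕ → Ω → Fin m → S) (t : ℕ) (ω : Ω) :
    State d p m :=
  run v B₁ B₂ R cα cβ ca f G J ⟨w₁, u₁ ω, z₁ ω⟩ (fun t => blocks t ω) (fun t => ξ t ω) t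

theorem trajectory_admits (hI : Init μ v (Cf * Cg) Δ V B₂ f g w₁ u₁ z₁) (ca : ℝ) (t : ℕ) (ω : Ω) :
    v.AdmitsInit (Cf * Cg)
      (trajectory v B₁ B₂ (Cf * Cg) cα cβ ca f G J w₁ u₁ z₁ blocks ξ t ω).z := by
  match t with
  | 0 => exact hI.z_admissible ω
  | 1 => exact hI.z_admissible ω
  | _ + 2 => exact v.admitsInit_project (by positivity) _

theorem Init.V_nonneg (hI : Init μ v (Cf * Cg) Δ V B₂ f g w₁ u₁ z₁) : 0 ≤ V :=
  (integral_nonneg fun ω => by positivity).trans hI.z_error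

theorem Init.Δ_nonneg (hI : Init μ v (Cf * Cg) Δ V B₂ f g w₁ u₁ z₁) : 0 ≤ Δ := by
  have := ciInf_le hI.bddBelow w₁
  linarith [hI.gap]

variable [MeasurableSpace S] [IsProbabilityMeasure μ]

/-- Index shift: the recursion starts at time 1 and its n-th innovation is the sample of time n + 2,
which produces the state of that time. -/
theorem trajectory_measurable_indep (H : Oracle μ Cg Lg σ B₂ g G J ξ)
    (hr : Regular Cf Lf Cg Lg f g) (HS : Sampling μ B₁ blocks ξ u₁ z₁)
    (hI : Init μ v (Cf * Cg) Δ V B₂ f g w₁ u₁ z₁) (ca : ℝ) (n : ℕ) :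
    Measurable (trajectory v B₁ B₂ (Cf * Cg) cα cβ ca f G J w₁ u₁ z₁ blocks ξ (n + 1)) ∧
    IndepFun (trajectory v B₁ B₂ (Cf * Cg) cα cβ ca f G J w₁ u₁ z₁ blocks ξ (n + 1))
      (fun ω => (blocks (n + 2) ω, ξ (n + 2) ω)) μ := by
  refine indepFun_of_recursion (I := fun ω => (u₁ ω, z₁ ω))
    (Z := fun n => trajectory v B₁ B₂ (Cf * Cg) cα cβ ca f G J w₁ u₁ z₁ blocks ξ (n + 1))
    (ζ := fun n ω => (blocks (n + 2) ω, ξ (n + 2) ω)) (φ := fun q => ⟨w₁, q.1, q.2⟩)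
    (Φ := fun n q => step v B₁ (Cf * Cg) f G J
      (stepSize m B₁ B₂ (ca * (m * B₂ / B₁)) (n + 1))
      (cα * stepSize m B₁ B₂ (ca * (m * B₂ / B₁)) (n + 1))
      (cβ * (m ^ 2 * stepSize m B₁ B₂ (ca * (m * B₂ / B₁)) (n + 1) ^ 2 / B₁ ^ 2))
      q.2.1 q.2.2 q.1)
    (hI.measurable_u.prodMk hI.measurable_z)
    (fun n => (HS.measurable_blocks _ (by omega)).prodMk (H.measurable_sample _ (by omega)))
    HS.times_indep HS.init_indep ?_ (fun n => ?_) (fun ω => rfl) (fun n ω => rfl) n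
  · exact measurable_to_state measurable_const
      (fun i => (measurable_pi_apply i).comp measurable_fst) measurable_snd
  · exact measurable_step (fun i => (hr.f_smooth i).continuous.measurable) H.measurable_value
      H.measurable_jacobian v B₁ _ _ _ _

/-- Telescoped decrease of the Lyapunov function along the trajectory. -/
theorem sum_lintegral_gradient_le (H : Oracle μ Cg Lg σ B₂ g G J ξ)
    (hr : Regular Cf Lf Cg Lg f g) (HS : Sampling μ B₁ blocks ξ u₁ z₁)
    (hI : Init μ v (Cf * Cg) Δ V B₂ f g w₁ u₁ z₁) (hsch : Schedule Cf Lf Cg Lg σ N c cα cβ)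
    (h₁ : 1 ≤ B₁) (hm : B₁ ≤ m) (h₂ : 1 ≤ B₂) {a : ℝ} (ha : a = N ^ 3 * (m * B₂ / B₁)) (n : ℕ) :
    ∫⁻ ω, ENNReal.ofReal (lyapunov f g (1 / cα)
        (c * ((B₁ : ℝ) / m) / stepSize m B₁ B₂ a (n + 1))
        (trajectory v B₁ B₂ (Cf * Cg) cα cβ (N ^ 3) f G J w₁ u₁ z₁ blocks ξ (n + 1) ω)) ∂μ
      + ∑ k ∈ Finset.range n, ∫⁻ ω, ENNReal.ofReal (stepSize m B₁ B₂ a (k + 1) / 2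
        * ‖∇ (objective f g) (trajectory v B₁ B₂ (Cf * Cg) cα cβ (N ^ 3) f G J w₁ u₁ z₁
          blocks ξ (k + 1) ω).w‖ ^ 2) ∂μ ≤
    ∫⁻ ω, ENNReal.ofReal (lyapunov f g (1 / cα)
        (c * ((B₁ : ℝ) / m) / stepSize m B₁ B₂ a 1) ⟨w₁, u₁ ω, z₁ ω⟩) ∂μ
      + ∑ k ∈ Finset.range n, ENNReal.ofReal
        ((cα * ((Cf * Cg) ^ 2 + Cf ^ 2 * σ ^ 2) + 4 * c * cβ ^ 2 * σ ^ 2)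
          / (a + (k + 1 : ℕ))) := by
  induction n with
  | zero => simp only [Finset.range_zero, Finset.sum_empty, add_zero]; exact le_rfl
  | succ n ih =>
    have hm1 : 1 ≤ m := h₁.trans hm
    obtain ⟨mX, iX⟩ := trajectory_measurable_indep (cα := cα) (cβ := cβ) H hr HS hI (N ^ 3) n
    have adm := trajectory_admits (B₁ := B₁) (cα := cα) (cβ := cβ) (G := G) (J := J)
      (blocks := blocks) (ξ := ξ) hI (N ^ 3) (n + 1)
    set X := trajectory v B₁ B₂ (Cf * Cg) cα cβ (N ^ 3) f G J w₁ u₁ z₁ blocks ξ with hX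
    set η := stepSize m B₁ B₂ a (n + 1) with hη
    have mY : Measurable fun ω => (blocks (n + 2) ω, ξ (n + 2) ω) :=
      (HS.measurable_blocks _ (by omega)).prodMk (H.measurable_sample _ (by omega))
    have mstep := measurable_step (fun i => (hr.f_smooth i).continuous.measurable)
      H.measurable_value H.measurable_jacobian v B₁ (Cf * Cg) η (cα * η)
        (cβ * (m ^ 2 * η ^ 2 / B₁ ^ 2))
    have mF : Measurable fun q : State d p m × (Finset (Fin m) × (Fin m → S)) =>
        ENNReal.ofReal (lyapunov f g (1 / cα)
          (c * ((B₁ : ℝ) / m) / stepSize m B₁ B₂ a (n + 1 + 1))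
          (step v B₁ (Cf * Cg) f G J η (cα * η)
            (cβ * (m ^ 2 * η ^ 2 / B₁ ^ 2)) q.2.1 q.2.2 q.1)) :=
      ((hr.measurable_lyapunov hm1 _ _).comp mstep).ennreal_ofReal
    have e1 : ∀ ω, X (n + 1 + 1) ω = step v B₁ (Cf * Cg) f G J η (cα * η)
        (cβ * (m ^ 2 * η ^ 2 / B₁ ^ 2)) (blocks (n + 2) ω) (ξ (n + 2) ω) (X (n + 1) ω) := by
      intro ω; rw [hη, ha]; rfl
    have e2 := lintegral_of_indepFun mX mY iX mF
    dsimp only at e2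
    have mg : Measurable fun ω => ENNReal.ofReal
        (η / 2 * ‖∇ (objective f g) (X (n + 1) ω).w‖ ^ 2) :=
      (((((hr.continuous_gradient_objective hm1).measurable.comp
        (measurable_state_w.comp mX)).norm).pow_const 2).const_mul _).ennreal_ofReal
    have ml : Measurable fun ω => ENNReal.ofReal
        (lyapunov f g (1 / cα) (c * ((B₁ : ℝ) / m) / η) (X (n + 1) ω)) :=
      ((hr.measurable_lyapunov hm1 _ _).comp mX).ennreal_ofReal
    have one : ∫⁻ ω, ENNReal.ofReal (lyapunov f g (1 / cα)
          (c * ((B₁ : ℝ) / m) / stepSize m B₁ B₂ a (n + 1 + 1)) (X (n + 1 + 1) ω)) ∂μ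
        + ∫⁻ ω, ENNReal.ofReal (η / 2 * ‖∇ (objective f g) (X (n + 1) ω).w‖ ^ 2) ∂μ
        ≤ ∫⁻ ω, ENNReal.ofReal
            (lyapunov f g (1 / cα) (c * ((B₁ : ℝ) / m) / η) (X (n + 1) ω)) ∂μ
          + ENNReal.ofReal ((cα * ((Cf * Cg) ^ 2 + Cf ^ 2 * σ ^ 2) + 4 * c * cβ ^ 2 * σ ^ 2)
          / (a + (n + 1 : ℕ))) := by
      simp_rw [e1]
      rw [e2, ← lintegral_add_right _ mg]
      calc _ ≤ ∫⁻ ω, (ENNReal.ofReal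
            (lyapunov f g (1 / cα) (c * ((B₁ : ℝ) / m) / η) (X (n + 1) ω))
          + ENNReal.ofReal ((cα * ((Cf * Cg) ^ 2 + Cf ^ 2 * σ ^ 2) + 4 * c * cβ ^ 2 * σ ^ 2)
          / (a + (n + 1 : ℕ)))) ∂μ := lintegral_mono fun ω =>
            lintegral_lyapunov_step_le H hr HS hI.bddBelow hsch h₁ hm h₂ (adm ω)
              (t := n + 1) (by omega) ha hη rfl
        _ = _ := by rw [lintegral_add_left ml]; simp
    rw [Finset.sum_range_succ, Finset.sum_range_succ]
    calc _ = (∫⁻ ω, ENNReal.ofReal (lyapunov f g (1 / cα)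
          (c * ((B₁ : ℝ) / m) / stepSize m B₁ B₂ a (n + 1 + 1)) (X (n + 1 + 1) ω)) ∂μ
        + ∫⁻ ω, ENNReal.ofReal (η / 2 * ‖∇ (objective f g) (X (n + 1) ω).w‖ ^ 2) ∂μ)
        + ∑ k ∈ Finset.range n, ∫⁻ ω, ENNReal.ofReal (stepSize m B₁ B₂ a (k + 1) / 2
        * ‖∇ (objective f g) (X (k + 1) ω).w‖ ^ 2) ∂μ := by ring
      _ ≤ _ := add_le_add_left one _
      _ = (∫⁻ ω, ENNReal.ofReal
            (lyapunov f g (1 / cα) (c * ((B₁ : ℝ) / m) / η) (X (n + 1) ω)) ∂μ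
        + ∑ k ∈ Finset.range n, ∫⁻ ω, ENNReal.ofReal (stepSize m B₁ B₂ a (k + 1) / 2
        * ‖∇ (objective f g) (X (k + 1) ω).w‖ ^ 2) ∂μ)
        + ENNReal.ofReal ((cα * ((Cf * Cg) ^ 2 + Cf ^ 2 * σ ^ 2) + 4 * c * cβ ^ 2 * σ ^ 2)
          / (a + (n + 1 : ℕ))) := by ring
      _ ≤ _ := add_le_add_left ih _
      _ = _ := by ring

/-- The weight c q/η₁ may be large, but its product with min {1, √(m/B₂)} is at most 2cN³ by
`ratio_mul_min_le_stepSize_one`. -/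
theorem lintegral_lyapunov_init_le (hI : Init μ v (Cf * Cg) Δ V B₂ f g w₁ u₁ z₁)
    (hsch : Schedule Cf Lf Cg Lg σ N c cα cβ)
    (h₁ : 1 ≤ B₁) (hm : B₁ ≤ m) (h₂ : 1 ≤ B₂) {a : ℝ} (ha : a = N ^ 3 * (m * B₂ / B₁)) :
    ∫⁻ ω, ENNReal.ofReal (lyapunov f g (1 / cα)
        (c * ((B₁ : ℝ) / m) / stepSize m B₁ B₂ a 1) ⟨w₁, u₁ ω, z₁ ω⟩) ∂μ
      ≤ ENNReal.ofReal (Δ + 1 / cα * V + 2 * c * N ^ 3 * V) := by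
  have h0 : (0 : ℝ) < m := by exact_mod_cast h₁.trans hm
  have h1 : (0 : ℝ) < B₁ := by exact_mod_cast h₁
  have h2 : (0 : ℝ) < B₂ := by exact_mod_cast h₂
  have hN0 : 0 < N := by linarith [hsch.one_le_N]
  have ha0 : 0 < a := by rw [ha]; positivity
  have hη0 : 0 < stepSize m B₁ B₂ a 1 := stepSize_pos h₁ hm h₂ (by positivity)
  have hratio := ratio_mul_min_le_stepSize_one h₁ hm h₂ hsch.one_le_N
  rw [← ha] at hratio
  set η := stepSize m B₁ B₂ a 1
  have hc0 := hsch.c_pos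
  have hcα0 := hsch.cα_pos
  have hP : 0 ≤ c * ((B₁ : ℝ) / m) / η := by positivity
  set P := c * ((B₁ : ℝ) / m) / η with hPd
  have hV := hI.V_nonneg
  have iz := hI.z_integrable.const_mul (1 / cα)
  have iu := ((integrable_finsetSum Finset.univ fun i _ =>
    hI.u_integrable i).const_mul (1 / (m : ℝ))).const_mul P
  have i1 : Integrable (fun ω => objective f g w₁ - (⨅ w, objective f g w)
      + 1 / cα * ‖z₁ ω - ∇ (objective f g) w₁‖ ^ 2) μ := (integrable_const _).add iz
  have i2 : Integrable (fun ω => lyapunov f g (1 / cα) P ⟨w₁, u₁ ω, z₁ ω⟩) μ := i1.add iu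
  rw [← ofReal_integral_eq_lintegral_ofReal i2
    (ae_of_all _ fun ω => lyapunov_nonneg hI.bddBelow (by positivity) hP _)]
  refine ENNReal.ofReal_le_ofReal ?_
  unfold lyapunov
  rw [integral_add i1 iu, integral_add (integrable_const _) iz, integral_const_mul,
    integral_const_mul, integral_const_mul,
    integral_finsetSum Finset.univ fun i _ => hI.u_integrable i]
  simp only [integral_const, probReal_univ, one_smul]
  refine add_le_add (add_le_add hI.gap (mul_le_mul_of_nonneg_left hI.z_error (by positivity))) ?_
  calc P * _ ≤ P * (V * min 1 √((m : ℝ) / B₂)) := mul_le_mul_of_nonneg_left hI.u_error hP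
    _ = c * V * (((B₁ : ℝ) / m * min 1 √((m : ℝ) / B₂)) / η) := by rw [hPd]; ring
    _ ≤ c * V * ((2 * N ^ 3 * η) / η) := by gcongr
    _ = _ := by field_simp

/-- The averaged squared gradient norm is bounded in terms of the last step size. -/
theorem sum_integral_gradient_le (H : Oracle μ Cg Lg σ B₂ g G J ξ)
    (hr : Regular Cf Lf Cg Lg f g) (HS : Sampling μ B₁ blocks ξ u₁ z₁)
    (hI : Init μ v (Cf * Cg) Δ V B₂ f g w₁ u₁ z₁) (hsch : Schedule Cf Lf Cg Lg σ N c cα cβ)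
    (h₁ : 1 ≤ B₁) (hm : B₁ ≤ m) (h₂ : 1 ≤ B₂) {a : ℝ} (ha : a = N ^ 3 * (m * B₂ / B₁)) (T : ℕ) :
    stepSize m B₁ B₂ a T / 2 * ∑ k ∈ Finset.range T, ∫ ω, ‖∇ (objective f g)
        (trajectory v B₁ B₂ (Cf * Cg) cα cβ (N ^ 3) f G J w₁ u₁ z₁ blocks ξ (k + 1) ω).w‖ ^ 2 ∂μ
      ≤ (Δ + 1 / cα * V + 2 * c * N ^ 3 * V)
        + (cα * ((Cf * Cg) ^ 2 + Cf ^ 2 * σ ^ 2) + 4 * c * cβ ^ 2 * σ ^ 2)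
          * Real.log (1 + T / a) := by
  have hm1 : 1 ≤ m := h₁.trans hm
  have h0 : (0 : ℝ) < m := by exact_mod_cast hm1
  have h1 : (0 : ℝ) < B₁ := by exact_mod_cast h₁
  have h2 : (0 : ℝ) < B₂ := by exact_mod_cast h₂
  have hN0 : 0 < N := by linarith [hsch.one_le_N]
  have ha0 : 0 < a := by rw [ha]; positivity
  have hc0 := hsch.c_pos
  have hcα0 := hsch.cα_pos
  have hV := hI.V_nonneg
  have hΔ := hI.Δ_nonneg
  have hη0 : ∀ k : ℕ, 0 ≤ stepSize m B₁ B₂ a (k + 1) :=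
    fun k => stepSize_nonneg (by positivity)
  have mX := fun k =>
    (trajectory_measurable_indep (cα := cα) (cβ := cβ) H hr HS hI (N ^ 3) k).1
  have main := sum_lintegral_gradient_le H hr HS hI hsch h₁ hm h₂ ha T
  set X := trajectory v B₁ B₂ (Cf * Cg) cα cβ (N ^ 3) f G J w₁ u₁ z₁ blocks ξ with hX
  set Cn := cα * ((Cf * Cg : ℝ) ^ 2 + Cf ^ 2 * σ ^ 2) + 4 * c * cβ ^ 2 * σ ^ 2 with hCn
  have hCn0 : 0 ≤ Cn := by positivity
  -- The gradient is bounded by Cf Cg, so its integrals can be returned to the reals.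
  have ig : ∀ k, Integrable (fun ω => ‖∇ (objective f g) (X (k + 1) ω).w‖ ^ 2) μ := by
    intro k
    refine Integrable.of_bound ((((hr.continuous_gradient_objective hm1).measurable.comp
      (measurable_state_w.comp (mX k))).norm).pow_const 2).aestronglyMeasurable
      (((Cf : ℝ) * Cg) ^ 2) (ae_of_all _ fun ω => ?_)
    rw [Real.norm_of_nonneg (by positivity)]
    exact pow_le_pow_left₀ (norm_nonneg _) (hr.norm_gradient_objective_le hm1 _) 2
  have e1 : ∀ k, ∫⁻ ω, ENNReal.ofReal (stepSize m B₁ B₂ a (k + 1) / 2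
      * ‖∇ (objective f g) (X (k + 1) ω).w‖ ^ 2) ∂μ = ENNReal.ofReal
      (stepSize m B₁ B₂ a (k + 1) / 2 * ∫ ω, ‖∇ (objective f g) (X (k + 1) ω).w‖ ^ 2 ∂μ) := by
    intro k
    rw [← integral_const_mul, ofReal_integral_eq_lintegral_ofReal ((ig k).const_mul _)
      (ae_of_all _ fun ω => mul_nonneg (by linarith [hη0 k]) (by positivity))]
  simp_rw [e1] at main
  -- The final potential is nonnegative and is dropped.
  have main2 := (le_add_self.trans main).trans
    (add_le_add_left (lintegral_lyapunov_init_le hI hsch h₁ hm h₂ ha) _)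
  have hA0 : ∀ k, 0 ≤ ∫ ω, ‖∇ (objective f g) (X (k + 1) ω).w‖ ^ 2 ∂μ :=
    fun k => integral_nonneg fun ω => by positivity
  rw [← ENNReal.ofReal_sum_of_nonneg fun k _ =>
      mul_nonneg (by linarith [hη0 k]) (hA0 k),
    ← ENNReal.ofReal_sum_of_nonneg fun k _ => by positivity,
    ← ENNReal.ofReal_add (by positivity) (Finset.sum_nonneg fun k _ => by positivity),
    ENNReal.ofReal_le_ofReal_iff (add_nonneg (by positivity)
      (Finset.sum_nonneg fun k _ => by positivity))] at main2
  rw [Finset.mul_sum]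
  refine (Finset.sum_le_sum fun k hk => ?_).trans (main2.trans (add_le_add le_rfl ?_))
  · refine mul_le_mul_of_nonneg_right ?_ (hA0 k)
    have := stepSize_antitone (m := m) (B₁ := B₁) (B₂ := B₂) (a := a) (t := k + 1) (t' := T)
      (by positivity) (Finset.mem_range.1 hk)
    linarith
  · calc ∑ k ∈ Finset.range T, Cn / (a + (k + 1 : ℕ))
        = Cn * ∑ k ∈ Finset.range T, 1 / (a + (k + 1 : ℕ)) := by
          rw [Finset.mul_sum]; exact Finset.sum_congr rfl fun k _ => by ring
      _ ≤ _ := mul_le_mul_of_nonneg_left (sum_inv_le_log ha0 T) hCn0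

end Trajectory

/-! ### The random output -/

theorem integral_uniformOn_Icc (T : ℕ) (φ : ℕ → ℝ) :
    ∫ t, φ t ∂(uniformOn (Set.Icc 1 T)) = 1 / (T : ℝ) * ∑ k ∈ Finset.range T, φ (k + 1) := by
  have e : Set.Icc 1 T = ((Finset.Icc 1 T : Finset ℕ) : Set ℕ) := by simp
  have e2 : ∑ k ∈ Finset.range T, φ (k + 1) = ∑ k ∈ Finset.Icc 1 T, φ k := by
    rw [Finset.range_eq_Ico, Finset.sum_Ico_add' φ 0 T 1]
    rfl
  have hc : Measure.count (Set.Icc 1 T) = (T : ENNReal) := by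
    rw [e, Measure.count_apply_finset, Nat.card_Icc, Nat.add_sub_cancel]
  have hint : IntegrableOn φ (Set.Icc 1 T) Measure.count := by
    have hfin : IsFiniteMeasure (Measure.count.restrict (Set.Icc 1 T)) :=
      ⟨by rw [Measure.restrict_apply_univ, hc]; exact ENNReal.natCast_lt_top T⟩
    have := IntegrableOn.finset (μ := Measure.count.restrict (Set.Icc 1 T)) (f := φ)
      (s := Finset.Icc 1 T)
    rwa [IntegrableOn, Finset.coe_Icc, Measure.restrict_restrict measurableSet_Icc,
      Set.inter_self] at this
  rw [uniformOn, ProbabilityTheory.cond, integral_smul_measure, hc, e2]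
  rw [e] at hint ⊢
  rw [setIntegral_finset _ hint]
  simp

/-- From mean square to mean by y ≤ ε/2 + y²/(2ε): both halves contribute ε/2. The product measure
encodes the independence of τ. -/
theorem integral_prod_uniformOn_le {Ω : Type*} [MeasurableSpace Ω] {μ : Measure Ω}
    [IsProbabilityMeasure μ] {h : ℕ → Ω → ℝ} (mh : ∀ t, Measurable (h t)) (h0 : ∀ t ω, 0 ≤ h t ω)
    {C : ℝ} (hC : ∀ t ω, h t ω ≤ C) {T : ℕ} (hT : 1 ≤ T) {ε : ℝ} (hε : 0 < ε)
    (hA : ∑ k ∈ Finset.range T, ∫ ω, h (k + 1) ω ^ 2 ∂μ ≤ ε ^ 2 * T) :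
    Integrable (fun q : Ω × ℕ => h q.2 q.1) (μ.prod (uniformOn (Set.Icc 1 T))) ∧
      ∫ q : Ω × ℕ, h q.2 q.1 ∂(μ.prod (uniformOn (Set.Icc 1 T))) ≤ ε := by
  have hT0 : (0 : ℝ) < T := by exact_mod_cast hT
  have : IsProbabilityMeasure (uniformOn (Set.Icc 1 T)) :=
    isProbabilityMeasure_uniformOn (Set.finite_Icc 1 T) (Set.nonempty_Icc.2 hT)
  have bd : ∀ t ω, ‖h t ω‖ ≤ C := fun t ω => by
    rw [Real.norm_of_nonneg (h0 t ω)]; exact hC t ω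
  have hint : Integrable (fun q : Ω × ℕ => h q.2 q.1) (μ.prod (uniformOn (Set.Icc 1 T))) :=
    Integrable.of_bound (measurable_from_prod_countable_left mh).aestronglyMeasurable C
      (ae_of_all _ fun q => bd _ _)
  refine ⟨hint, ?_⟩
  rw [integral_prod_symm _ hint, integral_uniformOn_Icc T fun t => ∫ ω, h t ω ∂μ]
  have i1 : ∀ t, Integrable (h t) μ := fun t =>
    Integrable.of_bound (mh t).aestronglyMeasurable C (ae_of_all _ (bd t))
  have i2 : ∀ t, Integrable (fun ω => h t ω ^ 2) μ := fun t =>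
    Integrable.of_bound ((mh t).pow_const 2).aestronglyMeasurable (C ^ 2)
      (ae_of_all _ fun ω => by
        rw [norm_pow]; exact pow_le_pow_left₀ (norm_nonneg _) (bd t ω) 2)
  have young : ∀ y : ℝ, y ≤ ε / 2 + 1 / (2 * ε) * y ^ 2 := fun y => by
    have h1 : ε / 2 + 1 / (2 * ε) * y ^ 2 - y = (y - ε) ^ 2 / (2 * ε) := by field_simp; ring
    have h2 : 0 ≤ (y - ε) ^ 2 / (2 * ε) := by positivity
    linarith
  have mean_le : ∀ t, ∫ ω, h t ω ∂μ ≤ ε / 2 + 1 / (2 * ε) * ∫ ω, h t ω ^ 2 ∂μ := fun t => by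
    have e : ε / 2 + 1 / (2 * ε) * ∫ ω, h t ω ^ 2 ∂μ
        = ∫ ω, (ε / 2 + 1 / (2 * ε) * h t ω ^ 2) ∂μ := by
      rw [integral_add (integrable_const _) ((i2 t).const_mul _), integral_const_mul]
      simp
    rw [e]
    exact integral_mono (i1 t) ((integrable_const _).add ((i2 t).const_mul _)) fun ω => young _
  calc 1 / (T : ℝ) * ∑ k ∈ Finset.range T, ∫ ω, h (k + 1) ω ∂μ
      ≤ 1 / (T : ℝ) * ∑ k ∈ Finset.range T, (ε / 2
        + 1 / (2 * ε) * ∫ ω, h (k + 1) ω ^ 2 ∂μ) :=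
        mul_le_mul_of_nonneg_left (Finset.sum_le_sum fun k _ => mean_le _) (by positivity)
    _ = ε / 2 + 1 / (2 * ε) * ((∑ k ∈ Finset.range T, ∫ ω, h (k + 1) ω ^ 2 ∂μ) / T) := by
        rw [Finset.sum_add_distrib, ← Finset.mul_sum]
        simp only [Finset.sum_const, Finset.card_range, nsmul_eq_mul]
        field_simp
    _ ≤ ε / 2 + 1 / (2 * ε) * ε ^ 2 := by
        gcongr
        rw [div_le_iff₀ hT0]; exact hA
    _ = ε := by field_simp; ring

end MSVR

/-! ### Assembly -/

theorem mainTheorem3 (Cf Lf Cg Lg : ℝ≥0) (σ : ℝ) :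
    ∃ cα cβ ca : ℝ, 0 < cα ∧ 0 < cβ ∧ 0 < ca ∧
    ∀ Δ V : ℝ, ∃ K : ℝ, 0 < K ∧
    ∀ (v : MSVR.Variant) (d p m B₁ B₂ : ℕ), 1 ≤ B₁ → B₁ ≤ m → 1 ≤ B₂ →
    ∀ (Ω S : Type*) [MeasurableSpace Ω] [MeasurableSpace S]
      (μ : Measure Ω) [IsProbabilityMeasure μ]
      (f : Fin m → MSVR.Vec p → ℝ) (g : Fin m → MSVR.Vec d → MSVR.Vec p)
      (G : Fin m → MSVR.Vec d → S → MSVR.Vec p)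
      (J : Fin m → MSVR.Vec d → S → (MSVR.Vec d →L[ℝ] MSVR.Vec p))
      (blocks : ℕ → Ω → Finset (Fin m)) (ξ : ℕ → Ω → Fin m → S)
      (w₁ : MSVR.Vec d) (u₁ : Ω → Fin m → MSVR.Vec p) (z₁ : Ω → MSVR.Vec d),
    MSVR.Regular Cf Lf Cg Lg f g →
    MSVR.Oracle μ Cg Lg σ B₂ g G J ξ →
    MSVR.Sampling μ B₁ blocks ξ u₁ z₁ →
    MSVR.Init μ v (Cf * Cg) Δ V B₂ f g w₁ u₁ z₁ →
    ∀ ε : ℝ, 0 < ε → (B₂ : ℝ) ≤ 1 / ε ^ 2 →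
    ∀ T : ℕ,
      K * max ((m : ℝ) / (B₁ * √(B₂ : ℝ) * ε ^ 3) * (1 + Real.log (1 / ε)) ^ (3 / 2 : ℝ))
          (1 / (min (B₁ : ℝ) (B₂ : ℝ) * ε ^ 4) * (1 + Real.log (1 / ε)) ^ 2) ≤ T →
      Integrable
        (fun q : Ω × ℕ => ‖∇ (MSVR.objective f g)
          (MSVR.run v B₁ B₂ (Cf * Cg) cα cβ ca f G J ⟨w₁, u₁ q.1, z₁ q.1⟩
            (fun t => blocks t q.1) (fun t => ξ t q.1) q.2).w‖)
        (μ.prod (uniformOn (Set.Icc 1 T))) ∧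
      ∫ q : Ω × ℕ, ‖∇ (MSVR.objective f g)
          (MSVR.run v B₁ B₂ (Cf * Cg) cα cβ ca f G J ⟨w₁, u₁ q.1, z₁ q.1⟩
            (fun t => blocks t q.1) (fun t => ξ t q.1) q.2).w‖
        ∂(μ.prod (uniformOn (Set.Icc 1 T))) ≤ ε := by
  obtain ⟨N, c, cα, cβ, hsch⟩ := MSVR.exists_schedule Cf Lf Cg Lg σ
  have hN1 := hsch.one_le_N
  have hc0 := hsch.c_pos
  have hcα0 := hsch.cα_pos
  refine ⟨cα, cβ, N ^ 3, hcα0, by linarith [hsch.one_le_cβ], by positivity, fun Δ V => ?_⟩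
  -- Absolute values, since `K` is chosen before the signs of Δ and V are known.
  set M₀ : ℝ := |Δ| + 1 / cα * |V| + 2 * c * N ^ 3 * |V| with hM₀
  set Cn : ℝ := cα * ((Cf * Cg) ^ 2 + Cf ^ 2 * σ ^ 2) + 4 * c * cβ ^ 2 * σ ^ 2 with hCn
  have hM₀0 : 0 ≤ M₀ := by positivity
  have hCn0 : 0 ≤ Cn := by positivity
  refine ⟨N ^ 3 + 64 * (26 * (M₀ + Cn) + 1) ^ 4, by positivity, ?_⟩
  intro v d p m B₁ B₂ h₁ hm h₂ Ω S _ _ μ _ f g G J blocks ξ w₁ u₁ z₁ hr H HS hI ε hε hB T hT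
  have hK4 : 0 ≤ 64 * (26 * (M₀ + Cn) + 1) ^ 4 := by positivity
  have hN3 : 0 ≤ N ^ 3 := by positivity
  obtain ⟨hT1, hstep⟩ := MSVR.le_stepSize_of_iterations (M := M₀ + Cn) (by positivity) hN1
    (by linarith) (by linarith) h₁ hm h₂ hε hB hT
  have hm1 : 1 ≤ m := h₁.trans hm
  have h0m : (0 : ℝ) < m := by exact_mod_cast hm1
  have h0 : (0 : ℝ) < B₁ := by exact_mod_cast h₁
  have mX : ∀ t, Measurable (MSVR.trajectory v B₁ B₂ (Cf * Cg) cα cβ (N ^ 3) f G J w₁ u₁ z₁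
      blocks ξ t) := by
    intro t
    match t with
    -- The dummy state at time 0 coincides with the state at time 1.
    | 0 => exact (MSVR.trajectory_measurable_indep (cα := cα) (cβ := cβ) H hr HS hI (N ^ 3) 0).1
    | t + 1 =>
      exact (MSVR.trajectory_measurable_indep (cα := cα) (cβ := cβ) H hr HS hI (N ^ 3) t).1
  have hsum := MSVR.sum_integral_gradient_le H hr HS hI hsch h₁ hm h₂ rfl T
  set a : ℝ := N ^ 3 * (m * B₂ / B₁) with ha
  have ha0 : 0 ≤ a := by positivity
  have hlog : 0 ≤ Real.log (1 + T / a) := Real.log_nonneg (by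
    have : 0 ≤ T / a := by positivity
    linarith)
  have hΛ : Δ + 1 / cα * V + 2 * c * N ^ 3 * V + Cn * Real.log (1 + T / a)
      ≤ (M₀ + Cn) * (1 + Real.log (1 + T / a)) := by
    have e1 : Δ + 1 / cα * V + 2 * c * N ^ 3 * V ≤ M₀ := by
      rw [hM₀]; gcongr <;> exact le_abs_self _
    have e2 := mul_nonneg hM₀0 hlog
    calc _ ≤ M₀ + Cn * Real.log (1 + T / a) := by gcongr
      _ ≤ M₀ + Cn * Real.log (1 + T / a) + (Cn + M₀ * Real.log (1 + T / a)) :=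
        le_add_of_nonneg_right (add_nonneg hCn0 e2)
      _ = _ := by ring
  have mh : ∀ t, Measurable fun ω => ‖∇ (MSVR.objective f g)
      (MSVR.trajectory v B₁ B₂ (Cf * Cg) cα cβ (N ^ 3) f G J w₁ u₁ z₁ blocks ξ t ω).w‖ := fun t =>
    ((hr.continuous_gradient_objective hm1).measurable.comp
      (MSVR.measurable_state_w.comp (mX t))).norm
  refine MSVR.integral_prod_uniformOn_le mh (fun _ _ => norm_nonneg _)
    (fun _ _ => hr.norm_gradient_objective_le hm1 _) hT1 hε ?_
  have hη := MSVR.stepSize_pos h₁ hm h₂ (a := a) (t := T) (by positivity)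
  rw [div_le_iff₀ (by positivity)] at hstep
  refine le_of_mul_le_mul_left ((hsum.trans hΛ).trans ?_) (half_pos hη)
  rw [div_mul_eq_mul_div, le_div_iff₀ two_pos, mul_comm]
  exact hstep
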